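/- Let $k$ be a field of characteristic zero and let $V,W$ be nonzero finite dimensional $k$-linear spaces. Write $\mathcal L(X)$ for the algebra of linear endomorphisms of $X$, and $t:\mathcal L(X)\to\mathcal L(X^*)$ for the transposition. Let $u\in\mathcal L(V)\otimes\mathcal L(W)$ be an invertible element satisfying $$(t\otimes id)u^{-1}=((t\otimes id)u)^{-1}.\qquad(\star)$$ *Models.* A corepresentation of a Hopf $k$-algebra $H$ is an element $v\in\mathcal L(X)\otimes H$, with $X$ a finite dimensional linear space, such that $(id\otimes\Delta)v=v_{12}v_{13}$ and $(id\otimes\varepsilon)v=1$; its contragredient is $\hat v=(t\otimes S)v\in\mathcal L(X^*)\otimes H$. A model for an element $w\in\mathcal L(X)\otimes\mathcal L(Y)$ is a triple $(H,v,\pi)$ consisting of a Hopf $k$-algebra $H$, a corepresentation $v\in\mathcal L(X)\otimes H$ and a morphism of algebras $\pi:H\to\mathcal L(Y)$ such that $(id\otimes\pi)v=w$. It is left-faithful if $H$ is generated as an algebra by $\bigcup_{n\ge 0}S^n(\mathcal C_v)$, where $\mathcal C_v=\{(f\otimes id)v\mid f\in\mathcal L(X)^*\}$. A morphism $(H_1,v_1,\pi_1)\to(H_2,v_2,\pi_2)$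 of left-faithful models is a Hopf algebra morphism $f:H_1\to H_2$ such that $(id\otimes f)v_1=v_2$ and $\pi_1=\pi_2f$. The minimal model for $w$ is the terminal object of the category of left-faithful models for $w$. *The lattice $L(v)$.* For $x\in\mathcal L(X)\otimes H$ and $y\in\mathcal L(Y)\otimes H$ let $x\otimes y=x_{13}y_{23}\in\mathcal L(X\otimes Y)\otimes H$ and $End(x)=\{T\in\mathcal L(X)\mid (T\otimes 1)x=x(T\otimes 1)\}$. For a corepresentation $v$ and $0\le j\le i$, the algebra of $L(v)$ on the position $(i,-j)$ is $End(r_{j,i})$, where $r_{j,i}$ is the alternating tensor product of $v$ and $\hat v$ with $i-j$ terms which begins with $v$ if $j$ is even and with $\hat v$ if $j$ is odd (for $i=j$ it is the unit $1\in\mathcal L(k)\otimes H$, so that $End(r_{i,i})=k$). The inclusions are $T\mapsto T\otimes id$ from $(i,-j)$ to $(i+1,-j)$ and $T\mapsto id\otimes T$ from $(i,-j-1)$ to $(i,-j)$. *The lattice $L(\Box_u)$.* Let $\Box_u$ be the square of algebras $$A_{01}=k\otimes\mathcal L(W)\subset A_{11}=\mathcal L(V)\otimes\mathcal L(W),\qquad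 A_{00}=k\subset A_{10}=u(\mathcal L(V)\otimes k)u^{-1},$$ with the normalized trace of $A_{11}$. Perform successive basic constructions: for $i\ge1$, $e_i$ is the conditional expectation $A_{i1}\to A_{i-1,1}$ with respect to the trace of $A_{i1}$, viewed as a linear endomorphism of $A_{i1}$; $A_{i+1,1}=\langle A_{i1},e_i\rangle$ is the algebra of linear endomorphisms of $A_{i1}$ generated by $A_{i1}$ (acting by left multiplication) and by $e_i$, with the Markov extension of the trace of $A_{i1}$, i.e. the trace on $A_{i+1,1}$ which extends that of $A_{i1}$ and for which there is a nonzero scalar $\beta$ such that $\beta\,tr(be_i)=tr(b)$ for all $b\in A_{i1}$; and $A_{i+1,0}$ is the subalgebra of $A_{i+1,1}$ generated by $A_{i0}$ and $e_i$. The lattice $L(\Box_u)$ of higher relative commutants of the vertical inclusion associated to $\Box_u$ has the algebra $A_{j1}'\cap A_{i0}$ (commutant taken in $A_{i1}$) on the position $(i,-j)$, for $0\le j\le i$, and its inclusions are those induced by $A_{i1}\subset A_{i+1,1}$ (from $(i,-j)$ to $(i+1,-j)$) and by $A_{j1}\subset A_{j+1,1}$ (from $(i,-j-1)$ to $(i,-j)$).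 **Theorem.** Let $(H,v,\pi)$ be the minimal model for the element $$u'=u_{12}((id\otimes t)u^{-1})_{13}\in\mathcal L(V)\otimes\mathcal L(W)\otimes\mathcal L(W^*)=\mathcal L(V)\otimes\mathcal L(W\otimes W^*).$$ Then the lattices $L(\Box_u)$ and $L(v)$ are equal, in the sense that there is a family of isomorphisms of $k$-algebras $$\Phi_{ij}:A_{j1}'\cap A_{i0}\to End(r_{j,i})\qquad(0\le j\le i)$$ which commute with all the horizontal and vertical inclusions of the two lattices. -/

import Mathlib

open scoped TensorProduct

universe u

noncomputable section

namespace VertexModel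

/-! ### Transposition, leg notation, and the equation `(⋆)` -/

section Star

variable {k V W : Type u} [Field k] [AddCommGroup V] [Module k V] [AddCommGroup W] [Module k W]

/-- `t ⊗ id : L(V) ⊗ A → L(V*) ⊗ A`. -/
def transposeLeft (A : Type u) [Ring A] [Algebra k A] :
    Module.End k V ⊗[k] A →ₗ[k] Module.End k (Module.Dual k V) ⊗[k] A :=
  LinearMap.rTensor A (Module.Dual.transpose (R := k) (M := V) (M' := V))

/-- `id ⊗ t : A ⊗ L(W) → A ⊗ L(W*)`. -/
def transposeRight (A : Type u) [Ring A] [Algebra k A] :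
    A ⊗[k] Module.End k W →ₗ[k] A ⊗[k] Module.End k (Module.Dual k W) :=
  LinearMap.lTensor A (Module.Dual.transpose (R := k) (M := W) (M' := W))

/-- The equation `(t ⊗ id)(u⁻¹) = ((t ⊗ id)u)⁻¹` for an invertible `u ∈ L(V) ⊗ L(W)`: the element
`(t ⊗ id)(u⁻¹)` is a two-sided inverse of `(t ⊗ id)u`. -/
def SatisfiesStar (u : (Module.End k V ⊗[k] Module.End k W)ˣ) : Prop :=
  transposeLeft (Module.End k W) (u : Module.End k V ⊗[k] Module.End k W) *
      transposeLeft (Module.End k W) (↑u⁻¹ : Module.End k V ⊗[k] Module.End k W) = 1 ∧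
    transposeLeft (Module.End k W) (↑u⁻¹ : Module.End k V ⊗[k] Module.End k W) *
      transposeLeft (Module.End k W) (u : Module.End k V ⊗[k] Module.End k W) = 1

/-- `u' = u₁₂ ((id ⊗ t)u⁻¹)₁₃ ∈ L(V) ⊗ L(W ⊗ W*)`. -/
def uPrime (u : (Module.End k V ⊗[k] Module.End k W)ˣ) :
    Module.End k V ⊗[k] Module.End k (W ⊗[k] Module.Dual k W) :=
  Algebra.TensorProduct.map (AlgHom.id k (Module.End k V))
      (Module.End.rTensorAlgHom k W (Module.Dual k W))
      (u : Module.End k V ⊗[k] Module.End k W) *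
    Algebra.TensorProduct.map (AlgHom.id k (Module.End k V))
      (Module.End.lTensorAlgHom k (Module.Dual k W) W)
      (transposeRight (Module.End k V) (↑u⁻¹ : Module.End k V ⊗[k] Module.End k W))

end Star

/-! ### Corepresentations and models -/

section Models

variable {k V W H : Type u} [Field k] [AddCommGroup V] [Module k V] [AddCommGroup W] [Module k W]
  [Ring H] [HopfAlgebra k H]

/-- `v ∈ L(V) ⊗ H` is a corepresentation: `(id ⊗ Δ)v = v₁₂ v₁₃` and `(id ⊗ ε)v = 1`. -/
def IsCorep (v : Module.End k V ⊗[k] H) : Prop :=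
  LinearMap.lTensor (Module.End k V) (Coalgebra.comul (R := k) (A := H)) v =
      Algebra.TensorProduct.map (AlgHom.id k (Module.End k V))
        (Algebra.TensorProduct.includeLeft : H →ₐ[k] H ⊗[k] H) v *
      Algebra.TensorProduct.map (AlgHom.id k (Module.End k V))
        (Algebra.TensorProduct.includeRight : H →ₐ[k] H ⊗[k] H) v ∧
    TensorProduct.rid k (Module.End k V)
      (LinearMap.lTensor (Module.End k V) (Coalgebra.counit (R := k) (A := H)) v) = 1

/-- The set of coefficients `C_v = {(f ⊗ id)v | f ∈ L(V)*}`. -/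
def coeffs (v : Module.End k V ⊗[k] H) : Set H :=
  Set.range fun f : Module.Dual k (Module.End k V) => TensorProduct.lid k H (LinearMap.rTensor H f v)

/-- The contragredient `v̂ = (t ⊗ S)v ∈ L(V*) ⊗ H`. -/
def contragredient (v : Module.End k V ⊗[k] H) : Module.End k (Module.Dual k V) ⊗[k] H :=
  TensorProduct.map (Module.Dual.transpose (R := k) (M := V) (M' := V)) (HopfAlgebra.antipode k) v

/-- `(H, v, π)` is a model for `u`: `v` is a corepresentation of `H`, `π` is a representation of `H`
and `(id ⊗ π)v = u`. -/
def IsModel (u : Module.End k V ⊗[k] Module.End k W) (v : Module.End k V ⊗[k] H)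
    (π : H →ₐ[k] Module.End k W) : Prop :=
  IsCorep v ∧ Algebra.TensorProduct.map (AlgHom.id k (Module.End k V)) π v = u

/-- The subalgebra generated by `⋃ₙ Sⁿ(C_v)` is the whole of `H`. -/
def IsLeftFaithful (v : Module.End k V ⊗[k] H) : Prop :=
  Algebra.adjoin k (⋃ n : ℕ, (HopfAlgebra.antipode k (A := H))^[n] '' coeffs v) = ⊤

/-- `(H, v, π)` is the minimal model for `u`: the universally attracting (terminal) object of the
category of left-faithful models for `u`, with Hopf algebra morphisms `f` such that
`(id ⊗ f)w = v` and `ρ = π ∘ f` as morphisms `(K, w, ρ) → (H, v, π)`. -/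
def IsMinimalModel (u : Module.End k V ⊗[k] Module.End k W) (v : Module.End k V ⊗[k] H)
    (π : H →ₐ[k] Module.End k W) : Prop :=
  (IsModel u v π ∧ IsLeftFaithful v) ∧
    ∀ (K : Type u) [Ring K] [HopfAlgebra k K] (w : Module.End k V ⊗[k] K)
      (ρ : K →ₐ[k] Module.End k W), IsModel u w ρ → IsLeftFaithful w →
        ∃! f : K →ₐc[k] H,
          Algebra.TensorProduct.map (AlgHom.id k (Module.End k V)) (f : K →ₐ[k] H) w = v ∧
            ρ = π.comp (f : K →ₐ[k] H)

end Models

/-! ### The tensor category of elements of `L(X) ⊗ A` and the lattice `L(v)` -/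

/-- An element of `L(X) ⊗ A`, with `X` a linear space. -/
structure Obj (k A : Type u) [Field k] [Ring A] [Algebra k A] where
  /-- The underlying space. -/
  X : Type u
  [addCommGroup : AddCommGroup X]
  [module : Module k X]
  /-- The element. -/
  el : Module.End k X ⊗[k] A

attribute [instance] Obj.addCommGroup Obj.module

namespace Obj

variable {k A : Type u} [Field k] [Ring A] [Algebra k A]

/-- The tensor unit `1 ∈ L(k) ⊗ A`. -/
def unit (k A : Type u) [Field k] [Ring A] [Algebra k A] : Obj k A where
  X := k
  el := 1

/-- The tensor product `x ⊗ y = x₁₃ y₂₃ ∈ L(X ⊗ Y) ⊗ A`. -/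
def tensor (x y : Obj k A) : Obj k A where
  X := x.X ⊗[k] y.X
  el := Algebra.TensorProduct.map (Module.End.rTensorAlgHom k x.X y.X) (AlgHom.id k A) x.el *
    Algebra.TensorProduct.map (Module.End.lTensorAlgHom k y.X x.X) (AlgHom.id k A) y.el

/-- `End(x) = {T ∈ L(X) | (T ⊗ 1)x = x(T ⊗ 1)}`. -/
def endAlg (x : Obj k A) : Subalgebra k (Module.End k x.X) :=
  (Subalgebra.centralizer k {x.el}).comap
    (Algebra.TensorProduct.includeLeft : Module.End k x.X →ₐ[k] Module.End k x.X ⊗[k] A)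

/-- The alternating sequence `x, y, x, y, …`. -/
def alt : Obj k A → Obj k A → ℕ → Obj k A
  | x, _, 0 => x
  | x, y, n + 1 => alt y x n

/-- The alternating tensor product with `m` terms that starts with the `j`-th term of
`x, y, x, y, …`. -/
def word (x y : Obj k A) : ℕ → ℕ → Obj k A
  | _, 0 => unit k A
  | j, m + 1 => tensor (alt x y j) (word x y (j + 1) m)

/-- The index `j + m` of the term following those of `word x y j m`, written so that it unfolds
along with `word`. -/
def nextIndex : ℕ → ℕ → ℕ
  | j, 0 => j
  | j, m + 1 => nextIndex (j + 1) m

/-- The canonical identification (associativity and unit constraints only) of the word with `m + 1`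
terms with the tensor product of the word with `m` terms by its last term. -/
def wordSnoc (x y : Obj k A) : (j m : ℕ) →
    ((word x y j m).X ⊗[k] (alt x y (nextIndex j m)).X) ≃ₗ[k] (word x y j (m + 1)).X
  | j, 0 => (TensorProduct.lid k (alt x y j).X).trans (TensorProduct.rid k (alt x y j).X).symm
  | j, m + 1 =>
    (TensorProduct.assoc k (alt x y j).X (word x y (j + 1) m).X
      (alt x y (nextIndex (j + 1) m)).X).trans
      (TensorProduct.congr (LinearEquiv.refl k (alt x y j).X) (wordSnoc x y (j + 1) m))

/-- `T ↦ T ⊗ id`, a tensor factor being added on the right. -/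
def addRight (x y : Obj k A) (j m : ℕ) :
    Module.End k (word x y j m).X →ₐ[k] Module.End k (word x y j (m + 1)).X :=
  ((wordSnoc x y j m).conjAlgEquiv k : _ →ₐ[k] _).comp
    (Module.End.rTensorAlgHom k (word x y j m).X (alt x y (nextIndex j m)).X)

/-- `T ↦ id ⊗ T`, a tensor factor being added on the left. -/
def addLeft (x y : Obj k A) (j m : ℕ) :
    Module.End k (word x y (j + 1) m).X →ₐ[k] Module.End k (word x y j (m + 1)).X :=
  Module.End.lTensorAlgHom k (word x y (j + 1) m).X (alt x y j).X

theorem mem_endAlg {x : Obj k A} {T : Module.End k x.X} :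
    T ∈ x.endAlg ↔ (T ⊗ₜ[k] (1 : A)) * x.el = x.el * (T ⊗ₜ[k] (1 : A)) := by
  simp only [endAlg, Subalgebra.mem_comap, Subalgebra.mem_centralizer_iff, Set.mem_singleton_iff,
    forall_eq, Algebra.TensorProduct.includeLeft_apply]
  exact eq_comm

theorem commute_legs_left (X Y : Type u) [AddCommGroup X] [Module k X] [AddCommGroup Y] [Module k Y]
    (S : Module.End k X) (y : Module.End k Y ⊗[k] A) :
    Commute (Module.End.rTensorAlgHom k X Y S ⊗ₜ[k] (1 : A))
      (Algebra.TensorProduct.map (Module.End.lTensorAlgHom k Y X) (AlgHom.id k A) y) := by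
  induction y with
  | zero => simp
  | add a b ha hb => rw [map_add]; exact ha.add_right hb
  | tmul T a =>
    simp only [Algebra.TensorProduct.map_tmul, AlgHom.id_apply, Commute, SemiconjBy,
      Algebra.TensorProduct.tmul_mul_tmul, one_mul, mul_one]
    congr 1
    ext; rfl

theorem commute_legs_right (X Y : Type u) [AddCommGroup X] [Module k X] [AddCommGroup Y] [Module k Y]
    (T : Module.End k Y) (x : Module.End k X ⊗[k] A) :
    Commute (Module.End.lTensorAlgHom k Y X T ⊗ₜ[k] (1 : A))
      (Algebra.TensorProduct.map (Module.End.rTensorAlgHom k X Y) (AlgHom.id k A) x) := by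
  induction x with
  | zero => simp
  | add a b ha hb => rw [map_add]; exact ha.add_right hb
  | tmul S a =>
    simp only [Algebra.TensorProduct.map_tmul, AlgHom.id_apply, Commute, SemiconjBy,
      Algebra.TensorProduct.tmul_mul_tmul, one_mul, mul_one]
    congr 1
    ext; rfl

theorem lTensor_mem (x y : Obj k A) {T : Module.End k y.X} (hT : T ∈ y.endAlg) :
    Module.End.lTensorAlgHom k y.X x.X T ∈ (tensor x y).endAlg := by
  rw [mem_endAlg] at hT
  refine mem_endAlg.2 ?_
  have h2 : Commute (Module.End.lTensorAlgHom k y.X x.X T ⊗ₜ[k] (1 : A))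
      (Algebra.TensorProduct.map (Module.End.lTensorAlgHom k y.X x.X) (AlgHom.id k A) y.el) := by
    have := congrArg
      (Algebra.TensorProduct.map (Module.End.lTensorAlgHom k y.X x.X) (AlgHom.id k A)) hT
    simp only [map_mul, Algebra.TensorProduct.map_tmul, map_one] at this
    exact this
  exact (commute_legs_right x.X y.X T x.el).mul_right h2

theorem rTensor_mem (x y : Obj k A) {T : Module.End k x.X} (hT : T ∈ x.endAlg) :
    Module.End.rTensorAlgHom k x.X y.X T ∈ (tensor x y).endAlg := by
  rw [mem_endAlg] at hT
  refine mem_endAlg.2 ?_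
  have h2 : Commute (Module.End.rTensorAlgHom k x.X y.X T ⊗ₜ[k] (1 : A))
      (Algebra.TensorProduct.map (Module.End.rTensorAlgHom k x.X y.X) (AlgHom.id k A) x.el) := by
    have := congrArg
      (Algebra.TensorProduct.map (Module.End.rTensorAlgHom k x.X y.X) (AlgHom.id k A)) hT
    simp only [map_mul, Algebra.TensorProduct.map_tmul, map_one] at this
    exact this
  exact h2.mul_right (commute_legs_left x.X y.X T y.el)

/-- Transport of elements of `L(X) ⊗ A` along a linear isomorphism `X ≃ Y`. -/
abbrev cj {X Y : Type u} [AddCommGroup X] [Module k X] [AddCommGroup Y] [Module k Y]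
    (e : X ≃ₗ[k] Y) : Module.End k X ⊗[k] A →ₐ[k] Module.End k Y ⊗[k] A :=
  Algebra.TensorProduct.map (e.conjAlgEquiv k : Module.End k X →ₐ[k] Module.End k Y) (AlgHom.id k A)

theorem conj_mem (x y : Obj k A) (e : x.X ≃ₗ[k] y.X) (he : cj e x.el = y.el)
    {T : Module.End k x.X} (hT : T ∈ x.endAlg) : e.conjAlgEquiv k T ∈ y.endAlg := by
  rw [mem_endAlg] at hT ⊢
  have := congrArg (cj e) hT
  simp only [map_mul, he, Algebra.TensorProduct.map_tmul, map_one] at this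
  exact this

theorem map_eq_map_of {X Y : Type u} [AddCommGroup X] [Module k X] [AddCommGroup Y] [Module k Y]
    (f g : Module.End k X →ₐ[k] Module.End k Y) (h : ∀ T, f T = g T) (z : Module.End k X ⊗[k] A) :
    Algebra.TensorProduct.map f (AlgHom.id k A) z = Algebra.TensorProduct.map g (AlgHom.id k A) z := by
  rw [AlgHom.ext h]

theorem map_map_apply {X Y Z : Type u} [AddCommGroup X] [Module k X] [AddCommGroup Y] [Module k Y]
    [AddCommGroup Z] [Module k Z] (f : Module.End k Y →ₐ[k] Module.End k Z)
    (g : Module.End k X →ₐ[k] Module.End k Y) (z : Module.End k X ⊗[k] A) :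
    Algebra.TensorProduct.map f (AlgHom.id k A) (Algebra.TensorProduct.map g (AlgHom.id k A) z) =
      Algebra.TensorProduct.map (f.comp g) (AlgHom.id k A) z := by
  induction z with
  | zero => simp
  | add a b ha hb => simp only [map_add, ha, hb]
  | tmul T a => simp

theorem conj_eq {X Y : Type u} [AddCommGroup X] [Module k X] [AddCommGroup Y] [Module k Y]
    (e : X ≃ₗ[k] Y) (S : Module.End k X) (R : Module.End k Y)
    (h : e.toLinearMap ∘ₗ S = R ∘ₗ e.toLinearMap) : e.conjAlgEquiv k S = R := by
  ext z
  obtain ⟨z, rfl⟩ := e.surjective z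
  have := LinearMap.congr_fun h z
  simpa using this

theorem wordSnoc_el (x y : Obj k A) : (m j : ℕ) →
    cj (wordSnoc x y j m) (tensor (word x y j m) (alt x y (nextIndex j m))).el =
      (word x y j (m + 1)).el
  | 0, j => by
    change cj ((TensorProduct.lid k (alt x y j).X).trans (TensorProduct.rid k (alt x y j).X).symm)
      (Algebra.TensorProduct.map (Module.End.rTensorAlgHom k k (alt x y j).X) (AlgHom.id k A) 1 *
        Algebra.TensorProduct.map (Module.End.lTensorAlgHom k (alt x y j).X k) (AlgHom.id k A)
          (alt x y j).el) =
      Algebra.TensorProduct.map (Module.End.rTensorAlgHom k (alt x y j).X k) (AlgHom.id k A)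
          (alt x y j).el *
        Algebra.TensorProduct.map (Module.End.lTensorAlgHom k k (alt x y j).X) (AlgHom.id k A) 1
    rw [map_one, map_one, one_mul, mul_one, cj, map_map_apply]
    refine map_eq_map_of _ _ (fun T => ?_) _
    ext a
    change (TensorProduct.rid k _).symm (TensorProduct.lid k _ (Module.End.lTensorAlgHom k _ k T
      ((TensorProduct.lid k _).symm (TensorProduct.rid k _ (a ⊗ₜ[k] (1 : k)))))) = T a ⊗ₜ[k] 1
    rw [TensorProduct.rid_tmul, one_smul, TensorProduct.lid_symm_apply]
    change (TensorProduct.rid k _).symm (TensorProduct.lid k _ (1 ⊗ₜ[k] T a)) = _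
    rw [TensorProduct.lid_tmul, one_smul, TensorProduct.rid_symm_apply]
  | m + 1, j => by
    have ih := wordSnoc_el x y m (j + 1)
    set X := alt x y j
    set P := word x y (j + 1) m
    set Z := alt x y (nextIndex (j + 1) m)
    set e := wordSnoc x y (j + 1) m
    change cj ((TensorProduct.assoc k X.X P.X Z.X).trans
        (TensorProduct.congr (LinearEquiv.refl k X.X) e)) (tensor (tensor X P) Z).el =
      Algebra.TensorProduct.map (Module.End.rTensorAlgHom k X.X _) (AlgHom.id k A) X.el *
        Algebra.TensorProduct.map (Module.End.lTensorAlgHom k _ X.X) (AlgHom.id k A)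
          (word x y (j + 1) (m + 1)).el
    rw [← ih]
    simp only [tensor, map_mul, map_map_apply, mul_assoc]
    congr 1
    · refine map_eq_map_of _ _ (fun T => conj_eq _ _ _ ?_) _
      ext a b c; rfl
    congr 1
    · refine map_eq_map_of _ _ (fun T => conj_eq _ _ _ ?_) _
      ext a b c
      change a ⊗ₜ[k] e (T b ⊗ₜ[k] c) = a ⊗ₜ[k] e (Module.End.rTensorAlgHom k _ _ T (e.symm (e (b ⊗ₜ[k] c))))
      rw [e.symm_apply_apply]; rfl
    · refine map_eq_map_of _ _ (fun T => conj_eq _ _ _ ?_) _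
      ext a b c
      change a ⊗ₜ[k] e (b ⊗ₜ[k] T c) = a ⊗ₜ[k] e (Module.End.lTensorAlgHom k _ _ T (e.symm (e (b ⊗ₜ[k] c))))
      rw [e.symm_apply_apply]; rfl

theorem addLeft_mem (x y : Obj k A) (j m : ℕ) {T : Module.End k (word x y (j + 1) m).X}
    (hT : T ∈ (word x y (j + 1) m).endAlg) : addLeft x y j m T ∈ (word x y j (m + 1)).endAlg :=
  lTensor_mem _ _ hT

theorem addRight_mem (x y : Obj k A) (j m : ℕ) {T : Module.End k (word x y j m).X}
    (hT : T ∈ (word x y j m).endAlg) : addRight x y j m T ∈ (word x y j (m + 1)).endAlg :=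
  conj_mem (tensor (word x y j m) (alt x y (nextIndex j m))) _ (wordSnoc x y j m)
    (wordSnoc_el x y m j) (rTensor_mem _ _ hT)

/-- The vertical inclusion `End(s) ⊂ End(r ⊗ s)`, `T ↦ id ⊗ T`, between algebras of `L(v)`. -/
def endVert (x y : Obj k A) (j m : ℕ) :
    (word x y (j + 1) m).endAlg →ₐ[k] (word x y j (m + 1)).endAlg :=
  ((addLeft x y j m).comp (word x y (j + 1) m).endAlg.val).codRestrict _
    fun T => addLeft_mem x y j m T.2

/-- The horizontal inclusion `End(r) ⊂ End(r ⊗ s)`, `T ↦ T ⊗ id`, between algebras of `L(v)`. -/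
def endHoriz (x y : Obj k A) (j m : ℕ) :
    (word x y j m).endAlg →ₐ[k] (word x y j (m + 1)).endAlg :=
  ((addRight x y j m).comp (word x y j m).endAlg.val).codRestrict _
    fun T => addRight_mem x y j m T.2

end Obj

section Lv

variable {k V H : Type u} [Field k] [AddCommGroup V] [Module k V] [Ring H] [HopfAlgebra k H]

/-- `v ∈ L(V) ⊗ H` as an object. -/
def vObj (v : Module.End k V ⊗[k] H) : Obj k H := ⟨V, v⟩

/-- `v̂ ∈ L(V*) ⊗ H` as an object. -/
def vHatObj (v : Module.End k V ⊗[k] H) : Obj k H := ⟨Module.Dual k V, contragredient v⟩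

/-- For `j ≤ i` and `m = i - j`, the algebra of the lattice `L(v)` on the position `(i, -j)`: the
algebra `End(v ⊗ v̂ ⊗ v ⊗ ⋯)` (`m` terms) if `j` is even, `End(v̂ ⊗ v ⊗ v̂ ⊗ ⋯)` (`m` terms) if `j`
is odd. -/
abbrev latticeEnd (v : Module.End k V ⊗[k] H) (j m : ℕ) :
    Subalgebra k (Module.End k (Obj.word (vObj v) (vHatObj v) j m).X) :=
  (Obj.word (vObj v) (vHatObj v) j m).endAlg

end Lv

/-! ### Squares of algebras with a trace, basic constructions, and the lattice `L(□)` -/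

/-- A square of inclusions of algebras `A₀ = A₀₀ ⊂ A = A₀₁`, `B₀ = A₁₀ ⊂ B = A₁₁`, `A ⊂ B`,
`A₀ ⊂ B₀`, with a linear form (the trace) on the biggest algebra `B`. -/
structure Square (k : Type u) [Field k] where
  /-- `A₀₁` -/
  A : Type u
  /-- `A₁₁` -/
  B : Type u
  [ringA : Ring A]
  [ringB : Ring B]
  [algA : Algebra k A]
  [algB : Algebra k B]
  /-- the inclusion `A₀₁ ⊂ A₁₁` -/
  ι : A →ₐ[k] B
  /-- `A₀₀` -/
  A₀ : Subalgebra k A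
  /-- `A₁₀` -/
  B₀ : Subalgebra k B
  /-- `A₀₀ ⊂ A₁₀` -/
  le : A₀.map ι ≤ B₀
  /-- the trace -/
  τ : B →ₗ[k] k

attribute [instance] Square.ringA Square.ringB Square.algA Square.algB

namespace Square

variable {k : Type u} [Field k]

/-- `E : B → A` is the conditional expectation with respect to the trace. -/
def IsCondExp (s : Square k) (E : s.B →ₗ[k] s.A) : Prop :=
  ∀ (b : s.B) (a : s.A), s.τ (s.ι (E b) * s.ι a) = s.τ (b * s.ι a)

open Classical in
/-- The conditional expectation `B → A` (`0` if there is none). -/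
def condExp (s : Square k) : s.B →ₗ[k] s.A :=
  if h : ∃ E, s.IsCondExp E then h.choose else 0

/-- The Jones projection: the conditional expectation as a linear endomorphism of `B`. -/
def jones (s : Square k) : Module.End k s.B := s.ι.toLinearMap ∘ₗ s.condExp

/-- The basic construction `⟨B, e⟩` for `A ⊂ B`: the algebra of linear endomorphisms of `B` generated
by the left multiplications by elements of `B` and by the Jones projection. -/
def basic (s : Square k) : Subalgebra k (Module.End k s.B) :=
  Algebra.adjoin k (Set.range (Algebra.lmul k s.B) ∪ {s.jones})

/-- The inclusion `B ⊂ ⟨B, e⟩`. -/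
def toBasic (s : Square k) : s.B →ₐ[k] s.basic :=
  (Algebra.lmul k s.B).codRestrict s.basic
    fun b => Algebra.subset_adjoin (Or.inl ⟨b, rfl⟩)

/-- The Jones projection as an element of `⟨B, e⟩`. -/
def jonesMem (s : Square k) : s.basic := ⟨s.jones, Algebra.subset_adjoin (Or.inr rfl)⟩

/-- `σ` is a Markov extension of the trace of `B` to `⟨B, e⟩`: a trace that extends the trace of `B`
and such that `β σ(be) = τ(b)` for all `b ∈ B`, for some nonzero scalar `β`. -/
def IsMarkovExt (s : Square k) (σ : s.basic →ₗ[k] k) : Prop :=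
  (∀ x y, σ (x * y) = σ (y * x)) ∧ (∀ b, σ (s.toBasic b) = s.τ b) ∧
    ∃ β : k, β ≠ 0 ∧ ∀ b, β * σ (s.toBasic b * s.jonesMem) = s.τ b

open Classical in
/-- The Markov extension of the trace of `B` to `⟨B, e⟩` (`0` if there is none). -/
def markovExt (s : Square k) : s.basic →ₗ[k] k :=
  if h : ∃ σ, s.IsMarkovExt σ then h.choose else 0

/-- The basic construction for squares: the square `B₀ ⊂ B`, `⟨B₀, e⟩ ⊂ ⟨B, e⟩`, where `⟨B₀, e⟩` is
the subalgebra of `⟨B, e⟩` generated by `B₀` and by the Jones projection. -/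
def next (s : Square k) : Square k where
  A := s.B
  B := s.basic
  ι := s.toBasic
  A₀ := s.B₀
  B₀ := Algebra.adjoin k (s.toBasic '' (s.B₀ : Set s.B) ∪ {s.jonesMem})
  le := by
    rintro _ ⟨b, hb, rfl⟩
    exact Algebra.subset_adjoin (Or.inl ⟨b, hb, rfl⟩)
  τ := s.markovExt

/-- The sequence of iterated basic constructions; its `i`-th term is the square with sides
`A_{i0} ⊂ A_{i1}` and `A_{i+1,0} ⊂ A_{i+1,1}`. -/
def tower (s : Square k) : ℕ → Square k
  | 0 => s
  | n + 1 => (tower s n).next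

/-- The algebra `A_{i1}`. -/
abbrev upper (s : Square k) (i : ℕ) : Type u := (s.tower i).A

/-- The algebra `A_{i0}`, as a subalgebra of `A_{i1}`. -/
def lower (s : Square k) (i : ℕ) : Subalgebra k (s.upper i) := (s.tower i).A₀

/-- The inclusion `A_{i1} ⊂ A_{i+1,1}`. -/
def incl (s : Square k) (i : ℕ) : s.upper i →ₐ[k] s.upper (i + 1) := (s.tower i).ι

/-- For `j ≤ i`, the algebra `A_{j1}` as a subalgebra of `A_{i1}`. -/
def upperIn (s : Square k) (j : ℕ) : (i : ℕ) → Subalgebra k (s.upper i)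
  | 0 => ⊤
  | i + 1 => if j ≤ i then (upperIn s j i).map (s.incl i) else ⊤

/-- For `j ≤ i`, the algebra `A_{j1}' ∩ A_{i0}` of the lattice `L(□)`. -/
def relComm (s : Square k) (i j : ℕ) : Subalgebra k (s.upper i) :=
  Subalgebra.centralizer k (s.upperIn j i : Set (s.upper i)) ⊓ s.lower i

theorem incl_mem_relComm (s : Square k) {i j : ℕ} (hij : j ≤ i) {x : s.upper i}
    (hx : x ∈ s.relComm i j) : s.incl i x ∈ s.relComm (i + 1) j := by
  refine ⟨?_, (s.tower i).le ⟨x, hx.2, rfl⟩⟩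
  have h1 : s.upperIn j (i + 1) = (s.upperIn j i).map (s.incl i) := if_pos hij
  rw [h1]
  refine Subalgebra.mem_centralizer_iff k |>.2 ?_
  rintro _ ⟨a, ha, rfl⟩
  have := (Subalgebra.mem_centralizer_iff k).1 hx.1 a ha
  simpa using congrArg (s.incl i) this

theorem upperIn_le (s : Square k) (j : ℕ) : ∀ i, j + 1 ≤ i → s.upperIn j i ≤ s.upperIn (j + 1) i
  | 0, h => absurd h (by omega)
  | i + 1, h => by
    have h1 : s.upperIn j (i + 1) = (s.upperIn j i).map (s.incl i) := if_pos (by omega)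
    by_cases h2 : j + 1 ≤ i
    · have h3 : s.upperIn (j + 1) (i + 1) = (s.upperIn (j + 1) i).map (s.incl i) := if_pos h2
      rw [h1, h3]
      exact Subalgebra.map_mono (upperIn_le s j i h2)
    · have h3 : s.upperIn (j + 1) (i + 1) = ⊤ := if_neg h2
      rw [h3]
      exact le_top

theorem relComm_le (s : Square k) {i j : ℕ} (hij : j + 1 ≤ i) :
    s.relComm i (j + 1) ≤ s.relComm i j :=
  inf_le_inf_right _ (Subalgebra.centralizer_le k _ _ (s.upperIn_le j i hij))

/-- The horizontal inclusion `A_{j1}' ∩ A_{i0} ⊂ A_{j1}' ∩ A_{i+1,0}`. -/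
def horiz (s : Square k) {i j : ℕ} (hij : j ≤ i) : s.relComm i j →ₐ[k] s.relComm (i + 1) j :=
  ((s.incl i).comp (s.relComm i j).val).codRestrict _ fun x => s.incl_mem_relComm hij x.2

/-- The vertical inclusion `A_{j+1,1}' ∩ A_{i0} ⊂ A_{j1}' ∩ A_{i0}`. -/
def vert (s : Square k) {i j : ℕ} (hij : j + 1 ≤ i) : s.relComm i (j + 1) →ₐ[k] s.relComm i j :=
  Subalgebra.inclusion (s.relComm_le hij)

end Square

section Box

variable {k V W : Type u} [Field k] [AddCommGroup V] [Module k V] [AddCommGroup W] [Module k W]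

/-- `ad(u) : x ↦ u x u⁻¹`. -/
def ad {B : Type u} [Ring B] [Algebra k B] (u : Bˣ) : B →ₐ[k] B where
  toFun x := u * x * (↑u⁻¹ : B)
  map_one' := by simp
  map_mul' x y := by simp [mul_assoc]
  map_zero' := by simp
  map_add' x y := by simp [mul_add, add_mul]
  commutes' r := by
    rw [← Algebra.commutes, mul_assoc, Units.mul_inv, mul_one]

/-- The square `□_u`, with `A₀₀ = k`, `A₀₁ = k ⊗ L(W)`, `A₁₀ = u(L(V) ⊗ k)u⁻¹` and
`A₁₁ = L(V) ⊗ L(W)`, and with the normalized trace of `L(V) ⊗ L(W)`. -/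
def box (u : (Module.End k V ⊗[k] Module.End k W)ˣ) : Square k where
  A := (Algebra.TensorProduct.includeRight :
    Module.End k W →ₐ[k] Module.End k V ⊗[k] Module.End k W).range
  B := Module.End k V ⊗[k] Module.End k W
  ι := Subalgebra.val _
  A₀ := ⊥
  B₀ := (Algebra.TensorProduct.includeLeft :
    Module.End k V →ₐ[k] Module.End k V ⊗[k] Module.End k W).range.map (ad u)
  le := by simp
  τ := ((Module.finrank k V * Module.finrank k W : k)⁻¹) •
    (LinearMap.mul' k k ∘ₗ TensorProduct.map (LinearMap.trace k V) (LinearMap.trace k W))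

end Box

end VertexModel

end

/-! Write X_i for the alternating tensor product V ⊗ V* ⊗ V ⊗ ⋯ with i factors, û = (t ⊗ id)u⁻¹, and
U_i ∈ L(X_i) ⊗ L(W) for the alternating product u ⊗ û ⊗ u ⊗ ⋯. Both lattices live inside the
algebras L(X), X an alternating product, and both are cut out by the same condition `Conjugable`:
the operator T satisfies U⁻¹(T ⊗ 1)U ∈ L(X) ⊗ 1 for the corresponding product U.

Tower side. Bending the last leg identifies L(X_{i+1}) with Hom(X_i, X_{i+2}). Under this
identification the conditional expectation onto L(X_i) becomes left composition with d⁻¹ cup ∘ cap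
on the last two factors, d = dim V, so the basic construction of L(X_i) ⊂ L(X_{i+1}) is L(X_{i+2}),
and A_{i1} = L(X_i) ⊗ L(W). Equation (⋆) makes cup ∘ cap commute with u ⊗ û and û ⊗ u; the Jones
projections are then fixed by conjugation by the U_i, so that A_{i0} = U_i(L(X_i) ⊗ 1)U_i⁻¹
(`stage`). The commutant of A_{j1} in A_{i1} consists of the operators on the last i - j factors
(`mem_centralizer_upperIn_iff`). Such an operator lies in A_{i0} exactly when it is conjugable for
U_i, and the first j factors of U_i cancel from this condition (`conjugable_emb_iff`).

Hopf side. For a corepresentation r, the coefficients of the commutator of r with T ⊗ 1 generate a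
Hopf ideal; if π kills it, minimality forces it to vanish. Hence r and (id ⊗ π)r have the same
endomorphisms (`IsMinimalModel.commute_of_commute_mapR`). For r an alternating product of v and v̂,
(id ⊗ π)r is the element U' = U₁₂G₁₃ attached to the product U of the u and û (`mapR_word`).
Commuting with U₁₂G₁₃ means U₁₂⁻¹TU₁₂ = G₁₃TG₁₃⁻¹; the two sides have disjoint legs W and W*, so
both must be of the form S ⊗ 1 ⊗ 1, which is conjugability (`commute_uPrime_iff`).

Both identifications are compatible with adding a factor on the right or on the left, hence so is
the isomorphism of lattices (`exists_lattice_equiv`). -/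

noncomputable section

namespace VertexModel

set_option linter.unusedSectionVars false

/-! ### Slicing tensors by linear forms -/

section Coefficients

variable {k M A B : Type u} [Field k] [AddCommGroup M] [Module k M] [Ring A] [Algebra k A]
  [Ring B] [Algebra k B]

/-- `(f ⊗ id)z` for a linear form `f`. -/
def coeff (f : Module.Dual k M) : M ⊗[k] A →ₗ[k] A :=
  (TensorProduct.lid k A).toLinearMap ∘ₗ LinearMap.rTensor A f

@[simp]
theorem coeff_tmul (f : Module.Dual k M) (m : M) (a : A) :
    coeff f (m ⊗ₜ[k] a) = f m • a := by
  simp [coeff]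

theorem coeff_lTensor (f : Module.Dual k M) (q : A →ₗ[k] B) (z : M ⊗[k] A) :
    coeff f (LinearMap.lTensor M q z) = q (coeff f z) := by
  induction z with
  | zero => simp
  | add a b ha hb => simp only [map_add, ha, hb]
  | tmul m a => simp

theorem eq_zero_of_coeff (z : M ⊗[k] A) (h : ∀ f : Module.Dual k M, coeff f z = 0) : z = 0 := by
  classical
  let b := Module.Basis.ofVectorSpace k M
  refine (TensorProduct.equivFinsuppOfBasisLeft b (N := A)).injective ?_
  ext i
  rw [TensorProduct.equivFinsuppOfBasisLeft_apply, map_zero]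
  exact h (b.coord i)

theorem lTensor_eq_zero_iff (q : A →ₗ[k] B) (z : M ⊗[k] A) :
    LinearMap.lTensor M q z = 0 ↔ ∀ f : Module.Dual k M, q (coeff f z) = 0 := by
  constructor
  · intro h f
    rw [← coeff_lTensor, h, map_zero]
  · intro h
    refine eq_zero_of_coeff _ fun f => ?_
    rw [coeff_lTensor, h]

end Coefficients

/-! ### Algebra morphisms applied to one leg -/

section Legs

variable {k X Y A B C : Type u} [Field k] [AddCommGroup X] [Module k X] [AddCommGroup Y]
  [Module k Y] [Ring A] [Algebra k A] [Ring B] [Algebra k B] [Ring C] [Algebra k C]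

/-- `id ⊗ f` for a morphism of algebras `f`. -/
abbrev mapR (X : Type u) [AddCommGroup X] [Module k X] (f : A →ₐ[k] B) :
    Module.End k X ⊗[k] A →ₐ[k] Module.End k X ⊗[k] B :=
  Algebra.TensorProduct.map (AlgHom.id k (Module.End k X)) f

/-- `f ⊗ id` for a morphism of algebras `f`. -/
abbrev mapL (f : Module.End k X →ₐ[k] Module.End k Y) (A : Type u) [Ring A] [Algebra k A] :
    Module.End k X ⊗[k] A →ₐ[k] Module.End k Y ⊗[k] A :=
  Algebra.TensorProduct.map f (AlgHom.id k A)

theorem mapR_eq_lTensor (f : A →ₐ[k] B) (z : Module.End k X ⊗[k] A) :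
    mapR X f z = LinearMap.lTensor (Module.End k X) f.toLinearMap z := rfl

theorem mapR_mapR (g : B →ₐ[k] C) (f : A →ₐ[k] B) (z : Module.End k X ⊗[k] A) :
    mapR X g (mapR X f z) = mapR X (g.comp f) z := by
  induction z with
  | zero => simp
  | add a b ha hb => simp only [map_add, ha, hb]
  | tmul T a => simp

theorem mapR_mapL (g : Module.End k X →ₐ[k] Module.End k Y) (f : A →ₐ[k] B)
    (z : Module.End k X ⊗[k] A) : mapR Y f (mapL g A z) = mapL g B (mapR X f z) := by
  induction z with
  | zero => simp
  | add a b ha hb => simp only [map_add, ha, hb]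
  | tmul T a => simp

end Legs

/-! ### Corepresentations: inverses, tensor products, contragredients -/

section Corep

variable {k X Y H : Type u} [Field k] [AddCommGroup X] [Module k X] [AddCommGroup Y] [Module k Y]
  [Ring H] [HopfAlgebra k H]

/-- The antipode applied to the second leg. -/
abbrev antipodeR (r : Module.End k X ⊗[k] H) : Module.End k X ⊗[k] H :=
  LinearMap.lTensor (Module.End k X) (HopfAlgebra.antipode k (A := H)) r

theorem isCorep_iff (r : Module.End k X ⊗[k] H) :
    IsCorep r ↔
      mapR X (Bialgebra.comulAlgHom k H) r =
          mapR X (Algebra.TensorProduct.includeLeft : H →ₐ[k] H ⊗[k] H) r *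
            mapR X (Algebra.TensorProduct.includeRight : H →ₐ[k] H ⊗[k] H) r ∧
        mapR X (Bialgebra.counitAlgHom k H) r = 1 := by
  refine and_congr Iff.rfl ?_
  rw [← (TensorProduct.rid k (Module.End k X)).injective.eq_iff]
  have : TensorProduct.rid k (Module.End k X) (1 : Module.End k X ⊗[k] k) = 1 := by
    rw [Algebra.TensorProduct.one_def, TensorProduct.rid_tmul, one_smul]
  rw [this]
  rfl

/-- For r = a = b a corepresentation the left side is the convolution of φ and ψ evaluated on r.
Taking id and the antipode, the Hopf axiom turns into the statement that (id ⊗ S)r is the inverse of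
r. -/
theorem lTensor_mul_legs (φ ψ : H →ₗ[k] H) (a b : Module.End k X ⊗[k] H) :
    LinearMap.lTensor (Module.End k X) (LinearMap.mul' k H ∘ₗ TensorProduct.map φ ψ)
        (mapR X (Algebra.TensorProduct.includeLeft : H →ₐ[k] H ⊗[k] H) a *
          mapR X (Algebra.TensorProduct.includeRight : H →ₐ[k] H ⊗[k] H) b) =
      LinearMap.lTensor _ φ a * LinearMap.lTensor _ ψ b := by
  induction a with
  | zero => simp
  | add a a' ha ha' => simp only [map_add, add_mul, ha, ha']
  | tmul S h =>
    induction b with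
    | zero => simp
    | add a a' ha ha' => simp only [map_add, mul_add, ha, ha']
    | tmul T h' => simp

theorem IsCorep.lTensor_counit {r : Module.End k X ⊗[k] H} (hr : IsCorep r) :
    LinearMap.lTensor (Module.End k X) (Algebra.linearMap k H ∘ₗ Coalgebra.counit) r = 1 := by
  have h := congrArg (mapR X (Algebra.ofId k H)) ((isCorep_iff r).1 hr).2
  rw [map_one, mapR_mapR] at h
  exact h

theorem IsCorep.mul_antipodeR {r : Module.End k X ⊗[k] H} (hr : IsCorep r) :
    r * antipodeR r = 1 := by
  have h := lTensor_mul_legs LinearMap.id (HopfAlgebra.antipode k (A := H)) r r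
  rw [← ((isCorep_iff r).1 hr).1] at h
  rw [LinearMap.lTensor_id, LinearMap.id_apply] at h
  rw [← h, ← hr.lTensor_counit, mapR_eq_lTensor, ← LinearMap.comp_apply, ← LinearMap.lTensor_comp]
  congr 2
  ext x
  exact (HopfAlgebra.mul_antipode_lTensor_comul_apply x)

theorem IsCorep.antipodeR_mul {r : Module.End k X ⊗[k] H} (hr : IsCorep r) :
    antipodeR r * r = 1 := by
  have h := lTensor_mul_legs (HopfAlgebra.antipode k (A := H)) LinearMap.id r r
  rw [← ((isCorep_iff r).1 hr).1] at h
  rw [LinearMap.lTensor_id, LinearMap.id_apply] at h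
  rw [← h, ← hr.lTensor_counit, mapR_eq_lTensor, ← LinearMap.comp_apply, ← LinearMap.lTensor_comp]
  congr 2
  ext x
  exact (HopfAlgebra.mul_antipode_rTensor_comul_apply x)

theorem isCorep_one : IsCorep (1 : Module.End k X ⊗[k] H) := by
  rw [isCorep_iff]
  simp only [map_one, mul_one, and_self]

/-- Elements of the two legs of a tensor product, with disjoint legs in the algebra, commute. -/
theorem commute_legs (A : Type u) {B C : Type u} [Ring A] [Algebra k A] [Ring B] [Algebra k B]
    [Ring C] [Algebra k C] (f : B →ₐ[k] A) (g : C →ₐ[k] A) (hfg : ∀ b c, Commute (f b) (g c))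
    (a : Module.End k X ⊗[k] B) (b : Module.End k Y ⊗[k] C) :
    Commute (mapL (Module.End.rTensorAlgHom k X Y) A (mapR X f a))
      (mapL (Module.End.lTensorAlgHom k Y X) A (mapR Y g b)) := by
  induction a with
  | zero => simp
  | add a a' ha ha' => rw [map_add, map_add]; exact ha.add_left ha'
  | tmul S h =>
    induction b with
    | zero => simp
    | add a a' ha ha' => rw [map_add, map_add]; exact ha.add_right ha'
    | tmul T h' =>
      simp only [Algebra.TensorProduct.map_tmul, AlgHom.id_apply, Commute, SemiconjBy,
        Algebra.TensorProduct.tmul_mul_tmul, (hfg h h').eq]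
      congr 1
      ext; rfl

/-- The product `a₁₃ b₂₃` of elements of `L(X) ⊗ A` and `L(Y) ⊗ A`. -/
abbrev legMul {A : Type u} [Ring A] [Algebra k A] (a : Module.End k X ⊗[k] A)
    (b : Module.End k Y ⊗[k] A) : Module.End k (X ⊗[k] Y) ⊗[k] A :=
  mapL (Module.End.rTensorAlgHom k X Y) A a * mapL (Module.End.lTensorAlgHom k Y X) A b

/-- Applying Δ yields four factors. The two middle ones sit in different tensor legs, both among the
spaces and among the copies of H, so they can be swapped. -/
theorem IsCorep.legMul {a : Module.End k X ⊗[k] H} {b : Module.End k Y ⊗[k] H} (ha : IsCorep a)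
    (hb : IsCorep b) : IsCorep (legMul a b) := by
  rw [isCorep_iff] at *
  simp only [VertexModel.legMul, map_mul, mapR_mapL, ha, hb, map_one, mul_one, and_true]
  have h := commute_legs (X := X) (Y := Y) (H ⊗[k] H)
    (Algebra.TensorProduct.includeRight : H →ₐ[k] H ⊗[k] H)
    (Algebra.TensorProduct.includeLeft : H →ₐ[k] H ⊗[k] H)
    (fun b c => by simp [Commute, SemiconjBy]) a b
  simp only [mul_assoc]
  congr 1
  simp only [← mul_assoc]
  rw [h.eq]

theorem IsCorep.tensor {x y : Obj k H} (hx : IsCorep x.el) (hy : IsCorep y.el) :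
    IsCorep (x.tensor y).el :=
  hx.legMul hy

/-- Transposition of the first leg reverses products of elements with disjoint second legs. -/
theorem transposeLeft_mul (A : Type u) {B C : Type u} [Ring A] [Algebra k A] [Ring B] [Algebra k B]
    [Ring C] [Algebra k C] (f : B →ₐ[k] A) (g : C →ₐ[k] A) (hfg : ∀ b c, Commute (f b) (g c))
    (a : Module.End k X ⊗[k] B) (b : Module.End k X ⊗[k] C) :
    transposeLeft A (mapR X f a * mapR X g b) =
      mapR _ g (transposeLeft C b) * mapR _ f (transposeLeft B a) := by
  induction a with
  | zero => simp
  | add a a' ha ha' => simp only [map_add, add_mul, mul_add, ha, ha']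
  | tmul S h =>
    induction b with
    | zero => simp
    | add a a' ha ha' => simp only [map_add, mul_add, add_mul, ha, ha']
    | tmul T h' =>
      simp only [transposeLeft, Algebra.TensorProduct.map_tmul, AlgHom.id_apply,
        Algebra.TensorProduct.tmul_mul_tmul, (hfg h h').eq, LinearMap.rTensor_tmul]
      rfl

theorem mapR_transposeLeft {A B : Type u} [Ring A] [Algebra k A] [Ring B] [Algebra k B]
    (f : A →ₐ[k] B) (a : Module.End k X ⊗[k] A) :
    mapR _ f (transposeLeft A a) = transposeLeft B (mapR X f a) := by
  induction a with
  | zero => simp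
  | add a a' ha ha' => simp only [map_add, ha, ha']
  | tmul S h => simp [transposeLeft]

theorem transposeLeft_one {A : Type u} [Ring A] [Algebra k A] :
    transposeLeft (k := k) (V := X) A 1 = 1 := by
  rw [Algebra.TensorProduct.one_def, transposeLeft, LinearMap.rTensor_tmul]
  rfl

theorem contragredient_eq (r : Module.End k X ⊗[k] H) :
    contragredient r = transposeLeft H (antipodeR r) := by
  induction r with
  | zero => simp [contragredient]
  | add a a' ha ha' =>
    simp only [contragredient, map_add] at *
    rw [ha, ha']
  | tmul S h => simp [transposeLeft, contragredient]

/-- (id ⊗ S)r is the inverse of r, so Δ multiplies its two copies in reversed order; transposition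
of the first leg reverses them back. -/
theorem IsCorep.contragredient {r : Module.End k X ⊗[k] H} (hr : IsCorep r) :
    IsCorep (contragredient r) := by
  have h1 := hr.mul_antipodeR
  have h2 := hr.antipodeR_mul
  rw [contragredient_eq]
  set s := antipodeR r
  rw [isCorep_iff] at *
  -- Both sides are inverses of (id ⊗ Δ)r, so the anticomultiplicativity of the antipode is not
  -- needed.
  have key : mapR X (Bialgebra.comulAlgHom k H) s =
      mapR X (Algebra.TensorProduct.includeRight : H →ₐ[k] H ⊗[k] H) s *
        mapR X (Algebra.TensorProduct.includeLeft : H →ₐ[k] H ⊗[k] H) s := by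
    have e1 : mapR X (Bialgebra.comulAlgHom k H) s * mapR X (Bialgebra.comulAlgHom k H) r = 1 := by
      rw [← map_mul, h2, map_one]
    refine left_inv_eq_right_inv e1 ?_
    rw [hr.1, mul_assoc, ← mul_assoc (mapR X (Algebra.TensorProduct.includeRight :
      H →ₐ[k] H ⊗[k] H) r), ← map_mul, h1, map_one, one_mul, ← map_mul, h1, map_one]
  constructor
  · rw [mapR_transposeLeft, key, transposeLeft_mul _ _ _ (fun b c => by simp [Commute, SemiconjBy])]
  · rw [mapR_transposeLeft]
    have : mapR X (Bialgebra.counitAlgHom k H) s = 1 := by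
      have := congrArg (mapR X (Bialgebra.counitAlgHom k H)) h1
      rwa [map_mul, hr.2, one_mul, map_one] at this
    rw [this, transposeLeft_one]

theorem IsCorep.alt {x y : Obj k H} (hx : IsCorep x.el) (hy : IsCorep y.el) (j : ℕ) :
    IsCorep (Obj.alt x y j).el := by
  induction j generalizing x y with
  | zero => exact hx
  | succ j ih => exact ih hy hx

theorem IsCorep.word {x y : Obj k H} (hx : IsCorep x.el) (hy : IsCorep y.el) (j m : ℕ) :
    IsCorep (Obj.word x y j m).el := by
  induction m generalizing j with
  | zero => exact isCorep_one
  | succ m ih => exact (hx.alt hy j).tensor (ih (j + 1))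

end Corep

/-! ### Intertwiners in the minimal model -/

section Minimal

variable {k V W X H : Type u} [Field k] [AddCommGroup V] [Module k V] [AddCommGroup W] [Module k W]
  [AddCommGroup X] [Module k X] [Ring H] [HopfAlgebra k H]

/-- The two-sided ideal generated by the coefficients of `z`. -/
def coeffIdeal (z : Module.End k X ⊗[k] H) : Ideal H :=
  (TwoSidedIdeal.span (Set.range fun f : Module.Dual k (Module.End k X) => coeff f z)).asIdeal

instance (z : Module.End k X ⊗[k] H) : (coeffIdeal z).IsTwoSided :=
  inferInstanceAs (TwoSidedIdeal.asIdeal _).IsTwoSided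

/-- The kernel of f is a two-sided ideal containing the coefficients. Each Hopf ideal axiom below is
an instance, for f equal to ε, (q ⊗ q)Δ, or the antipode followed by q with values in the opposite
algebra. -/
theorem map_eq_zero_of_mem_coeffIdeal {B : Type u} [Ring B] [Algebra k B] (f : H →ₐ[k] B)
    {z : Module.End k X ⊗[k] H} (hz : mapR X f z = 0) {a : H} (ha : a ∈ coeffIdeal z) : f a = 0 := by
  have h : TwoSidedIdeal.span (Set.range fun f : Module.Dual k (Module.End k X) => coeff f z) ≤
      TwoSidedIdeal.ker f := by
    rw [TwoSidedIdeal.span_le]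
    rintro _ ⟨g, rfl⟩
    exact (TwoSidedIdeal.mem_ker f).2 ((lTensor_eq_zero_iff f.toLinearMap z).1 hz g)
  exact (TwoSidedIdeal.mem_ker f).1 (h ha)

theorem mapR_mk_coeffIdeal (z : Module.End k X ⊗[k] H) :
    mapR X (Ideal.Quotient.mkₐ k (coeffIdeal z)) z = 0 := by
  refine (lTensor_eq_zero_iff _ z).2 fun f => ?_
  exact Ideal.Quotient.eq_zero_iff_mem.2 (TwoSidedIdeal.subset_span ⟨f, rfl⟩)

/-- The commutator of `T ⊗ 1` and `r`. -/
abbrev endCommutator (T : Module.End k X) (r : Module.End k X ⊗[k] H) : Module.End k X ⊗[k] H :=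
  (T ⊗ₜ[k] (1 : H)) * r - r * (T ⊗ₜ[k] (1 : H))

theorem commute_mapR_iff_endCommutator {B : Type u} [Ring B] [Algebra k B] (f : H →ₐ[k] B)
    {T : Module.End k X} {r : Module.End k X ⊗[k] H} :
    mapR X f (endCommutator T r) = 0 ↔ Commute (T ⊗ₜ[k] (1 : B)) (mapR X f r) := by
  rw [map_sub, map_mul, map_mul, sub_eq_zero, Algebra.TensorProduct.map_tmul, map_one]
  rfl

/-- The coefficients of the commutator of a corepresentation with `T ⊗ 1` generate a Hopf ideal. -/
theorem isHopfIdeal_coeffIdeal {r : Module.End k X ⊗[k] H} (hr : IsCorep r) (T : Module.End k X) :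
    (coeffIdeal (endCommutator T r)).IsHopfIdeal k := by
  set J := coeffIdeal (endCommutator T r) with hJ
  set q := Ideal.Quotient.mkₐ k J with hq
  have hT : Commute (T ⊗ₜ[k] (1 : H ⧸ J)) (mapR X q r) :=
    (commute_mapR_iff_endCommutator q).1 (mapR_mk_coeffIdeal _)
  have hr' := (isCorep_iff r).1 hr
  refine { counit_eq_zero := ?_, map_mkQ_comul_eq_zero := ?_, antipode_mem := ?_ }
  · intro a ha
    refine map_eq_zero_of_mem_coeffIdeal (Bialgebra.counitAlgHom k H) ?_ ha
    rw [commute_mapR_iff_endCommutator, hr'.2]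
    exact Commute.one_right _
  · intro a ha
    refine map_eq_zero_of_mem_coeffIdeal
      ((Algebra.TensorProduct.map q q).comp (Bialgebra.comulAlgHom k H)) ?_ ha
    rw [commute_mapR_iff_endCommutator, ← mapR_mapR, hr'.1, map_mul, mapR_mapR, mapR_mapR,
      Algebra.TensorProduct.map_comp_includeLeft, Algebra.TensorProduct.map_comp_includeRight,
      ← mapR_mapR, ← mapR_mapR]
    -- Modulo J ⊗ H + H ⊗ J, the operator T commutes with r₁₂ and with r₁₃ separately, hence with
    -- their product (id ⊗ Δ)r.
    have h1 := hT.map (mapR X (Algebra.TensorProduct.includeLeft : _ →ₐ[k] (H ⧸ J) ⊗[k] (H ⧸ J)))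
    have h2 := hT.map (mapR X (Algebra.TensorProduct.includeRight : _ →ₐ[k] (H ⧸ J) ⊗[k] (H ⧸ J)))
    rw [Algebra.TensorProduct.map_tmul, map_one] at h1 h2
    exact h1.mul_right h2
  · intro a ha
    have hS : LinearMap.lTensor (Module.End k X)
        (q.toLinearMap ∘ₗ HopfAlgebra.antipode k (A := H)) (endCommutator T r) = 0 := by
      have e : mapR X q (antipodeR (endCommutator T r)) =
          (T ⊗ₜ[k] (1 : H ⧸ J)) * mapR X q (antipodeR r) -
            mapR X q (antipodeR r) * (T ⊗ₜ[k] (1 : H ⧸ J)) := by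
        simp only [antipodeR, endCommutator, map_sub]
        congr 1
        · rw [show (T ⊗ₜ[k] (1 : H ⧸ J)) = mapR X q (T ⊗ₜ[k] (1 : H)) by simp, ← map_mul]
          congr 1
          generalize r = z
          induction z with
          | zero => simp
          | add a b ha hb => simp only [mul_add, map_add, ha, hb]
          | tmul S h => simp
        · rw [show (T ⊗ₜ[k] (1 : H ⧸ J)) = mapR X q (T ⊗ₜ[k] (1 : H)) by simp, ← map_mul]
          congr 1
          generalize r = z
          induction z with
          | zero => simp
          | add a b ha hb => simp only [add_mul, map_add, ha, hb]
          | tmul S h => simp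
      have h1 : mapR X q r * mapR X q (antipodeR r) = 1 := by
        rw [← map_mul, hr.mul_antipodeR, map_one]
      have h2 : mapR X q (antipodeR r) * mapR X q r = 1 := by
        rw [← map_mul, hr.antipodeR_mul, map_one]
      -- Modulo J the element (id ⊗ S)r is the inverse of r, and what commutes with r commutes with
      -- its inverse.
      have h3 : Commute (T ⊗ₜ[k] (1 : H ⧸ J)) (mapR X q (antipodeR r)) :=
        Commute.units_inv_right (u := ⟨_, _, h1, h2⟩) hT
      rw [h3.eq, sub_self] at e
      rw [LinearMap.lTensor_comp]
      exact e
    -- The antipode reverses products, so it is an algebra morphism only into the opposite algebra;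
    -- the ideal argument is applied there.
    have := map_eq_zero_of_mem_coeffIdeal
      ((AlgHom.op q).comp (HopfAlgebra.antipodeAlgHomOp k H)) (z := endCommutator T r) ?_ ha
    · exact Ideal.Quotient.eq_zero_iff_mem.1 (MulOpposite.op_injective this)
    · refine (lTensor_eq_zero_iff _ _).2 fun f => ?_
      exact congrArg MulOpposite.op ((lTensor_eq_zero_iff _ _).1 hS f)

/-- If the quotient of the minimal model by a Hopf ideal is still a model, then the ideal is zero. -/
theorem IsMinimalModel.eq_bot {w : Module.End k V ⊗[k] Module.End k W} {v : Module.End k V ⊗[k] H}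
    {π : H →ₐ[k] Module.End k W} (hmin : IsMinimalModel w v π) (J : Ideal H) [J.IsTwoSided]
    [J.IsHopfIdeal k] (hJ : ∀ a ∈ J, π a = 0) : ∀ a ∈ J, a = 0 := by
  obtain ⟨⟨⟨hv, hπ⟩, hf⟩, huniv⟩ := hmin
  let q : H →ₐc[k] H ⧸ J := Bialgebra.Quotient.mkBialgHom J
  let qa : H →ₐ[k] H ⧸ J := Ideal.Quotient.mkₐ k J
  let π' : (H ⧸ J) →ₐ[k] Module.End k W := Ideal.Quotient.liftₐ J π hJ
  have hcomp : π'.comp qa = π := Ideal.Quotient.liftₐ_comp J π hJ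
  have hv' : IsCorep (mapR V qa v) := by
    rw [isCorep_iff] at hv ⊢
    constructor
    · have h1 : (Bialgebra.comulAlgHom k (H ⧸ J)).comp qa =
          (Algebra.TensorProduct.map qa qa).comp (Bialgebra.comulAlgHom k H) := rfl
      rw [mapR_mapR, h1, ← mapR_mapR, hv.1, map_mul, mapR_mapR, mapR_mapR,
        Algebra.TensorProduct.map_comp_includeLeft, Algebra.TensorProduct.map_comp_includeRight,
        ← mapR_mapR, ← mapR_mapR]
    · have h1 : (Bialgebra.counitAlgHom k (H ⧸ J)).comp qa = Bialgebra.counitAlgHom k H := rfl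
      rw [mapR_mapR, h1, hv.2]
  have hm : IsModel w (mapR V qa v) π' := ⟨hv', by
    have := mapR_mapR (X := V) π' qa v
    rw [hcomp] at this
    exact this.trans hπ⟩
  have hlf : IsLeftFaithful (mapR V qa v) := by
    have h := congrArg (Subalgebra.map qa) hf
    rw [AlgHom.map_adjoin, Algebra.map_top,
      (AlgHom.range_eq_top qa).2 (Ideal.Quotient.mkₐ_surjective k J)] at h
    rw [IsLeftFaithful, eq_top_iff, ← h]
    refine Algebra.adjoin_mono ?_
    rintro _ ⟨a, ha, rfl⟩
    obtain ⟨n, ha⟩ := Set.mem_iUnion.1 ha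
    obtain ⟨_, ⟨f, rfl⟩, rfl⟩ := ha
    refine Set.mem_iUnion.2 ⟨n, coeff f (mapR V qa v), ⟨f, rfl⟩, ?_⟩
    rw [mapR_eq_lTensor, coeff_lTensor]
    have hS : ∀ (n : ℕ) (b : H), (HopfAlgebra.antipode k)^[n] (qa b) =
        qa ((HopfAlgebra.antipode k)^[n] b) := by
      intro n
      induction n with
      | zero => exact fun b => rfl
      | succ n ih => exact fun b => ih _
    exact hS n _
  obtain ⟨f, ⟨hf1, hf2⟩, -⟩ := huniv (H ⧸ J) (mapR V qa v) π' hm hlf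
  obtain ⟨g, -, hg⟩ := huniv H v π ⟨hv, hπ⟩ hf
  -- f ∘ q is an endomorphism of the terminal object, hence the identity; so the quotient map q is
  -- injective.
  have h1 := hg (f.comp q) ⟨by
      refine Eq.trans ?_ hf1
      exact (mapR_mapR (X := V) (f : (H ⧸ J) →ₐ[k] H) qa v).symm, by
      refine hcomp.symm.trans ?_
      rw [hf2]
      rfl⟩
  have h2 := hg (BialgHom.id k H) ⟨by
      exact DFunLike.congr_fun (Algebra.TensorProduct.map_id (R := k) (S := k)) v, by ext; rfl⟩
  intro a ha
  have h3 : f (q a) = a := DFunLike.congr_fun (h1.trans h2.symm) a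
  rw [← h3, show q a = 0 from Ideal.Quotient.eq_zero_iff_mem.2 ha, map_zero]

/-- An operator that intertwines the image of a corepresentation of the minimal model intertwines
the corepresentation. -/
theorem IsMinimalModel.commute_of_commute_mapR {w : Module.End k V ⊗[k] Module.End k W}
    {v : Module.End k V ⊗[k] H} {π : H →ₐ[k] Module.End k W} (hmin : IsMinimalModel w v π)
    {r : Module.End k X ⊗[k] H} (hr : IsCorep r) {T : Module.End k X}
    (hT : Commute (T ⊗ₜ[k] (1 : Module.End k W)) (mapR X π r)) :
    Commute (T ⊗ₜ[k] (1 : H)) r := by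
  have := isHopfIdeal_coeffIdeal hr T
  -- The hypothesis on T says that π kills the coefficients of the commutator, so π factors through
  -- the quotient by the Hopf ideal they generate.
  have h0 := hmin.eq_bot (coeffIdeal (endCommutator T r)) fun a ha =>
    map_eq_zero_of_mem_coeffIdeal π ((commute_mapR_iff_endCommutator π).2 hT) ha
  refine sub_eq_zero.1 (eq_zero_of_coeff _ fun f => h0 _ ?_)
  exact TwoSidedIdeal.subset_span ⟨f, rfl⟩

end Minimal

/-! ### Transpositions and the two forms of (⋆) -/

section Transposition

variable {k X Y W : Type u} [Field k] [AddCommGroup X] [Module k X] [AddCommGroup Y] [Module k Y]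
  [AddCommGroup W] [Module k W]

/-- `id ⊗ t` on `L(X) ⊗ L(W)`. -/
abbrev tR : Module.End k X ⊗[k] Module.End k W →ₗ[k]
    Module.End k X ⊗[k] Module.End k (Module.Dual k W) :=
  transposeRight (Module.End k X)

/-- `t ⊗ id` on `L(X) ⊗ L(W)`. -/
abbrev tL : Module.End k X ⊗[k] Module.End k W →ₗ[k]
    Module.End k (Module.Dual k X) ⊗[k] Module.End k W :=
  transposeLeft (Module.End k W)

theorem transpose_injective :
    Function.Injective (Module.Dual.transpose (R := k) (M := X) (M' := X)) := by
  intro S T h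
  ext x
  refine (Module.forall_dual_apply_eq_zero_iff k _).1 (fun f => ?_) |> sub_eq_zero.1
  rw [map_sub, sub_eq_zero]
  exact LinearMap.congr_fun (LinearMap.congr_fun h f) x

theorem transposeLeft_injective (A : Type u) [Ring A] [Algebra k A] :
    Function.Injective (transposeLeft (k := k) (V := X) A) :=
  Module.Flat.rTensor_preserves_injective_linearMap _ transpose_injective

theorem transposeRight_one : tR (1 : Module.End k X ⊗[k] Module.End k W) = 1 :=
  (LinearMap.lTensor_tmul _ _ _ _).trans rfl

/-- On S ⊗ h and T ⊗ g both sides equal (ST)ᵗ ⊗ (gh)ᵗ. This trades transposition of the first leg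
for transposition of the second, and so moves (⋆) from V to W. -/
theorem transposeLeft_transposeRight_mul (x y : Module.End k X ⊗[k] Module.End k W) :
    tL (tR x * tR y) =
      tR (tL y * tL x) := by
  induction x with
  | zero => simp
  | add a b ha hb => simp only [map_add, add_mul, mul_add, ha, hb]
  | tmul S h =>
    induction y with
    | zero => simp
    | add a b ha hb => simp only [map_add, add_mul, mul_add, ha, hb]
    | tmul T g =>
      simp only [transposeLeft, transposeRight, LinearMap.rTensor_tmul, LinearMap.lTensor_tmul,
        Algebra.TensorProduct.tmul_mul_tmul]
      rfl

theorem transposeRight_transposeLeft_mul (x y : Module.End k X ⊗[k] Module.End k W) :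
    tR (tL x) * tR (tL y) =
      tL (tR (y * x)) := by
  induction x with
  | zero => simp
  | add a b ha hb => simp only [map_add, add_mul, mul_add, ha, hb]
  | tmul S h =>
    induction y with
    | zero => simp
    | add a b ha hb => simp only [map_add, add_mul, mul_add, ha, hb]
    | tmul T g =>
      simp only [transposeLeft, transposeRight, LinearMap.rTensor_tmul, LinearMap.lTensor_tmul,
        Algebra.TensorProduct.tmul_mul_tmul]
      rfl

theorem transposeRight_legs (a : Module.End k X ⊗[k] Module.End k W)
    (b : Module.End k Y ⊗[k] Module.End k W) :
    tR (mapL (Module.End.lTensorAlgHom k Y X) (Module.End k W) b *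
        mapL (Module.End.rTensorAlgHom k X Y) (Module.End k W) a) =
      mapL (Module.End.rTensorAlgHom k X Y) (Module.End k (Module.Dual k W)) (tR a) *
        mapL (Module.End.lTensorAlgHom k Y X) (Module.End k (Module.Dual k W)) (tR b) := by
  induction a with
  | zero => simp
  | add a a' ha ha' => simp only [map_add, add_mul, mul_add, ha, ha']
  | tmul S h =>
    induction b with
    | zero => simp
    | add a b ha hb => simp only [map_add, add_mul, mul_add, ha, hb]
    | tmul T g =>
      simp only [transposeRight, LinearMap.lTensor_tmul, Algebra.TensorProduct.map_tmul,
        AlgHom.id_apply, Algebra.TensorProduct.tmul_mul_tmul]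
      congr 1
      ext; rfl

theorem transposeRight_legs' (a : Module.End k X ⊗[k] Module.End k W)
    (b : Module.End k Y ⊗[k] Module.End k W) :
    tR (mapL (Module.End.rTensorAlgHom k X Y) (Module.End k W) a *
        mapL (Module.End.lTensorAlgHom k Y X) (Module.End k W) b) =
      mapL (Module.End.lTensorAlgHom k Y X) (Module.End k (Module.Dual k W)) (tR b) *
        mapL (Module.End.rTensorAlgHom k X Y) (Module.End k (Module.Dual k W)) (tR a) := by
  induction a with
  | zero => simp
  | add a a' ha ha' => simp only [map_add, add_mul, mul_add, ha, ha']
  | tmul S h =>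
    induction b with
    | zero => simp
    | add a b ha hb => simp only [map_add, add_mul, mul_add, ha, hb]
    | tmul T g =>
      simp only [transposeRight, LinearMap.lTensor_tmul, Algebra.TensorProduct.map_tmul,
        AlgHom.id_apply, Algebra.TensorProduct.tmul_mul_tmul]
      congr 1
      ext; rfl

theorem transposeRight_mul_left (S : Module.End k X) (z : Module.End k X ⊗[k] Module.End k W) :
    tR ((S ⊗ₜ[k] 1) * z) = (S ⊗ₜ[k] 1) * tR z := by
  induction z with
  | zero => simp
  | add a b ha hb => simp only [map_add, mul_add, ha, hb]
  | tmul T g => simp [transposeRight]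

theorem transposeRight_mul_right (S : Module.End k X) (z : Module.End k X ⊗[k] Module.End k W) :
    tR (z * (S ⊗ₜ[k] 1)) = tR z * (S ⊗ₜ[k] 1) := by
  induction z with
  | zero => simp
  | add a b ha hb => simp only [map_add, add_mul, ha, hb]
  | tmul T g => simp [transposeRight]

/-- `(id ⊗ t)(U⁻¹)` is the inverse of `(id ⊗ t)U`. -/
def TransposeInv (U : (Module.End k X ⊗[k] Module.End k W)ˣ) : Prop :=
  transposeRight (Module.End k X) (U : Module.End k X ⊗[k] Module.End k W) *
      transposeRight (Module.End k X) (↑U⁻¹ : Module.End k X ⊗[k] Module.End k W) = 1 ∧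
    transposeRight (Module.End k X) (↑U⁻¹ : Module.End k X ⊗[k] Module.End k W) *
      transposeRight (Module.End k X) (U : Module.End k X ⊗[k] Module.End k W) = 1

/-- The contragredient `û = (t ⊗ id)u⁻¹`, with inverse `(t ⊗ id)u`. -/
def hatUnit (u : (Module.End k X ⊗[k] Module.End k W)ˣ) (hu : SatisfiesStar u) :
    (Module.End k (Module.Dual k X) ⊗[k] Module.End k W)ˣ :=
  ⟨tL (↑u⁻¹ : Module.End k X ⊗[k] Module.End k W),
    tL (u : Module.End k X ⊗[k] Module.End k W), hu.2, hu.1⟩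

theorem SatisfiesStar.transposeInv {u : (Module.End k X ⊗[k] Module.End k W)ˣ}
    (hu : SatisfiesStar u) : TransposeInv u := by
  constructor
  · refine transposeLeft_injective (X := X) (Module.End k (Module.Dual k W)) ?_
    rw [transposeLeft_transposeRight_mul, hu.2, transposeLeft_one, transposeRight_one]
  · refine transposeLeft_injective (X := X) (Module.End k (Module.Dual k W)) ?_
    rw [transposeLeft_transposeRight_mul, hu.1, transposeLeft_one, transposeRight_one]

/-- For û the condition is t ⊗ t applied to u u⁻¹ = u⁻¹ u = 1; (⋆) enters only through the
invertibility of û. -/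
theorem SatisfiesStar.transposeInv_hat {u : (Module.End k X ⊗[k] Module.End k W)ˣ}
    (hu : SatisfiesStar u) : TransposeInv (hatUnit u hu) := by
  constructor
  · refine (transposeRight_transposeLeft_mul _ _).trans ?_
    rw [Units.mul_inv, transposeRight_one, transposeLeft_one]
  · refine (transposeRight_transposeLeft_mul _ _).trans ?_
    rw [Units.inv_mul, transposeRight_one, transposeLeft_one]

end Transposition

/-! ### Leg products of invertible elements -/

section LegUnits

variable {k X Y R : Type u} [Field k] [AddCommGroup X] [Module k X] [AddCommGroup Y] [Module k Y]
  [Ring R] [Algebra k R]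

/-- The product `a₁₃ b₂₃` of invertible elements. -/
def legMulU (a : (Module.End k X ⊗[k] R)ˣ) (b : (Module.End k Y ⊗[k] R)ˣ) :
    (Module.End k (X ⊗[k] Y) ⊗[k] R)ˣ :=
  Units.map (mapL (Module.End.rTensorAlgHom k X Y) R : _ →* _) a *
    Units.map (mapL (Module.End.lTensorAlgHom k Y X) R : _ →* _) b

theorem coe_legMulU (a : (Module.End k X ⊗[k] R)ˣ) (b : (Module.End k Y ⊗[k] R)ˣ) :
    (legMulU a b : Module.End k (X ⊗[k] Y) ⊗[k] R) =
      legMul (a : Module.End k X ⊗[k] R) (b : Module.End k Y ⊗[k] R) := rfl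

theorem coe_inv_legMulU (a : (Module.End k X ⊗[k] R)ˣ) (b : (Module.End k Y ⊗[k] R)ˣ) :
    (↑(legMulU a b)⁻¹ : Module.End k (X ⊗[k] Y) ⊗[k] R) =
      mapL (Module.End.lTensorAlgHom k Y X) R (↑b⁻¹ : Module.End k Y ⊗[k] R) *
        mapL (Module.End.rTensorAlgHom k X Y) R (↑a⁻¹ : Module.End k X ⊗[k] R) := by
  rw [legMulU, mul_inv_rev]
  rfl

variable {W : Type u} [AddCommGroup W] [Module k W]

/-- Transposing W reverses the order of the two factors of both ab and its inverse, so the products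
still telescope from the inside. -/
theorem TransposeInv.legMul {a : (Module.End k X ⊗[k] Module.End k W)ˣ}
    {b : (Module.End k Y ⊗[k] Module.End k W)ˣ} (ha : TransposeInv a) (hb : TransposeInv b) :
    TransposeInv (legMulU a b) := by
  have e1 : tR (legMulU a b : Module.End k (X ⊗[k] Y) ⊗[k] Module.End k W) = _ :=
    transposeRight_legs' (a : Module.End k X ⊗[k] Module.End k W)
      (b : Module.End k Y ⊗[k] Module.End k W)
  have e2 : tR (↑(legMulU a b)⁻¹ : Module.End k (X ⊗[k] Y) ⊗[k] Module.End k W) = _ :=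
    (congrArg tR (coe_inv_legMulU a b)).trans (transposeRight_legs _ _)
  unfold TransposeInv
  rw [e1, e2]
  constructor
  · rw [mul_assoc, ← mul_assoc (mapL (Module.End.rTensorAlgHom k X Y) _ _)
      (mapL (Module.End.rTensorAlgHom k X Y) _ _), ← map_mul, ha.1, map_one, one_mul, ← map_mul,
      hb.1, map_one]
  · rw [mul_assoc, ← mul_assoc (mapL (Module.End.lTensorAlgHom k Y X) _ _)
      (mapL (Module.End.lTensorAlgHom k Y X) _ _), ← map_mul, hb.2, map_one, one_mul, ← map_mul,
      ha.2, map_one]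

theorem mapR_legMul_mul {B C Q : Type u} [Ring B] [Algebra k B] [Ring C] [Algebra k C] [Ring Q]
    [Algebra k Q] (f : B →ₐ[k] Q) (g : C →ₐ[k] Q) (hfg : ∀ b c, Commute (g c) (f b))
    (a : Module.End k X ⊗[k] B) (b : Module.End k Y ⊗[k] B) (a' : Module.End k X ⊗[k] C)
    (b' : Module.End k Y ⊗[k] C) :
    mapR (X ⊗[k] Y) f (legMul a b) * mapR (X ⊗[k] Y) g (legMul a' b') =
      legMul (mapR X f a * mapR X g a') (mapR Y f b * mapR Y g b') := by
  have h := commute_legs (X := X) (Y := Y) Q g f (fun c b => hfg b c) a' b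
  simp only [legMul, map_mul]
  rw [mapR_mapL, mapR_mapL, mapR_mapL, mapR_mapL]
  simp only [mul_assoc]
  congr 1
  simp only [← mul_assoc]
  rw [h.eq]

/-- The W* part of a' and the W part of b' commute, so the W parts and the W* parts of a'b' can be
collected; transposition puts the latter in the order required by (ab)⁻¹ = b⁻¹a⁻¹. -/
theorem uPrime_legMulU (a : (Module.End k X ⊗[k] Module.End k W)ˣ)
    (b : (Module.End k Y ⊗[k] Module.End k W)ˣ) :
    uPrime (legMulU a b) = legMul (uPrime a) (uPrime b) := by
  have e2 : tR (↑(legMulU a b)⁻¹ : Module.End k (X ⊗[k] Y) ⊗[k] Module.End k W) = _ :=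
    (congrArg tR (coe_inv_legMulU a b)).trans (transposeRight_legs _ _)
  have h := mapR_legMul_mul (X := X) (Y := Y) (B := Module.End k W)
    (C := Module.End k (Module.Dual k W)) (Q := Module.End k (W ⊗[k] Module.Dual k W))
    (Module.End.rTensorAlgHom k W (Module.Dual k W))
    (Module.End.lTensorAlgHom k (Module.Dual k W) W)
    (fun b c => by simp only [Commute, SemiconjBy]; ext; rfl) ↑a ↑b
    (tR (↑a⁻¹ : Module.End k X ⊗[k] Module.End k W))
    (tR (↑b⁻¹ : Module.End k Y ⊗[k] Module.End k W))
  rw [uPrime, e2]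
  exact h

end LegUnits

/-! ### Conjugable operators -/

section Conjugation

variable {k X Y W : Type u} [Field k] [AddCommGroup X] [Module k X] [AddCommGroup Y] [Module k Y]
  [AddCommGroup W] [Module k W]

theorem rTensorAlgHom_injective [Nontrivial Y] :
    Function.Injective (Module.End.rTensorAlgHom k X Y) := by
  intro S T h
  obtain ⟨y, hy⟩ := exists_ne (0 : Y)
  obtain ⟨f, hf⟩ := Module.Projective.exists_dual_ne_zero k hy
  ext x
  have h1 := congrArg (TensorProduct.rid k X ∘ LinearMap.lTensor X f)
    (LinearMap.congr_fun h (x ⊗ₜ[k] y))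
  change f y • S x = f y • T x at h1
  exact smul_right_injective X hf h1

theorem lTensorAlgHom_injective [Nontrivial X] :
    Function.Injective (Module.End.lTensorAlgHom k Y X) := by
  intro S T h
  obtain ⟨x, hx⟩ := exists_ne (0 : X)
  obtain ⟨f, hf⟩ := Module.Projective.exists_dual_ne_zero k hx
  ext y
  have h1 := congrArg (TensorProduct.lid k Y ∘ LinearMap.rTensor Y f)
    (LinearMap.congr_fun h (x ⊗ₜ[k] y))
  change f x • S y = f x • T y at h1
  exact smul_right_injective Y hf h1

theorem mapL_injective {f : Module.End k X →ₐ[k] Module.End k Y} (hf : Function.Injective f)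
    (R : Type u) [Ring R] [Algebra k R] : Function.Injective (mapL f R) :=
  Module.Flat.rTensor_preserves_injective_linearMap f.toLinearMap hf

theorem mapR_injective {A B : Type u} [Ring A] [Algebra k A] [Ring B] [Algebra k B]
    {f : A →ₐ[k] B} (hf : Function.Injective f) : Function.Injective (mapR X f) :=
  Module.Flat.lTensor_preserves_injective_linearMap f.toLinearMap hf

/-- An element of `L(X) ⊗ L(W)` that commutes with `1 ⊗ L(W)` belongs to `L(X) ⊗ 1`. -/
theorem exists_eq_tmul_one_of_commute {A : Type u} [Ring A] [Algebra k A]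
    (z : A ⊗[k] Module.End k W)
    (hz : ∀ c : Module.End k W, Commute (1 ⊗ₜ[k] c) z) : ∃ S : A, z = S ⊗ₜ[k] 1 := by
  have h := Subalgebra.centralizer_range_includeRight_eq_center_tensorProduct k A (Module.End k W)
  have h1 : z ∈ Subalgebra.centralizer k
      ((Algebra.TensorProduct.includeRight : Module.End k W →ₐ[k]
        A ⊗[k] Module.End k W).range : Set (A ⊗[k] Module.End k W)) := by
    rw [Subalgebra.mem_centralizer_iff]
    rintro _ ⟨c, rfl⟩
    exact hz c
  rw [h] at h1
  obtain ⟨y, rfl⟩ := h1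
  clear hz
  induction y with
  | zero => exact ⟨0, by simp⟩
  | add a b ha hb =>
    obtain ⟨S, hS⟩ := ha
    obtain ⟨T, hT⟩ := hb
    exact ⟨S + T, by rw [TensorProduct.add_tmul, ← hS, ← hT]; exact map_add _ _ _⟩
  | tmul S c =>
    obtain ⟨c, hc⟩ := c
    rw [Algebra.IsCentral.center_eq_bot] at hc
    obtain ⟨r, rfl⟩ := hc
    refine ⟨r • S, ?_⟩
    rw [TensorProduct.smul_tmul, ← Algebra.algebraMap_eq_smul_one]
    rfl

/-- `U⁻¹(T ⊗ 1)U` belongs to `L(X) ⊗ 1`. -/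
def Conjugable {R : Type u} [Ring R] [Algebra k R] (U : (Module.End k X ⊗[k] R)ˣ)
    (T : Module.End k X) : Prop :=
  ∃ S : Module.End k X, (T ⊗ₜ[k] (1 : R)) * ↑U = ↑U * (S ⊗ₜ[k] (1 : R))

/-- The factor a does not touch X, so it commutes with id ⊗ T and cancels. This is what lets the
first factors of a word be forgotten. -/
theorem conjugable_legMulU_iff [Nontrivial Y] (a : (Module.End k Y ⊗[k] Module.End k W)ˣ)
    (U : (Module.End k X ⊗[k] Module.End k W)ˣ) (T : Module.End k X) :
    Conjugable (legMulU a U) (Module.End.lTensorAlgHom k X Y T) ↔ Conjugable U T := by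
  have hc := Obj.commute_legs_right Y X T (a : Module.End k Y ⊗[k] Module.End k W)
  constructor
  · rintro ⟨S, hS⟩
    rw [coe_legMulU, ← mul_assoc, hc.eq, mul_assoc] at hS
    have e1 : mapL (Module.End.rTensorAlgHom k Y X) (Module.End k W)
        (a⁻¹ : (Module.End k Y ⊗[k] Module.End k W)ˣ) *
        mapL (Module.End.rTensorAlgHom k Y X) (Module.End k W)
        (a : Module.End k Y ⊗[k] Module.End k W) = 1 := by
      rw [← map_mul, Units.inv_mul, map_one]
    have h1 := congrArg (fun z => mapL (Module.End.rTensorAlgHom k Y X) (Module.End k W)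
        (a⁻¹ : (Module.End k Y ⊗[k] Module.End k W)ˣ) * z) hS
    simp only [legMul, mul_assoc] at h1
    rw [← mul_assoc, e1, one_mul, ← mul_assoc (mapL (Module.End.rTensorAlgHom k Y X) _ _), e1,
      one_mul] at h1
    set z := (↑U⁻¹ : Module.End k X ⊗[k] Module.End k W) * ((T ⊗ₜ[k] 1) * (U : Module.End k X ⊗[k] Module.End k W)) with hz
    have h2 : mapL (Module.End.lTensorAlgHom k X Y) (Module.End k W) z = S ⊗ₜ[k] 1 := by
      rw [hz, map_mul, map_mul, Algebra.TensorProduct.map_tmul, map_one, h1, ← mul_assoc, ← map_mul,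
        Units.inv_mul, map_one, one_mul]
    clear_value z
    -- S acts on the whole of Y ⊗ X and is not known to have the form id ⊗ S'. But z becomes S ⊗ 1
    -- after an injective map, so it commutes with 1 ⊗ L(W), and this already puts it in L(X) ⊗ 1.
    obtain ⟨S', hS'⟩ := exists_eq_tmul_one_of_commute z fun c => by
      refine mapL_injective (lTensorAlgHom_injective (X := Y)) (Module.End k W) ?_
      rw [map_mul, map_mul, h2, Algebra.TensorProduct.map_tmul, map_one]
      simp
    refine ⟨S', ?_⟩
    rw [← hS', hz, ← mul_assoc, Units.mul_inv, one_mul]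
  · rintro ⟨S, hS⟩
    refine ⟨Module.End.lTensorAlgHom k X Y S, ?_⟩
    rw [coe_legMulU, ← mul_assoc, hc.eq, mul_assoc, mul_assoc]
    congr 1
    have := congrArg (mapL (Module.End.lTensorAlgHom k X Y) (Module.End k W)) hS
    simpa only [map_mul, Algebra.TensorProduct.map_tmul, map_one] using this

/-- With U' = U₁₂G₁₃, commutation reads U₁₂⁻¹TU₁₂ = G₁₃TG₁₃⁻¹. The left side has no W* component and
the right side no W component, so the common value is some S ⊗ 1 ⊗ 1. -/
theorem commute_uPrime_iff [Nontrivial W] {U : (Module.End k X ⊗[k] Module.End k W)ˣ}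
    (hU : TransposeInv U) (T : Module.End k X) :
    Commute (T ⊗ₜ[k] (1 : Module.End k (W ⊗[k] Module.Dual k W))) (uPrime U) ↔ Conjugable U T := by
  set f := Module.End.rTensorAlgHom k W (Module.Dual k W)
  set g := Module.End.lTensorAlgHom k (Module.Dual k W) W
  set G := mapR (A := Module.End k (Module.Dual k W)) X g (tR (↑U⁻¹ : Module.End k X ⊗[k] Module.End k W)) with hG
  have hP : uPrime U = mapR X f (U : Module.End k X ⊗[k] Module.End k W) * G := rfl
  have hf : ∀ S : Module.End k X, mapR X f (S ⊗ₜ[k] 1) = S ⊗ₜ[k] 1 := fun S => by simp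
  have hg : ∀ S : Module.End k X, mapR (A := Module.End k (Module.Dual k W)) X g (S ⊗ₜ[k] 1) =
      S ⊗ₜ[k] 1 := fun S => by simp
  rw [hP]
  constructor
  · intro h
    set G' := mapR (A := Module.End k (Module.Dual k W)) X g (tR (U : Module.End k X ⊗[k] Module.End k W)) with hG'
    have hGG' : G * G' = 1 := by rw [hG, hG', ← map_mul, hU.2, map_one]
    set z := (↑U⁻¹ : Module.End k X ⊗[k] Module.End k W) * ((T ⊗ₜ[k] 1) * (U : Module.End k X ⊗[k] Module.End k W)) with hz
    have h1 : mapR X f z = G * (T ⊗ₜ[k] 1) * G' := by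
      have e1 : mapR X f (↑U⁻¹ : Module.End k X ⊗[k] Module.End k W) *
          mapR X f (U : Module.End k X ⊗[k] Module.End k W) = 1 := by
        rw [← map_mul, Units.inv_mul, map_one]
      calc mapR X f z = mapR X f (↑U⁻¹ : Module.End k X ⊗[k] Module.End k W) * ((T ⊗ₜ[k] 1) *
            (mapR X f (U : Module.End k X ⊗[k] Module.End k W) * G)) * G' := by
            rw [hz, map_mul, map_mul, hf]
            simp only [mul_assoc, hGG', mul_one]
        _ = G * (T ⊗ₜ[k] 1) * G' := by
            rw [h.eq, ← mul_assoc, ← mul_assoc, e1, one_mul]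
    clear_value z
    have hcomm : ∀ (c : Module.End k W) (y : Module.End k X ⊗[k] Module.End k (Module.Dual k W)),
        Commute (1 ⊗ₜ[k] f c) (mapR (A := Module.End k (Module.Dual k W)) X g y) := by
      intro c y
      induction y with
      | zero => simp
      | add a b ha hb => rw [map_add]; exact ha.add_right hb
      | tmul S d =>
        simp only [Algebra.TensorProduct.map_tmul, AlgHom.id_apply, Commute, SemiconjBy,
          Algebra.TensorProduct.tmul_mul_tmul, one_mul, mul_one]
        congr 1
        ext; rfl
    have hnt : Nontrivial (Module.Dual k W) := inferInstance
    -- By `h1` the image of z lies in legs 1 and 3, so it commutes with everything on the leg W.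
    obtain ⟨S, hS⟩ := exists_eq_tmul_one_of_commute z fun c => by
      refine mapR_injective (rTensorAlgHom_injective (k := k) (X := W) (Y := Module.Dual k W)) ?_
      change mapR X f _ = mapR X f _
      rw [map_mul, map_mul, h1, Algebra.TensorProduct.map_tmul, map_one]
      refine ((hcomm c _).mul_right ?_).mul_right (hcomm c _)
      simp [Commute, SemiconjBy]
    refine ⟨S, ?_⟩
    rw [← hS, hz, ← mul_assoc, Units.mul_inv, one_mul]
  · rintro ⟨S, hS⟩
    -- This is U⁻¹T = SU⁻¹ after transposing the leg W, which leaves the leg X and its order of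
    -- products alone.
    have h1 : G * (T ⊗ₜ[k] 1) = (S ⊗ₜ[k] 1) * G := by
      rw [hG, ← hg, ← hg, ← map_mul, ← map_mul, ← transposeRight_mul_left,
        ← transposeRight_mul_right]
      congr 2
      rw [Units.eq_mul_inv_iff_mul_eq, mul_assoc, hS, ← mul_assoc, Units.inv_mul, one_mul]
    have h2 := congrArg (mapR X f) hS
    rw [map_mul, map_mul, hf, hf] at h2
    rw [Commute, SemiconjBy, ← mul_assoc, h2, mul_assoc, mul_assoc, h1]

end Conjugation

/-! ### Dualities, recorded only through their trace identities -/

section DualPair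

variable {k : Type u} [Field k]

theorem end_tensor_induction {X Y : Type u} [AddCommGroup X] [Module k X] [AddCommGroup Y]
    [Module k Y] [FiniteDimensional k X] [FiniteDimensional k Y]
    {P : Module.End k (X ⊗[k] Y) → Prop} (add : ∀ S T, P S → P T → P (S + T))
    (map : ∀ (A : Module.End k X) (B : Module.End k Y), P (TensorProduct.map A B))
    (T : Module.End k (X ⊗[k] Y)) : P T := by
  obtain ⟨z, rfl⟩ := (homTensorHomEquiv k X Y X Y).surjective T
  induction z with
  | zero => simpa using map 0 0
  | add a b ha hb => rw [map_add]; exact add _ _ ha hb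
  | tmul A B => simpa using map A B

/-- A duality between `Z` and `Z'`, given by its coevaluation `ξ` and its evaluation `p`. -/
@[ext]
structure DualPair (k Z Z' : Type u) [Field k] [AddCommGroup Z] [Module k Z] [AddCommGroup Z']
    [Module k Z'] where
  ξ : Z ⊗[k] Z'
  p : Z ⊗[k] Z' →ₗ[k] k
  p_rTensor : ∀ B : Module.End k Z, p (LinearMap.rTensor Z' B ξ) = LinearMap.trace k Z B
  p_lTensor : ∀ B : Module.End k Z', p (LinearMap.lTensor Z B ξ) = LinearMap.trace k Z' B

namespace DualPair

variable {Z Z' : Type u} [AddCommGroup Z'] [Module k Z'] [AddCommGroup Z] [Module k Z]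

/-- The opposite duality. -/
def symm (D : DualPair k Z Z') : DualPair k Z' Z where
  ξ := TensorProduct.comm k Z Z' D.ξ
  p := D.p ∘ₗ (TensorProduct.comm k Z' Z).toLinearMap
  p_rTensor B := by
    rw [← D.p_lTensor]
    generalize D.ξ = z
    induction z with
    | zero => simp
    | add a b ha hb => simp only [map_add, ha, hb]
    | tmul a b => simp
  p_lTensor B := by
    rw [← D.p_rTensor]
    generalize D.ξ = z
    induction z with
    | zero => simp
    | add a b ha hb => simp only [map_add, ha, hb]
    | tmul a b => simp

/-- The rank one operator `ξ ∘ p`. -/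
def cup (D : DualPair k Z Z') : Module.End k (Z ⊗[k] Z') := D.p.smulRight D.ξ

variable (k Z) in
/-- The canonical duality between a finite dimensional space and its dual. -/
def canonical [FiniteDimensional k Z] : DualPair k Z (Module.Dual k Z) where
  ξ := coevaluation k Z 1
  p := contractRight k Z
  p_rTensor B := by
    classical
    rw [coevaluation_apply_one, LinearMap.trace_eq_matrix_trace k (Module.Basis.ofVectorSpace k Z)]
    simp [Matrix.trace, LinearMap.toMatrix_apply]
  p_lTensor B := by
    classical
    rw [coevaluation_apply_one, LinearMap.trace_eq_matrix_trace k
      (Module.Basis.ofVectorSpace k Z).dualBasis]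
    simp [Matrix.trace, LinearMap.toMatrix_apply]

end DualPair

end DualPair

/-! ### Alternating words and their last factor -/

section Words

variable {k A R : Type u} [Field k] [Ring A] [Algebra k A] [Ring R] [Algebra k R]

theorem finite_alt {x y : Obj k A} (hx : FiniteDimensional k x.X) (hy : FiniteDimensional k y.X)
    (j : ℕ) : FiniteDimensional k (Obj.alt x y j).X := by
  induction j generalizing x y with
  | zero => exact hx
  | succ j ih => exact ih hy hx

instance (x y : Obj k A) [hx : FiniteDimensional k x.X] [hy : FiniteDimensional k y.X] (j : ℕ) :
    FiniteDimensional k (Obj.alt x y j).X :=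
  finite_alt hx hy j

theorem finite_word (x y : Obj k A) [FiniteDimensional k x.X] [FiniteDimensional k y.X]
    (j m : ℕ) : FiniteDimensional k (Obj.word x y j m).X := by
  induction m generalizing j with
  | zero => exact inferInstanceAs (FiniteDimensional k k)
  | succ m ih =>
    have := ih (j + 1)
    exact inferInstanceAs (FiniteDimensional k ((Obj.alt x y j).X ⊗[k] (Obj.word x y (j + 1) m).X))

instance (x y : Obj k A) [FiniteDimensional k x.X] [FiniteDimensional k y.X]
    (j m : ℕ) : FiniteDimensional k (Obj.word x y j m).X :=
  finite_word x y j m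

theorem nontrivial_alt {x y : Obj k A} (hx : Nontrivial x.X) (hy : Nontrivial y.X)
    (j : ℕ) : Nontrivial (Obj.alt x y j).X := by
  induction j generalizing x y with
  | zero => exact hx
  | succ j ih => exact ih hy hx

instance (x y : Obj k A) [hx : Nontrivial x.X] [hy : Nontrivial y.X] (j : ℕ) :
    Nontrivial (Obj.alt x y j).X :=
  nontrivial_alt hx hy j

theorem nontrivial_word (x y : Obj k A) [Nontrivial x.X] [Nontrivial y.X]
    (j m : ℕ) : Nontrivial (Obj.word x y j m).X := by
  induction m generalizing j with
  | zero => exact inferInstanceAs (Nontrivial k)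
  | succ m ih =>
    have := ih (j + 1)
    exact inferInstanceAs (Nontrivial ((Obj.alt x y j).X ⊗[k] (Obj.word x y (j + 1) m).X))

instance (x y : Obj k A) [Nontrivial x.X] [Nontrivial y.X] (j m : ℕ) :
    Nontrivial (Obj.word x y j m).X :=
  nontrivial_word x y j m

theorem finrank_alt {x y : Obj k A} {d : ℕ} (hx : Module.finrank k x.X = d)
    (hy : Module.finrank k y.X = d) (j : ℕ) : Module.finrank k (Obj.alt x y j).X = d := by
  induction j generalizing x y with
  | zero => exact hx
  | succ j ih => exact ih hy hx

theorem finrank_word {x y : Obj k A} {d : ℕ} (hx : Module.finrank k x.X = d)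
    (hy : Module.finrank k y.X = d) (j m : ℕ) : Module.finrank k (Obj.word x y j m).X = d ^ m := by
  induction m generalizing j with
  | zero => exact Module.finrank_self k
  | succ m ih =>
    refine (Module.finrank_tensorProduct (R := k) (S := k) (M := (Obj.alt x y j).X)
      (M' := (Obj.word x y (j + 1) m).X)).trans ?_
    rw [ih, finrank_alt hx hy, pow_succ']

/-- The alternating sequence `a, b, a, b, …`, over the alternating sequence of spaces. -/
def altU : (x y : Obj k A) → (Module.End k x.X ⊗[k] R)ˣ → (Module.End k y.X ⊗[k] R)ˣ → (j : ℕ) →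
    (Module.End k (Obj.alt x y j).X ⊗[k] R)ˣ
  | _, _, a, _, 0 => a
  | x, y, a, b, j + 1 => altU y x b a j

/-- The alternating product `a ⊗ b ⊗ a ⊗ ⋯`, over the spaces of the words in `x` and `y`. -/
def wordU (x y : Obj k A) (a : (Module.End k x.X ⊗[k] R)ˣ) (b : (Module.End k y.X ⊗[k] R)ˣ) :
    (j m : ℕ) → (Module.End k (Obj.word x y j m).X ⊗[k] R)ˣ
  | _, 0 => 1
  | j, m + 1 => legMulU (altU x y a b j) (wordU x y a b (j + 1) m)

theorem addRight_wordSnoc (x y : Obj k A) (j m : ℕ) (T : Module.End k (Obj.word x y j m).X)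
    (b : (Obj.word x y j m).X) (c : (Obj.alt x y (Obj.nextIndex j m)).X) :
    Obj.addRight x y j m T (Obj.wordSnoc x y j m (b ⊗ₜ[k] c)) =
      Obj.wordSnoc x y j m (T b ⊗ₜ[k] c) := by
  change Obj.wordSnoc x y j m (Module.End.rTensorAlgHom k _ _ T
    ((Obj.wordSnoc x y j m).symm (Obj.wordSnoc x y j m (b ⊗ₜ[k] c)))) = _
  rw [LinearEquiv.symm_apply_apply]
  rfl

/-- `T ↦ id ⊗ T`, from operators on the last tensor factor. -/
def onLast (x y : Obj k A) (j m : ℕ) :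
    Module.End k (Obj.alt x y (Obj.nextIndex j m)).X →ₐ[k]
      Module.End k (Obj.word x y j (m + 1)).X :=
  ((Obj.wordSnoc x y j m).conjAlgEquiv k : _ →ₐ[k] _).comp
    (Module.End.lTensorAlgHom k (Obj.alt x y (Obj.nextIndex j m)).X (Obj.word x y j m).X)

theorem onLast_wordSnoc (x y : Obj k A) (j m : ℕ)
    (T : Module.End k (Obj.alt x y (Obj.nextIndex j m)).X)
    (b : (Obj.word x y j m).X) (c : (Obj.alt x y (Obj.nextIndex j m)).X) :
    onLast x y j m T (Obj.wordSnoc x y j m (b ⊗ₜ[k] c)) =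
      Obj.wordSnoc x y j m (b ⊗ₜ[k] T c) := by
  change Obj.wordSnoc x y j m (Module.End.lTensorAlgHom k _ _ T
    ((Obj.wordSnoc x y j m).symm (Obj.wordSnoc x y j m (b ⊗ₜ[k] c)))) = _
  rw [LinearEquiv.symm_apply_apply]
  rfl

theorem addRight_map (x y : Obj k A) (j m : ℕ) (S : Module.End k (Obj.alt x y j).X)
    (T : Module.End k (Obj.word x y (j + 1) m).X) :
    Obj.addRight x y j (m + 1) (TensorProduct.map S T) =
      TensorProduct.map S (Obj.addRight x y (j + 1) m T) := by
  refine Obj.conj_eq _ _ _ ?_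
  refine TensorProduct.ext_threefold fun a b c => ?_
  exact congrArg (fun z => S a ⊗ₜ[k] z) (addRight_wordSnoc x y (j + 1) m T b c).symm

theorem onLast_succ (x y : Obj k A) (j m : ℕ)
    (T : Module.End k (Obj.alt x y (Obj.nextIndex (j + 1) m)).X) :
    onLast x y j (m + 1) T = Obj.addLeft x y j (m + 1) (onLast x y (j + 1) m T) := by
  refine Obj.conj_eq _ _ _ ?_
  refine TensorProduct.ext_threefold fun a b c => ?_
  exact congrArg (fun z => a ⊗ₜ[k] z) (onLast_wordSnoc x y (j + 1) m T b c).symm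

/-- `T ↦ T ⊗ id`, from operators on the first tensor factor. -/
def onFirst (x y : Obj k A) (j m : ℕ) :
    Module.End k (Obj.alt x y j).X →ₐ[k] Module.End k (Obj.word x y j (m + 1)).X :=
  Module.End.rTensorAlgHom k (Obj.alt x y j).X (Obj.word x y (j + 1) m).X

theorem conj_lid_rid {Z : Type u} [AddCommGroup Z] [Module k Z] (T : Module.End k Z) :
    ((TensorProduct.lid k Z).trans (TensorProduct.rid k Z).symm).conjAlgEquiv k
      (Module.End.lTensorAlgHom k Z k T) = Module.End.rTensorAlgHom k Z k T := by
  refine Obj.conj_eq _ _ _ ?_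
  ext a
  change (TensorProduct.rid k _).symm (TensorProduct.lid k _ (1 ⊗ₜ[k] T a)) =
    Module.End.rTensorAlgHom k _ k T ((TensorProduct.rid k _).symm
      (TensorProduct.lid k _ (1 ⊗ₜ[k] a)))
  simp only [TensorProduct.lid_tmul, TensorProduct.rid_symm_apply, one_smul]
  rfl

theorem onLast_zero (x y : Obj k A) (j : ℕ) (T : Module.End k (Obj.alt x y j).X) :
    onLast x y j 0 T = onFirst x y j 0 T :=
  conj_lid_rid T

theorem addRight_addLeft (x y : Obj k A) (j m : ℕ) (T : Module.End k (Obj.word x y (j + 1) m).X) :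
    Obj.addRight x y j (m + 1) (Obj.addLeft x y j m T) =
      Obj.addLeft x y j (m + 1) (Obj.addRight x y (j + 1) m T) :=
  addRight_map x y j m LinearMap.id T

theorem addRight_onFirst (x y : Obj k A) (j m : ℕ) (T : Module.End k (Obj.alt x y j).X) :
    Obj.addRight x y j (m + 1) (onFirst x y j m T) = onFirst x y j (m + 1) T := by
  refine (addRight_map x y j m T 1).trans ?_
  rw [map_one]
  rfl

/-- Words are defined by adding factors on the left, whereas the tower grows on the right. In this
form the new factor commutes with the operators on the old ones, as `Stage.next` requires. -/
theorem coe_wordU_snoc (x y : Obj k A) (a : (Module.End k x.X ⊗[k] R)ˣ)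
    (b : (Module.End k y.X ⊗[k] R)ˣ) (j m : ℕ) :
    (wordU x y a b j (m + 1) : Module.End k (Obj.word x y j (m + 1)).X ⊗[k] R) =
      mapL (Obj.addRight x y j m) R (wordU x y a b j m) *
        mapL (onLast x y j m) R (altU x y a b (Obj.nextIndex j m)) := by
  induction m generalizing j with
  | zero =>
    change mapL (onFirst x y j 0) R (altU x y a b j) * mapL (Obj.addLeft x y j 0) R 1 =
      mapL (Obj.addRight x y j 0) R 1 * mapL (onLast x y j 0) R
        (altU x y a b j : Module.End k (Obj.alt x y j).X ⊗[k] R)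
    rw [map_one, map_one, mul_one, one_mul]
    exact Obj.map_eq_map_of _ _ (fun T => (onLast_zero x y j T).symm) _
  | succ m ih =>
    have h1 : (wordU x y a b j (m + 2) : Module.End k (Obj.word x y j (m + 2)).X ⊗[k] R) =
        mapL (onFirst x y j (m + 1)) R (altU x y a b j) *
          mapL (Obj.addLeft x y j (m + 1)) R (wordU x y a b (j + 1) (m + 1)) := rfl
    have h2 : (wordU x y a b j (m + 1) : Module.End k (Obj.word x y j (m + 1)).X ⊗[k] R) =
        mapL (onFirst x y j m) R (altU x y a b j) *
          mapL (Obj.addLeft x y j m) R (wordU x y a b (j + 1) m) := rfl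
    rw [h1, h2, ih, map_mul, map_mul, Obj.map_map_apply, Obj.map_map_apply, Obj.map_map_apply,
      Obj.map_map_apply, mul_assoc]
    congr 1
    · exact Obj.map_eq_map_of _ _ (fun T => (addRight_onFirst x y j m T).symm) _
    · congr 1
      · exact Obj.map_eq_map_of _ _ (fun T => (addRight_addLeft x y j m T).symm) _
      · exact Obj.map_eq_map_of _ _ (fun T => (onLast_succ x y j m T).symm) _

end Words

/-! ### Operators on the last factors of a word -/

section Iterated

variable {k A : Type u} [Field k] [Ring A] [Algebra k A]

/-- The iterated inclusion `T ↦ id ⊗ T`. -/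
def emb (x y : Obj k A) : (j m i : ℕ) → j + m = i →
    (Module.End k (Obj.word x y j m).X →ₐ[k] Module.End k (Obj.word x y 0 i).X)
  | 0, m, i, h => (by
      obtain rfl : m = i := by omega
      exact AlgHom.id k _)
  | j + 1, m, i, h => (emb x y j (m + 1) i (by omega)).comp (Obj.addLeft x y j m)

theorem emb_succ (x y : Obj k A) (j m i : ℕ) (h : j + 1 + m = i) (h' : j + (m + 1) = i)
    (T : Module.End k (Obj.word x y (j + 1) m).X) :
    emb x y (j + 1) m i h T = emb x y j (m + 1) i h' (Obj.addLeft x y j m T) := rfl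

theorem emb_addRight (x y : Obj k A) (j m i : ℕ) (h : j + m = i) (h' : j + (m + 1) = i + 1)
    (T : Module.End k (Obj.word x y j m).X) :
    emb x y j (m + 1) (i + 1) h' (Obj.addRight x y j m T) =
      Obj.addRight x y 0 i (emb x y j m i h T) := by
  induction j generalizing m with
  | zero =>
    obtain rfl : m = i := by omega
    rfl
  | succ j ih =>
    rw [emb_succ x y j m i h (by omega), ← ih (m + 1) (by omega) (by omega), addRight_addLeft]
    rfl

theorem addLeft_injective (x y : Obj k A) [Nontrivial x.X] [Nontrivial y.X] (j m : ℕ) :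
    Function.Injective (Obj.addLeft x y j m) :=
  lTensorAlgHom_injective (X := (Obj.alt x y j).X)

theorem emb_injective (x y : Obj k A) [Nontrivial x.X] [Nontrivial y.X] (j m i : ℕ)
    (h : j + m = i) : Function.Injective (emb x y j m i h) := by
  induction j generalizing m with
  | zero =>
    obtain rfl : m = i := by omega
    exact Function.injective_id
  | succ j ih => exact (ih (m + 1) (by omega)).comp (addLeft_injective x y j m)

variable {W : Type u} [AddCommGroup W] [Module k W]

/-- The j left-hand factors are removed one at a time by `conjugable_legMulU_iff`. On the tower side
this is why the position (i, -j) only sees the last i - j factors. -/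
theorem conjugable_emb_iff (x y : Obj k A) [Nontrivial x.X] [Nontrivial y.X]
    (a : (Module.End k x.X ⊗[k] Module.End k W)ˣ) (b : (Module.End k y.X ⊗[k] Module.End k W)ˣ)
    (j m i : ℕ) (h : j + m = i) (T : Module.End k (Obj.word x y j m).X) :
    Conjugable (wordU x y a b 0 i) (emb x y j m i h T) ↔ Conjugable (wordU x y a b j m) T := by
  induction j generalizing m with
  | zero =>
    obtain rfl : m = i := by omega
    rfl
  | succ j ih =>
    rw [emb_succ x y j m i h (by omega), ih]
    exact conjugable_legMulU_iff _ _ T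

end Iterated

/-- The alternating sequence of dualities has period two, which is used in `commute_altPair`. -/
theorem DualPair.symm_symm {k Z Z' : Type u} [Field k] [AddCommGroup Z] [Module k Z]
    [AddCommGroup Z'] [Module k Z'] (D : DualPair k Z Z') : D.symm.symm = D := by
  have h1 : D.symm.symm.ξ = D.ξ := (TensorProduct.comm k Z Z').symm_apply_apply D.ξ
  have h2 : D.symm.symm.p = D.p := by
    ext a b
    rfl
  exact DualPair.ext h1 h2

/-! ### Coevaluation and evaluation on the last two factors; partial traces -/

section CoevEv

variable {k A R : Type u} [Field k] [Ring A] [Algebra k A] [Ring R] [Algebra k R]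

/-- The alternating sequence of dualities. -/
def altPair : (x y : Obj k A) → DualPair k x.X y.X → (j : ℕ) →
    DualPair k (Obj.alt x y j).X (Obj.alt x y (j + 1)).X
  | _, _, D, 0 => D
  | x, y, D, j + 1 => altPair y x D.symm j

variable (x y : Obj k A) (D : DualPair k x.X y.X)

/-- The coevaluation of the last two tensor factors of a word. -/
def coev : (j m : ℕ) → (Obj.word x y j m).X →ₗ[k] (Obj.word x y j (m + 2)).X
  | j, 0 => LinearMap.toSpanSingleton k ((Obj.alt x y j).X ⊗[k] ((Obj.alt x y (j + 1)).X ⊗[k] k))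
      (LinearMap.lTensor (Obj.alt x y j).X
        (TensorProduct.rid k (Obj.alt x y (j + 1)).X).symm.toLinearMap (altPair x y D j).ξ)
  | j, m + 1 => LinearMap.lTensor (Obj.alt x y j).X (coev (j + 1) m)

/-- The evaluation of the last two tensor factors of a word. -/
def ev : (j m : ℕ) → (Obj.word x y j (m + 2)).X →ₗ[k] (Obj.word x y j m).X
  | j, 0 => (altPair x y D j).p ∘ₗ LinearMap.lTensor (Obj.alt x y j).X
        (TensorProduct.rid k (Obj.alt x y (j + 1)).X).toLinearMap
  | j, m + 1 => LinearMap.lTensor (Obj.alt x y j).X (ev (j + 1) m)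

theorem exists_eq_algebraMap (T : Module.End k k) : ∃ c : k, T = algebraMap k (Module.End k k) c :=
  ⟨T 1, by ext; simp⟩

/-- The tensor product of an operator on the first factor of a word with an operator on the
remaining ones. -/
def wmap (j m : ℕ) (S : Module.End k (Obj.alt x y j).X)
    (T : Module.End k (Obj.word x y (j + 1) m).X) : Module.End k (Obj.word x y j (m + 1)).X :=
  TensorProduct.map S T

theorem addRight_wmap (j m : ℕ) (S : Module.End k (Obj.alt x y j).X)
    (T : Module.End k (Obj.word x y (j + 1) m).X) :
    Obj.addRight x y j (m + 1) (wmap x y j m S T) =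
      wmap x y j (m + 1) S (Obj.addRight x y (j + 1) m T) :=
  addRight_map x y j m S T

variable [FiniteDimensional k x.X] [FiniteDimensional k y.X]

theorem end_word_induction (j m : ℕ) {P : Module.End k (Obj.word x y j (m + 1)).X → Prop}
    (add : ∀ S T, P S → P T → P (S + T)) (map : ∀ S T, P (wmap x y j m S T))
    (T : Module.End k (Obj.word x y j (m + 1)).X) : P T :=
  end_tensor_induction (X := (Obj.alt x y j).X) (Y := (Obj.word x y (j + 1) m).X) add map T

theorem trace_wmap (j m : ℕ) (S : Module.End k (Obj.alt x y j).X)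
    (T : Module.End k (Obj.word x y (j + 1) m).X) :
    LinearMap.trace k _ (wmap x y j m S T) = LinearMap.trace k _ S * LinearMap.trace k _ T :=
  LinearMap.trace_tensorProduct' S T

theorem addRight_addRight_coev (j m : ℕ) (h : Module.End k (Obj.word x y j m).X) :
    Obj.addRight x y j (m + 1) (Obj.addRight x y j m h) ∘ₗ coev x y D j m =
      coev x y D j m ∘ₗ h := by
  induction m generalizing j with
  | zero =>
    -- The empty word is k, so h is a scalar.
    obtain ⟨c, hc⟩ := exists_eq_algebraMap (h : Module.End k k)
    have hc' : h = algebraMap k (Module.End k (Obj.word x y j 0).X) c := hc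
    rw [hc', AlgHom.commutes, AlgHom.commutes]
    exact LinearMap.ext fun z => (map_smul (coev x y D j 0) c z).symm
  | succ m ih =>
    induction h using end_word_induction with
    | add S T hS hT =>
      rw [map_add, map_add, LinearMap.add_comp, hS, hT, LinearMap.comp_add]
    | map S T =>
      rw [addRight_wmap, addRight_wmap]
      refine TensorProduct.ext' fun a b => ?_
      exact congrArg (fun z => S a ⊗ₜ[k] z) (LinearMap.congr_fun (ih (j + 1) T) b)

theorem DualPair.p_map_rid {Z Z' : Type u} [AddCommGroup Z] [Module k Z] [AddCommGroup Z']
    [Module k Z'] (P : DualPair k Z Z') (B : Module.End k Z) (c : k) :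
    (P.p ∘ₗ LinearMap.lTensor Z (TensorProduct.rid k Z').toLinearMap)
      (TensorProduct.map B (algebraMap k (Module.End k (Z' ⊗[k] k)) c)
        ((1 : k) • LinearMap.lTensor Z (TensorProduct.rid k Z').symm.toLinearMap P.ξ)) =
      LinearMap.trace k Z B * c := by
  rw [← P.p_rTensor, one_smul]
  generalize P.ξ = z
  induction z with
  | zero => simp
  | add a b ha hb => simp only [map_add, ha, hb, add_mul]
  | tmul a b => simp [mul_comm]

theorem trace_end_self (f : Module.End k k) : LinearMap.trace k k f = f 1 := by
  obtain ⟨c, rfl⟩ := exists_eq_algebraMap f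
  rw [Algebra.algebraMap_eq_smul_one, map_smul, LinearMap.trace_one, Module.finrank_self]
  simp

/-- ev ∘ (g ⊗ id) ∘ coev is the partial trace of g over its last factor. Peeling off first factors
reduces this to the pairing p((B ⊗ 1)ξ) = tr B. -/
theorem trace_ev_addRight_coev (j m : ℕ) (g : Module.End k (Obj.word x y j (m + 1)).X) :
    LinearMap.trace k _ (ev x y D j m ∘ₗ Obj.addRight x y j (m + 1) g ∘ₗ coev x y D j m) =
      LinearMap.trace k _ g := by
  induction m generalizing j with
  | zero =>
    induction g using end_word_induction with
    | add S T hS hT =>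
      rw [map_add, LinearMap.add_comp, LinearMap.comp_add, map_add, map_add, hS, hT]
    | map S T =>
      obtain ⟨c, hc⟩ := exists_eq_algebraMap (T : Module.End k k)
      have hc' : T = algebraMap k (Module.End k (Obj.word x y (j + 1) 0).X) c := hc
      have hT : LinearMap.trace k (Obj.word x y (j + 1) 0).X T = c := by
        refine (trace_end_self (T : Module.End k k)).trans ?_
        rw [hc]
        simp
      rw [addRight_wmap, trace_wmap, hT, hc', AlgHom.commutes]
      refine (trace_end_self (k := k) (ev x y D j 0 ∘ₗ _ ∘ₗ coev x y D j 0)).trans ?_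
      exact (altPair x y D j).p_map_rid S c
  | succ m ih =>
    induction g using end_word_induction with
    | add S T hS hT =>
      rw [map_add, LinearMap.add_comp, LinearMap.comp_add, map_add, map_add, hS, hT]
    | map S T =>
      have h : ev x y D j (m + 1) ∘ₗ
          wmap x y j (m + 2) S (Obj.addRight x y (j + 1) (m + 1) T) ∘ₗ coev x y D j (m + 1) =
          wmap x y j m S (ev x y D (j + 1) m ∘ₗ
            Obj.addRight x y (j + 1) (m + 1) T ∘ₗ coev x y D (j + 1) m) :=
        TensorProduct.ext' fun a b => rfl
      rw [addRight_wmap, h, trace_wmap, ih, trace_wmap]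

theorem trace_addRight {d : ℕ} (hx : Module.finrank k x.X = d) (hy : Module.finrank k y.X = d)
    (j m : ℕ) (f : Module.End k (Obj.word x y j m).X) :
    LinearMap.trace k _ (Obj.addRight x y j m f) = d * LinearMap.trace k _ f := by
  refine (LinearMap.trace_conj' (Module.End.rTensorAlgHom k _ _ f)
    (Obj.wordSnoc x y j m)).trans ?_
  refine (LinearMap.trace_tensorProduct' f LinearMap.id).trans ?_
  rw [LinearMap.trace_id, finrank_alt hx hy, mul_comm]

end CoevEv

/-! ### Commutation of cup ∘ cap with the alternating products -/

section CommuteCoevEv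

variable {k A R : Type u} [Field k] [Ring A] [Algebra k A] [Ring R] [Algebra k R]
  (x y : Obj k A) (D : DualPair k x.X y.X)

theorem commute_altPair {x y : Obj k A} {D : DualPair k x.X y.X}
    {a : (Module.End k x.X ⊗[k] R)ˣ} {b : (Module.End k y.X ⊗[k] R)ˣ}
    (h : Commute (D.cup ⊗ₜ[k] (1 : R)) (legMul (a : Module.End k x.X ⊗[k] R) ↑b))
    (h' : Commute (D.symm.cup ⊗ₜ[k] (1 : R)) (legMul (b : Module.End k y.X ⊗[k] R) ↑a)) (j : ℕ) :
    Commute ((altPair x y D j).cup ⊗ₜ[k] (1 : R))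
      (legMul (altU x y a b j : Module.End k (Obj.alt x y j).X ⊗[k] R)
        (altU x y a b (j + 1) : Module.End k (Obj.alt x y (j + 1)).X ⊗[k] R)) := by
  induction j generalizing x y with
  | zero => exact h
  | succ j ih =>
    refine ih h' ?_
    rwa [DualPair.symm_symm]

/-- Adding the tensor unit on the right of the second factor. -/
def addUnit (Z Z' : Type u) [AddCommGroup Z] [Module k Z] [AddCommGroup Z'] [Module k Z'] :
    Z ⊗[k] Z' ≃ₗ[k] Z ⊗[k] (Z' ⊗[k] k) :=
  TensorProduct.congr (LinearEquiv.refl k Z) (TensorProduct.rid k Z').symm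

theorem cj_addUnit {Z Z' : Type u} [AddCommGroup Z] [Module k Z] [AddCommGroup Z'] [Module k Z']
    (a : Module.End k Z ⊗[k] R) (b : Module.End k Z' ⊗[k] R) :
    Obj.cj (addUnit Z Z') (legMul a b) = legMul a (legMul b (1 : Module.End k k ⊗[k] R)) := by
  simp only [legMul, map_mul, Obj.map_map_apply, map_one, mul_one]
  congr 1
  · refine Obj.map_eq_map_of _ _ (fun T => Obj.conj_eq _ _ _ ?_) _
    ext a b; rfl
  · refine Obj.map_eq_map_of _ _ (fun T => Obj.conj_eq _ _ _ ?_) _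
    ext a b
    change a ⊗ₜ[k] (TensorProduct.rid k Z').symm (T b) = Module.End.lTensorAlgHom k _ _
      (Module.End.rTensorAlgHom k Z' k T) (a ⊗ₜ[k] (TensorProduct.rid k Z').symm b)
    rw [TensorProduct.rid_symm_apply, TensorProduct.rid_symm_apply]
    rfl

/-- Only the last two letters matter, and they are x, y or y, x according to parity; hence the two
hypotheses. -/
theorem commute_coev_ev (a : (Module.End k x.X ⊗[k] R)ˣ) (b : (Module.End k y.X ⊗[k] R)ˣ)
    (h : Commute (D.cup ⊗ₜ[k] (1 : R)) (legMul (a : Module.End k x.X ⊗[k] R) ↑b))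
    (h' : Commute (D.symm.cup ⊗ₜ[k] (1 : R)) (legMul (b : Module.End k y.X ⊗[k] R) ↑a)) (j m : ℕ) :
    Commute ((coev x y D j m ∘ₗ ev x y D j m : Module.End k (Obj.word x y j (m + 2)).X) ⊗ₜ[k] (1 : R))
      (wordU x y a b j (m + 2) : Module.End k (Obj.word x y j (m + 2)).X ⊗[k] R) := by
  induction m generalizing j with
  | zero =>
    have h1 := (commute_altPair h h' j).map (Obj.cj (addUnit _ _))
    rw [cj_addUnit, Algebra.TensorProduct.map_tmul, map_one] at h1
    have e : (coev x y D j 0 ∘ₗ ev x y D j 0 : Module.End k (Obj.word x y j 2).X) =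
        (addUnit _ _).conjAlgEquiv k (altPair x y D j).cup := LinearMap.ext fun z =>
          ((addUnit (Obj.alt x y j).X (Obj.alt x y (j + 1)).X).map_smul
            (show k from ev x y D j 0 z) (altPair x y D j).ξ).symm
    rw [e]
    exact h1
  | succ m ih =>
    have e : (coev x y D j (m + 1) ∘ₗ ev x y D j (m + 1) :
        Module.End k (Obj.word x y j (m + 3)).X) = Module.End.lTensorAlgHom k
          (Obj.word x y (j + 1) (m + 2)).X (Obj.alt x y j).X
          (coev x y D (j + 1) m ∘ₗ ev x y D (j + 1) m) := TensorProduct.ext' fun a b => rfl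
    rw [e]
    have h1 := Obj.commute_legs_right (Obj.alt x y j).X (Obj.word x y (j + 1) (m + 2)).X
      (coev x y D (j + 1) m ∘ₗ ev x y D (j + 1) m)
      (altU x y a b j : Module.End k (Obj.alt x y j).X ⊗[k] R)
    refine h1.mul_right ?_
    have h2 := (ih (j + 1)).map (mapL (Module.End.lTensorAlgHom k
      (Obj.word x y (j + 1) (m + 2)).X (Obj.alt x y j).X) R)
    rwa [Algebra.TensorProduct.map_tmul, map_one] at h2

end CommuteCoevEv

/-! ### Nondegeneracy and uniqueness of traces on matrix algebras -/

section Trace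

variable {k M W : Type u} [Field k] [AddCommGroup M] [Module k M] [FiniteDimensional k M]
  [AddCommGroup W] [Module k W] [FiniteDimensional k W]

theorem end_rankOne_induction {P : Module.End k M → Prop} (zero : P 0)
    (add : ∀ S T, P S → P T → P (S + T))
    (rankOne : ∀ (φ : Module.Dual k M) (m : M), P (φ.smulRight m)) (T : Module.End k M) : P T := by
  obtain ⟨z, rfl⟩ := (dualTensorHomEquiv k M M).surjective T
  induction z with
  | zero => simpa using zero
  | add a b ha hb => rw [map_add]; exact add _ _ ha hb
  | tmul φ m =>
    convert rankOne φ m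
    ext; simp

theorem eq_zero_of_trace_mul (f : Module.End k M) (h : ∀ g, LinearMap.trace k M (f * g) = 0) :
    f = 0 := by
  ext m
  refine (Module.forall_dual_apply_eq_zero_iff k _).1 fun φ => ?_
  have h1 := h (φ.smulRight m)
  have h2 : f * φ.smulRight m = φ.smulRight (f m) := by ext; simp
  rw [h2, LinearMap.trace_smulRight] at h1
  simpa using h1

/-- Traces on the algebra of linear endomorphisms are unique up to a scalar. -/
theorem exists_eq_smul_trace (σ : Module.End k M →ₗ[k] k) (hσ : ∀ a b, σ (a * b) = σ (b * a)) :
    ∃ c : k, ∀ T, σ T = c * LinearMap.trace k M T := by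
  rcases subsingleton_or_nontrivial M with hM | hM
  · exact ⟨0, fun T => by rw [Subsingleton.elim T 0]; simp⟩
  obtain ⟨x₀, hx₀⟩ := exists_ne (0 : M)
  obtain ⟨φ₁, hφ₁⟩ := Module.Projective.exists_dual_ne_zero k hx₀
  set φ₀ := (φ₁ x₀)⁻¹ • φ₁ with hφ₀
  have h1 : φ₀ x₀ = 1 := by simp [hφ₀, hφ₁]
  refine ⟨σ (φ₀.smulRight x₀), fun T => ?_⟩
  induction T using end_rankOne_induction with
  | zero => simp
  | add S T hS hT => rw [map_add, map_add, hS, hT, mul_add]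
  | rankOne φ m =>
    -- Since φ₀(x₀) = 1, a rank one operator factors through the line of x₀; exchanging the two
    -- factors leaves φ(m) times one fixed rank one operator, whose σ-value is the constant.
    have e1 : φ.smulRight m = (φ₀.smulRight m * φ.smulRight x₀ : Module.End k M) := by
      ext z; simp [h1]
    have e2 : (φ.smulRight x₀ * φ₀.smulRight m : Module.End k M) = φ m • φ₀.smulRight x₀ := by
      ext z; simp [smul_smul, mul_comm]
    rw [LinearMap.trace_smulRight, e1, hσ, e2, map_smul, smul_eq_mul, mul_comm]

variable (k M W) in
/-- `L(M) ⊗ L(W) ≃ L(M ⊗ W)`. -/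
def endTensorEnd : Module.End k M ⊗[k] Module.End k W ≃ₐ[k] Module.End k (M ⊗[k] W) :=
  AlgEquiv.ofBijective
    (Module.endTensorEndAlgHom (R := k) (S := k) (A := k) (M := M) (N := W))
    (by
      convert (homTensorHomEquiv k M W M W).bijective using 1
      funext z
      induction z with
      | zero => simp
      | add a b ha hb => simp only [map_add, ha, hb]
      | tmul S T =>
        rw [Module.endTensorEndAlgHom_apply, homTensorHomEquiv_apply]
        rfl)

theorem endTensorEnd_tmul (S : Module.End k M) (T : Module.End k W) :
    endTensorEnd k M W (S ⊗ₜ[k] T) = TensorProduct.map S T := rfl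

variable (k M W) in
/-- The trace `tr ⊗ tr`. -/
def trT : Module.End k M ⊗[k] Module.End k W →ₗ[k] k :=
  LinearMap.mul' k k ∘ₗ TensorProduct.map (LinearMap.trace k M) (LinearMap.trace k W)

@[simp]
theorem trT_tmul (S : Module.End k M) (T : Module.End k W) :
    trT k M W (S ⊗ₜ[k] T) = LinearMap.trace k M S * LinearMap.trace k W T := by
  simp [trT]

theorem trT_eq_trace (z : Module.End k M ⊗[k] Module.End k W) :
    trT k M W z = LinearMap.trace k _ (endTensorEnd k M W z) := by
  induction z with
  | zero => simp
  | add a b ha hb => simp only [map_add, ha, hb]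
  | tmul S T => rw [endTensorEnd_tmul, LinearMap.trace_tensorProduct', trT_tmul]

theorem trT_mul_comm (a b : Module.End k M ⊗[k] Module.End k W) :
    trT k M W (a * b) = trT k M W (b * a) := by
  rw [trT_eq_trace, trT_eq_trace, map_mul (endTensorEnd k M W), LinearMap.trace_mul_comm,
    map_mul (endTensorEnd k M W)]

theorem eq_zero_of_trT_mul (a : Module.End k M ⊗[k] Module.End k W)
    (h : ∀ b, trT k M W (a * b) = 0) : a = 0 := by
  refine (endTensorEnd k M W).injective ?_
  rw [map_zero]
  refine eq_zero_of_trace_mul _ fun g => ?_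
  obtain ⟨b, rfl⟩ := (endTensorEnd k M W).surjective g
  rw [← map_mul, ← trT_eq_trace, h]

theorem exists_eq_smul_trT (σ : Module.End k M ⊗[k] Module.End k W →ₗ[k] k)
    (hσ : ∀ a b, σ (a * b) = σ (b * a)) : ∃ c : k, ∀ z, σ z = c * trT k M W z := by
  obtain ⟨c, hc⟩ := exists_eq_smul_trace (σ ∘ₗ (endTensorEnd k M W).symm.toLinearMap) (by
    intro a b
    simp only [LinearMap.comp_apply, AlgEquiv.toLinearMap_apply, map_mul, hσ])
  refine ⟨c, fun z => ?_⟩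
  rw [trT_eq_trace, ← hc]
  simp

theorem trT_one : trT k M W 1 = Module.finrank k M * Module.finrank k W := by
  rw [Algebra.TensorProduct.one_def, trT_tmul, LinearMap.trace_one, LinearMap.trace_one]

end Trace

/-! ### The basic construction for matrix algebras by bending -/

/-- The data of a basic construction: inclusions `L(X) ⊂ L(Y) ⊂ L(Y')` together with maps
`cup : X → Y'` and `cap : Y' → X` which give the Jones projection. -/
structure BasicData (k X Y Y' : Type u) [Field k] [AddCommGroup X] [Module k X] [AddCommGroup Y]
    [Module k Y] [AddCommGroup Y'] [Module k Y'] where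
  /-- the inclusion `L(X) ⊂ L(Y)` -/
  inc : Module.End k X →ₐ[k] Module.End k Y
  /-- the inclusion `L(Y) ⊂ L(Y')` -/
  inc' : Module.End k Y →ₐ[k] Module.End k Y'
  cup : X →ₗ[k] Y'
  cap : Y' →ₗ[k] X
  /-- the dimension of the duality -/
  d : k
  d_ne : d ≠ 0
  inc_cup : ∀ h, inc' (inc h) ∘ₗ cup = cup ∘ₗ h
  trace_inc : ∀ h, LinearMap.trace k Y (inc h) = d * LinearMap.trace k X h
  trace_inc' : ∀ g, LinearMap.trace k Y' (inc' g) = d * LinearMap.trace k Y g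
  trace_cap_cup : ∀ g, LinearMap.trace k X (cap ∘ₗ inc' g ∘ₗ cup) = LinearMap.trace k Y g
  finrank_eq : Module.finrank k Y * Module.finrank k Y = Module.finrank k X * Module.finrank k Y'

namespace BasicData

variable {k X Y Y' : Type u} [Field k] [AddCommGroup X] [Module k X] [AddCommGroup Y]
    [Module k Y] [AddCommGroup Y'] [Module k Y']
    [FiniteDimensional k Y'] (B : BasicData k X Y Y') [FiniteDimensional k X]
    [FiniteDimensional k Y]

/-- The Jones projection. -/
def proj : Module.End k Y' := B.d⁻¹ • (B.cup ∘ₗ B.cap)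

/-- `trace_cap_cup` computes tr(zf) from f ∘ cup alone, and the trace form is nondegenerate. With
`finrank_eq` injectivity becomes bijectivity. -/
theorem bend_injective : Function.Injective (fun f : Module.End k Y => B.inc' f ∘ₗ B.cup) := by
  intro f g h
  rw [← sub_eq_zero]
  refine eq_zero_of_trace_mul _ fun z => ?_
  rw [LinearMap.trace_mul_comm, ← B.trace_cap_cup, map_mul, map_sub]
  have h' : (B.inc' f - B.inc' g) ∘ₗ B.cup = 0 := by
    rw [LinearMap.sub_comp, sub_eq_zero]
    exact h
  rw [Module.End.mul_eq_comp, LinearMap.comp_assoc, h', LinearMap.comp_zero, LinearMap.comp_zero,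
    map_zero]

theorem cobend_injective : Function.Injective (fun f : Module.End k Y => B.cap ∘ₗ B.inc' f) := by
  intro f g h
  rw [← sub_eq_zero]
  refine eq_zero_of_trace_mul _ fun z => ?_
  rw [← B.trace_cap_cup, map_mul, map_sub]
  have h' : B.cap ∘ₗ (B.inc' f - B.inc' g) = 0 := by
    rw [LinearMap.comp_sub, sub_eq_zero]
    exact h
  rw [Module.End.mul_eq_comp, ← LinearMap.comp_assoc, ← LinearMap.comp_assoc, h',
    LinearMap.zero_comp, LinearMap.zero_comp, map_zero]

/-- The linear isomorphism `L(Y) ≃ L(X, Y')` given by the coevaluation. -/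
def bend : Module.End k Y ≃ₗ[k] (X →ₗ[k] Y') :=
  LinearEquiv.ofInjectiveOfFinrankEq
    ({ toFun := fun f => B.inc' f ∘ₗ B.cup
       map_add' := fun f g => by rw [map_add, LinearMap.add_comp]
       map_smul' := fun c f => by rw [map_smul, LinearMap.smul_comp]; rfl } :
      Module.End k Y →ₗ[k] (X →ₗ[k] Y')) B.bend_injective
    ((Module.finrank_linearMap k k Y Y).trans
      (B.finrank_eq.trans (Module.finrank_linearMap k k X Y').symm))

@[simp]
theorem bend_apply (f : Module.End k Y) : B.bend f = B.inc' f ∘ₗ B.cup := rfl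

theorem exists_cobend (β : Y' →ₗ[k] X) : ∃ f : Module.End k Y, B.cap ∘ₗ B.inc' f = β :=
  (LinearEquiv.ofInjectiveOfFinrankEq
    ({ toFun := fun f => B.cap ∘ₗ B.inc' f
       map_add' := fun f g => by rw [map_add, LinearMap.comp_add]
       map_smul' := fun c f => by rw [map_smul, LinearMap.comp_smul]; rfl } :
      Module.End k Y →ₗ[k] (Y' →ₗ[k] X)) B.cobend_injective
    ((Module.finrank_linearMap k k Y Y).trans (B.finrank_eq.trans
      ((mul_comm _ _).trans (Module.finrank_linearMap k k Y' X).symm)))).surjective β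

/-- A rank one operator of Y' factors through X. By bending, every map X → Y' is inc'(f) ∘ cup and
every map Y' → X is cap ∘ inc'(g), so the composite is d · inc'(f) e inc'(g). -/
theorem adjoin_eq_top [Nontrivial X] :
    Algebra.adjoin k (Set.range B.inc' ∪ {B.proj}) = ⊤ := by
  rw [eq_top_iff]
  intro T _
  induction T using end_rankOne_induction with
  | zero => exact zero_mem _
  | add S T hS hT => exact add_mem (hS trivial) (hT trivial)
  | rankOne φ m =>
    obtain ⟨x₀, hx₀⟩ := exists_ne (0 : X)
    obtain ⟨ψ, hψ⟩ := Module.Projective.exists_dual_ne_zero k hx₀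
    -- The factor (ψ x₀)⁻¹ compensates the scalar ψ(x₀) produced when this map is composed with
    -- φ(·)x₀.
    obtain ⟨f, hf⟩ := B.bend.surjective (ψ.smulRight ((ψ x₀)⁻¹ • m))
    obtain ⟨g, hg⟩ := B.exists_cobend (φ.smulRight x₀)
    have e : φ.smulRight m = B.inc' f * (B.d • B.proj) * B.inc' g := by
      have h1 : B.inc' f * (B.d • B.proj) * B.inc' g =
          (B.inc' f ∘ₗ B.cup) ∘ₗ (B.cap ∘ₗ B.inc' g) := by
        rw [proj, smul_smul, mul_inv_cancel₀ B.d_ne, one_smul]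
        rfl
      rw [h1, hg, ← B.bend_apply, hf]
      ext z
      simp only [LinearMap.coe_comp, Function.comp_apply, LinearMap.smulRight_apply, map_smul,
        smul_smul]
      rw [mul_inv_cancel₀ hψ, mul_one]
    rw [e]
    refine mul_mem (mul_mem ?_ (Subalgebra.smul_mem _ ?_ _)) ?_
    · exact Algebra.subset_adjoin (Or.inl ⟨f, rfl⟩)
    · exact Algebra.subset_adjoin (Or.inr rfl)
    · exact Algebra.subset_adjoin (Or.inl ⟨g, rfl⟩)

variable (R : Type u) [Ring R] [Algebra k R]

theorem adjoin_tensor_eq_top [Nontrivial X] :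
    Algebra.adjoin k (Set.range (mapL B.inc' R) ∪ {B.proj ⊗ₜ[k] (1 : R)}) = ⊤ := by
  set S := Algebra.adjoin k (Set.range (mapL B.inc' R) ∪ {B.proj ⊗ₜ[k] (1 : R)})
  have h1 : ∀ T : Module.End k Y', T ⊗ₜ[k] (1 : R) ∈ S := by
    intro T
    have h : T ∈ (Algebra.adjoin k (Set.range B.inc' ∪ {B.proj})) := by
      rw [B.adjoin_eq_top]; trivial
    have h2 : T ⊗ₜ[k] (1 : R) ∈ (Algebra.adjoin k (Set.range B.inc' ∪ {B.proj})).map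
        (Algebra.TensorProduct.includeLeft : Module.End k Y' →ₐ[k] Module.End k Y' ⊗[k] R) :=
      ⟨T, h, rfl⟩
    rw [AlgHom.map_adjoin] at h2
    refine Algebra.adjoin_mono ?_ h2
    rintro _ ⟨z, ⟨g, rfl⟩ | hz, rfl⟩
    · exact Or.inl ⟨g ⊗ₜ[k] 1, by simp⟩
    · rw [Set.mem_singleton_iff] at hz
      exact Or.inr (by rw [hz]; rfl)
  rw [eq_top_iff]
  intro z _
  induction z with
  | zero => exact zero_mem _
  | add a b ha hb => exact add_mem (ha trivial) (hb trivial)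
  | tmul T r =>
    have e : T ⊗ₜ[k] r = (T ⊗ₜ[k] (1 : R)) * mapL B.inc' R (1 ⊗ₜ[k] r) := by simp
    rw [e]
    exact mul_mem (h1 T) (Algebra.subset_adjoin (Or.inl ⟨_, rfl⟩))

/-- Postcomposition. -/
def postcomp (k X Y' : Type u) [Field k] [AddCommGroup X] [Module k X] [AddCommGroup Y']
    [Module k Y'] : Module.End k Y' →ₐ[k] Module.End k (X →ₗ[k] Y') where
  toFun T :=
    { toFun := fun α => T ∘ₗ α
      map_add' := fun α β => LinearMap.comp_add _ _ _
      map_smul' := fun c α => LinearMap.comp_smul _ _ _ }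
  map_one' := rfl
  map_mul' S T := rfl
  map_zero' := by ext; simp
  map_add' S T := by ext; simp
  commutes' c := by ext; simp

/-- The action of `L(Y')` on `L(Y) = L(X, Y')`. -/
def act : Module.End k Y' →ₐ[k] Module.End k (Module.End k Y) :=
  (B.bend.symm.conjAlgEquiv k : _ →ₐ[k] _).comp (postcomp k X Y')

theorem bend_act (T : Module.End k Y') (f : Module.End k Y) :
    B.bend (B.act T f) = T ∘ₗ B.bend f := by
  change B.bend (B.bend.symm (T ∘ₗ B.bend f)) = _
  rw [LinearEquiv.apply_symm_apply]

theorem act_injective [Nontrivial X] : Function.Injective B.act := by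
  intro S T h
  obtain ⟨x₀, hx₀⟩ := exists_ne (0 : X)
  obtain ⟨ψ, hψ⟩ := Module.Projective.exists_dual_ne_zero k hx₀
  ext y
  obtain ⟨f, hf⟩ := B.bend.surjective (ψ.smulRight y)
  have h1 := congrArg B.bend (LinearMap.congr_fun h f)
  rw [bend_act, bend_act, hf] at h1
  have h2 := LinearMap.congr_fun h1 x₀
  simp only [LinearMap.coe_comp, Function.comp_apply, LinearMap.smulRight_apply, map_smul] at h2
  exact smul_right_injective _ hψ h2

theorem act_inc' (g f : Module.End k Y) : B.act (B.inc' g) f = g * f := by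
  refine B.bend.injective ?_
  rw [bend_act, bend_apply, bend_apply, map_mul]
  rfl

/-- The conditional expectation `L(Y) → L(X)`. -/
def expect : Module.End k Y →ₗ[k] Module.End k X where
  toFun f := B.d⁻¹ • (B.cap ∘ₗ B.inc' f ∘ₗ B.cup)
  map_add' f g := by rw [map_add, LinearMap.add_comp, LinearMap.comp_add, smul_add]
  map_smul' c f := by
    rw [map_smul, LinearMap.smul_comp, LinearMap.comp_smul, smul_comm]
    rfl

/-- d⁻¹ cup ∘ (cap ∘ f ∘ cup) equals cup ∘ E(f), and `inc_cup` moves E(f) to the other side of cup.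
This identifies the Jones projection with d⁻¹ cup ∘ cap. -/
theorem act_proj (f : Module.End k Y) : B.act B.proj f = B.inc (B.expect f) := by
  refine B.bend.injective ?_
  rw [bend_act, bend_apply, bend_apply, B.inc_cup]
  simp only [proj, expect, LinearMap.coe_mk, AddHom.coe_mk, LinearMap.smul_comp,
    LinearMap.comp_smul, LinearMap.comp_assoc]

/-- The action of `L(Y') ⊗ R` on `L(Y) ⊗ R`. -/
def actT : Module.End k Y' ⊗[k] R →ₐ[k] Module.End k (Module.End k Y ⊗[k] R) :=
  (Module.endTensorEndAlgHom (R := k) (S := k) (A := k) (M := Module.End k Y) (N := R)).comp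
    (Algebra.TensorProduct.map B.act (Algebra.lmul k R))

theorem actT_tmul_tmul (T : Module.End k Y') (r : R) (f : Module.End k Y) (s : R) :
    B.actT R (T ⊗ₜ[k] r) (f ⊗ₜ[k] s) = B.act T f ⊗ₜ[k] (r * s) := rfl

theorem actT_injective [Nontrivial X] [FiniteDimensional k R] :
    Function.Injective (B.actT R) := by
  refine (endTensorEnd k (Module.End k Y) R).injective.comp ?_
  exact TensorProduct.map_injective_of_flat_flat B.act.toLinearMap (Algebra.lmul k R).toLinearMap
    B.act_injective (Algebra.lmul_injective)

theorem actT_mapL (z : Module.End k Y ⊗[k] R) :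
    B.actT R (mapL B.inc' R z) = Algebra.lmul k (Module.End k Y ⊗[k] R) z := by
  induction z with
  | zero => simp
  | add a b ha hb => simp only [map_add, ha, hb]
  | tmul g r =>
    refine TensorProduct.ext' fun f s => ?_
    rw [Algebra.TensorProduct.map_tmul, AlgHom.id_apply, actT_tmul_tmul, act_inc']
    simp

theorem actT_proj (z : Module.End k Y ⊗[k] R) :
    B.actT R (B.proj ⊗ₜ[k] 1) z = mapL B.inc R (LinearMap.rTensor R B.expect z) := by
  induction z with
  | zero => simp
  | add a b ha hb => simp only [map_add, ha, hb]
  | tmul f s =>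
    rw [actT_tmul_tmul, act_proj]
    simp

variable (W : Type u) [AddCommGroup W] [Module k W] [FiniteDimensional k W]

theorem trT_mapL_inc (z : Module.End k X ⊗[k] Module.End k W) :
    trT k Y W (mapL B.inc _ z) = B.d * trT k X W z := by
  induction z with
  | zero => simp
  | add a b ha hb => simp only [map_add, ha, hb, mul_add]
  | tmul f s => simp [B.trace_inc, mul_assoc]

theorem trT_mapL_inc' (z : Module.End k Y ⊗[k] Module.End k W) :
    trT k Y' W (mapL B.inc' _ z) = B.d * trT k Y W z := by
  induction z with
  | zero => simp
  | add a b ha hb => simp only [map_add, ha, hb, mul_add]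
  | tmul f s => simp [B.trace_inc', mul_assoc]

theorem trace_expect (f : Module.End k Y) (h : Module.End k X) :
    B.d * LinearMap.trace k X (B.expect f * h) = LinearMap.trace k Y (f * B.inc h) := by
  rw [← B.trace_cap_cup, map_mul B.inc', Module.End.mul_eq_comp, Module.End.mul_eq_comp,
    LinearMap.comp_assoc, B.inc_cup]
  simp only [expect, LinearMap.coe_mk, AddHom.coe_mk, LinearMap.smul_comp, map_smul, smul_eq_mul]
  rw [← mul_assoc, mul_inv_cancel₀ B.d_ne, one_mul]
  rfl

theorem trT_expect (z : Module.End k Y ⊗[k] Module.End k W)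
    (a : Module.End k X ⊗[k] Module.End k W) :
    B.d * trT k X W (LinearMap.rTensor _ B.expect z * a) = trT k Y W (z * mapL B.inc _ a) := by
  induction z with
  | zero => simp
  | add a b ha hb => simp only [map_add, add_mul, mul_add, ha, hb]
  | tmul f s =>
    induction a with
    | zero => simp
    | add a b ha hb => simp only [map_add, mul_add, ha, hb]
    | tmul h r =>
      simp only [LinearMap.rTensor_tmul, Algebra.TensorProduct.tmul_mul_tmul,
        Algebra.TensorProduct.map_tmul, AlgHom.id_apply, trT_tmul]
      rw [← B.trace_expect, mul_assoc]

theorem trT_mapL_mul_proj (z : Module.End k Y ⊗[k] Module.End k W) :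
    trT k Y' W (mapL B.inc' _ z * (B.proj ⊗ₜ[k] 1)) = B.d⁻¹ * trT k Y W z := by
  induction z with
  | zero => simp
  | add a b ha hb => simp only [map_add, add_mul, mul_add, ha, hb]
  | tmul f s =>
    simp only [Algebra.TensorProduct.tmul_mul_tmul,
        Algebra.TensorProduct.map_tmul, AlgHom.id_apply, trT_tmul, mul_one]
    rw [← B.trace_cap_cup, proj, mul_smul_comm, map_smul, smul_eq_mul, mul_assoc]
    congr 2
    rw [Module.End.mul_eq_comp, ← LinearMap.comp_assoc, LinearMap.trace_comp_comm']

end BasicData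

theorem ad_apply {k B : Type u} [Field k] [Ring B] [Algebra k B] (u : Bˣ) (x : B) :
    ad (k := k) u x = u * x * (↑u⁻¹ : B) := rfl

namespace BasicData

theorem finrank_eq_mul {k X Y Y' : Type u} [Field k] [AddCommGroup X] [Module k X]
    [AddCommGroup Y] [Module k Y] [AddCommGroup Y'] [Module k Y'] [FiniteDimensional k Y]
    [FiniteDimensional k Y'] (B : BasicData k X Y Y') :
    (Module.finrank k Y' : k) = B.d * Module.finrank k Y := by
  have h := B.trace_inc' 1
  rwa [map_one, LinearMap.trace_one, LinearMap.trace_one] at h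

end BasicData

/-! ### Identified squares and their basic construction -/

section Stage

variable {k X Y Y' W : Type u} [Field k] [AddCommGroup X] [Module k X] [AddCommGroup Y]
  [Module k Y] [AddCommGroup Y'] [Module k Y'] [AddCommGroup W] [Module k W]

/-- An identification of a square with a square of the form `L(X) ⊗ L(W) ⊂ L(Y) ⊗ L(W)`, whose
lower right algebra is `U(L(Y) ⊗ k)U⁻¹`. -/
structure Stage (s : Square k) (inc : Module.End k X →ₐ[k] Module.End k Y)
    (U : (Module.End k Y ⊗[k] Module.End k W)ˣ) where
  /-- the identification of the smaller algebra -/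
  αA : s.A ≃ₐ[k] Module.End k X ⊗[k] Module.End k W
  /-- the identification of the bigger algebra -/
  αB : s.B ≃ₐ[k] Module.End k Y ⊗[k] Module.End k W
  αB_ι : ∀ a, αB (s.ι a) = mapL inc (Module.End k W) (αA a)
  /-- the normalization of the trace -/
  c : k
  c_mul : c * (Module.finrank k Y * Module.finrank k W) = 1
  τ_eq : ∀ b, s.τ b = c * trT k Y W (αB b)
  map_B₀ : s.B₀.map (αB : s.B →ₐ[k] Module.End k Y ⊗[k] Module.End k W) =
    ((ad U).comp (Algebra.TensorProduct.includeLeft : Module.End k Y →ₐ[k]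
      Module.End k Y ⊗[k] Module.End k W)).range

namespace Stage

variable [FiniteDimensional k X] [FiniteDimensional k Y] [FiniteDimensional k Y']
  [FiniteDimensional k W] {s : Square k} {B : BasicData k X Y Y'}
  {U : (Module.End k Y ⊗[k] Module.End k W)ˣ} (S : Stage s B.inc U)

theorem c_ne : S.c ≠ 0 := left_ne_zero_of_mul_eq_one S.c_mul

theorem condExp_eq (b : s.B) :
    s.condExp b = S.αA.symm (LinearMap.rTensor (Module.End k W) B.expect (S.αB b)) := by
  -- `condExp` is a choice with default 0, so existence comes before uniqueness; uniqueness follows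
  -- from the nondegeneracy of the trace on L(X) ⊗ L(W).
  have hex : ∃ E, s.IsCondExp E := by
    refine ⟨S.αA.symm.toLinearMap ∘ₗ LinearMap.rTensor (Module.End k W) B.expect ∘ₗ
      S.αB.toLinearMap, fun b a => ?_⟩
    rw [S.τ_eq, S.τ_eq, map_mul S.αB, map_mul S.αB, S.αB_ι, S.αB_ι, ← map_mul (mapL B.inc _),
      B.trT_mapL_inc, ← B.trT_expect]
    simp
  have h : s.condExp = hex.choose := dif_pos hex
  have hE := hex.choose_spec
  rw [← h] at hE
  refine S.αA.injective ?_
  rw [AlgEquiv.apply_symm_apply, ← sub_eq_zero]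
  refine eq_zero_of_trT_mul _ fun z => ?_
  obtain ⟨a, rfl⟩ := S.αA.surjective z
  have h1 := hE b a
  rw [S.τ_eq, S.τ_eq, map_mul S.αB, map_mul S.αB, S.αB_ι, S.αB_ι, ← map_mul (mapL B.inc _),
      B.trT_mapL_inc, ← B.trT_expect] at h1
  rw [sub_mul, map_sub, sub_eq_zero]
  exact mul_left_cancel₀ B.d_ne (mul_left_cancel₀ S.c_ne h1)

theorem αB_jones (b : s.B) :
    S.αB (s.jones b) = B.actT (Module.End k W) (B.proj ⊗ₜ[k] 1) (S.αB b) := by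
  rw [B.actT_proj]
  change S.αB (s.ι (s.condExp b)) = _
  rw [S.αB_ι, S.condExp_eq, AlgEquiv.apply_symm_apply]

/-- The representation of `L(Y') ⊗ L(W)` on the bigger algebra of the square. -/
def rep : Module.End k Y' ⊗[k] Module.End k W →ₐ[k] Module.End k s.B :=
  (S.αB.symm.toLinearEquiv.conjAlgEquiv k : _ →ₐ[k] _).comp (B.actT (Module.End k W))

theorem αB_rep (z : Module.End k Y' ⊗[k] Module.End k W) (b : s.B) :
    S.αB (S.rep z b) = B.actT (Module.End k W) z (S.αB b) := by
  change S.αB (S.αB.symm (B.actT (Module.End k W) z (S.αB b))) = _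
  rw [AlgEquiv.apply_symm_apply]

theorem rep_injective [Nontrivial X] : Function.Injective S.rep :=
  (S.αB.symm.toLinearEquiv.conjAlgEquiv k).injective.comp (B.actT_injective _)

theorem rep_mapL (b : s.B) :
    S.rep (mapL B.inc' (Module.End k W) (S.αB b)) = Algebra.lmul k s.B b := by
  ext z
  refine S.αB.injective ?_
  rw [S.αB_rep, B.actT_mapL]
  simp

theorem rep_proj : S.rep (B.proj ⊗ₜ[k] 1) = s.jones := by
  ext z
  refine S.αB.injective ?_
  rw [S.αB_rep, S.αB_jones]

theorem range_rep [Nontrivial X] : S.rep.range = s.basic := by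
  rw [← Algebra.map_top, ← B.adjoin_tensor_eq_top, AlgHom.map_adjoin, Square.basic, Set.image_union,
    Set.image_singleton, S.rep_proj]
  congr 2
  ext f
  constructor
  · rintro ⟨_, ⟨z, rfl⟩, rfl⟩
    obtain ⟨b, rfl⟩ := S.αB.surjective z
    exact ⟨b, (S.rep_mapL b).symm⟩
  · rintro ⟨b, rfl⟩
    exact ⟨_, ⟨_, rfl⟩, S.rep_mapL b⟩

/-- The identification of the basic construction. -/
def basicEquiv [Nontrivial X] : s.basic ≃ₐ[k] Module.End k Y' ⊗[k] Module.End k W :=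
  ((AlgEquiv.ofInjective S.rep S.rep_injective).trans
    (Subalgebra.equivOfEq _ _ S.range_rep)).symm

theorem basicEquiv_eq [Nontrivial X] {x : s.basic} {z : Module.End k Y' ⊗[k] Module.End k W}
    (h : S.rep z = x) : S.basicEquiv x = z := by
  rw [basicEquiv, AlgEquiv.symm_apply_eq]
  exact Subtype.ext h.symm

theorem basicEquiv_toBasic [Nontrivial X] (b : s.B) :
    S.basicEquiv (s.toBasic b) = mapL B.inc' (Module.End k W) (S.αB b) :=
  S.basicEquiv_eq (S.rep_mapL b)

theorem basicEquiv_jonesMem [Nontrivial X] : S.basicEquiv s.jonesMem = B.proj ⊗ₜ[k] 1 :=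
  S.basicEquiv_eq S.rep_proj

theorem c_div_mul : S.c / B.d * (Module.finrank k Y' * Module.finrank k W) = 1 := by
  rw [B.finrank_eq_mul, ← S.c_mul]
  have := B.d_ne
  field_simp

/-- On a matrix algebra a trace is determined up to a scalar, and the scalar is fixed by the value
at 1, which is prescribed by extending τ. -/
theorem markovExt_eq [Nontrivial X] (x : s.basic) :
    s.markovExt x = S.c / B.d * trT k Y' W (S.basicEquiv x) := by
  have hex : ∃ σ, s.IsMarkovExt σ := by
    -- The inclusion L(Y) ⊂ L(Y') multiplies the trace by d, whence c/d. Multiplying by the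
    -- projection brings a further d⁻¹ in place of that d, so β = d².
    refine ⟨(S.c / B.d) • (trT k Y' W ∘ₗ S.basicEquiv.toLinearMap), fun x y => ?_, fun b => ?_,
      B.d ^ 2, pow_ne_zero 2 B.d_ne, fun b => ?_⟩
    · simp only [LinearMap.smul_apply, LinearMap.comp_apply, AlgEquiv.toLinearMap_apply]
      rw [map_mul S.basicEquiv, map_mul S.basicEquiv, trT_mul_comm]
    · simp only [LinearMap.smul_apply, LinearMap.comp_apply, AlgEquiv.toLinearMap_apply]
      rw [S.basicEquiv_toBasic, B.trT_mapL_inc', S.τ_eq, smul_eq_mul, ← mul_assoc,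
        div_mul_cancel₀ _ B.d_ne]
    · simp only [LinearMap.smul_apply, LinearMap.comp_apply, AlgEquiv.toLinearMap_apply]
      rw [map_mul S.basicEquiv, S.basicEquiv_toBasic, S.basicEquiv_jonesMem, B.trT_mapL_mul_proj,
        S.τ_eq, smul_eq_mul]
      have := B.d_ne
      field_simp
  have h : s.markovExt = hex.choose := dif_pos hex
  obtain ⟨h1, h2, -⟩ := hex.choose_spec
  rw [← h] at h1 h2
  obtain ⟨c, hc⟩ := exists_eq_smul_trT (M := Y') (W := W)
    (s.markovExt ∘ₗ S.basicEquiv.symm.toLinearMap) (by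
      intro a b
      simp only [LinearMap.comp_apply, AlgEquiv.toLinearMap_apply, map_mul, h1])
  have h3 : c * (Module.finrank k Y' * Module.finrank k W) = 1 := by
    have h4 := hc 1
    rw [trT_one] at h4
    rw [← h4, LinearMap.comp_apply, AlgEquiv.toLinearMap_apply, map_one, ← map_one s.toBasic, h2,
      S.τ_eq, map_one, trT_one, S.c_mul]
  have h5 : c = S.c / B.d :=
    mul_right_cancel₀ (right_ne_zero_of_mul_eq_one h3) (h3.trans S.c_div_mul.symm)
  rw [← h5, ← hc]
  simp

/-- L commutes with the operators on the old factors, so conjugation by UL restricts to conjugation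
by U on them. -/
theorem ad_mapL {U' : (Module.End k Y' ⊗[k] Module.End k W)ˣ}
    {L : Module.End k Y' ⊗[k] Module.End k W} {inc' : Module.End k Y →ₐ[k] Module.End k Y'}
    (hU : (U' : Module.End k Y' ⊗[k] Module.End k W) = mapL inc' (Module.End k W) U * L)
    (hL : ∀ T, Commute (inc' T ⊗ₜ[k] (1 : Module.End k W)) L) (T : Module.End k Y) :
    ad (k := k) U' (inc' T ⊗ₜ[k] 1) = mapL inc' (Module.End k W) (ad (k := k) U (T ⊗ₜ[k] 1)) := by
  rw [ad_apply, Units.mul_inv_eq_iff_eq_mul, ad_apply, hU, map_mul, map_mul,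
    Algebra.TensorProduct.map_tmul, map_one, mul_assoc, ← (hL T).eq, mul_assoc (_ * _),
    ← mul_assoc (mapL inc' (Module.End k W) _) (mapL inc' (Module.End k W) _), ← map_mul,
    Units.inv_mul, map_one, one_mul, mul_assoc]

/-- The basic construction of an identified square. -/
def next [Nontrivial X] (U' : (Module.End k Y' ⊗[k] Module.End k W)ˣ)
    (L : Module.End k Y' ⊗[k] Module.End k W)
    (hU : (U' : Module.End k Y' ⊗[k] Module.End k W) = mapL B.inc' (Module.End k W) U * L)
    (hL : ∀ T, Commute (B.inc' T ⊗ₜ[k] (1 : Module.End k W)) L)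
    (hP : Commute ((B.cup ∘ₗ B.cap : Module.End k Y') ⊗ₜ[k] (1 : Module.End k W))
      (U' : Module.End k Y' ⊗[k] Module.End k W)) :
    Stage s.next B.inc' U' where
  αA := S.αB
  αB := S.basicEquiv
  αB_ι := S.basicEquiv_toBasic
  c := S.c / B.d
  c_mul := S.c_div_mul
  τ_eq := S.markovExt_eq
  map_B₀ := by
    have hP' : ad (k := k) U' (B.proj ⊗ₜ[k] 1) = B.proj ⊗ₜ[k] 1 := by
      rw [ad_apply, Units.mul_inv_eq_iff_eq_mul, BasicData.proj, ← TensorProduct.smul_tmul',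
        mul_smul_comm, smul_mul_assoc, hP.eq]
    change (Algebra.adjoin k (s.toBasic '' (s.B₀ : Set s.B) ∪ {s.jonesMem})).map
      (S.basicEquiv : s.basic →ₐ[k] Module.End k Y' ⊗[k] Module.End k W) = _
    -- L(Y') is generated by L(Y) and the projection, so U'(L(Y') ⊗ 1)U'⁻¹ is generated by U(L(Y) ⊗
    -- 1)U⁻¹ and, by `hP'`, the projection itself: the defining generators of the new lower algebra.
    rw [← Algebra.map_top, ← B.adjoin_eq_top, AlgHom.map_adjoin, AlgHom.map_adjoin,
      Set.image_union, Set.image_union, Set.image_singleton, Set.image_singleton]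
    congr 2
    · ext z
      constructor
      · rintro ⟨_, ⟨b, hb, rfl⟩, rfl⟩
        have h1 : S.αB b ∈ s.B₀.map (S.αB : s.B →ₐ[k] Module.End k Y ⊗[k] Module.End k W) :=
          ⟨b, hb, rfl⟩
        rw [S.map_B₀] at h1
        obtain ⟨T, hT⟩ := h1
        refine ⟨B.inc' T, ⟨T, rfl⟩, ?_⟩
        refine (ad_mapL hU hL T).trans ?_
        refine Eq.trans ?_ (S.basicEquiv_toBasic b).symm
        exact congrArg _ hT
      · rintro ⟨_, ⟨T, rfl⟩, rfl⟩
        have h1 : ad (k := k) U (T ⊗ₜ[k] 1) ∈ s.B₀.map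
            (S.αB : s.B →ₐ[k] Module.End k Y ⊗[k] Module.End k W) := by
          rw [S.map_B₀]
          exact ⟨T, rfl⟩
        obtain ⟨b, hb, hT⟩ := h1
        refine ⟨_, ⟨b, hb, rfl⟩, ?_⟩
        refine Eq.trans ?_ (ad_mapL hU hL T).symm
        refine (S.basicEquiv_toBasic b).trans ?_
        exact congrArg _ hT
    · rw [Set.singleton_eq_singleton_iff]
      exact S.basicEquiv_jonesMem.trans hP'.symm

end Stage

end Stage

/-! ### Where (⋆) enters: cup ∘ cap commutes with u ⊗ û and û ⊗ u -/

section Cup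

variable {k Z R : Type u} [Field k] [AddCommGroup Z] [Module k Z] [FiniteDimensional k Z]
  [Ring R] [Algebra k R]

/-- Expand in a basis and its dual basis: both sides are the matrix of B, read by rows or by
columns. -/
theorem lTensor_transpose_coevaluation (B : Module.End k Z) :
    LinearMap.lTensor Z (Module.Dual.transpose (R := k) B) (coevaluation k Z 1) =
      LinearMap.rTensor (Module.Dual k Z) B (coevaluation k Z 1) := by
  classical
  set b := Module.Basis.ofVectorSpace k Z
  have h1 : ∀ i, Module.Dual.transpose (R := k) B (b.coord i) =
      ∑ j, b.coord i (B (b j)) • b.coord j := fun i =>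
    (b.sum_dual_apply_smul_coord (Module.Dual.transpose (R := k) B (b.coord i))).symm
  have h2 : ∀ j, B (b j) = ∑ i, b.coord i (B (b j)) • b i := fun j => (b.sum_repr (B (b j))).symm
  rw [coevaluation_apply_one]
  simp only [map_sum, LinearMap.lTensor_tmul, LinearMap.rTensor_tmul]
  calc _ = ∑ i, ∑ j, b.coord i (B (b j)) • (b i ⊗ₜ[k] b.coord j) := by
        refine Finset.sum_congr rfl fun i _ => ?_
        refine (congrArg (fun z => b i ⊗ₜ[k] z) (h1 i)).trans ?_
        simp only [TensorProduct.tmul_sum, TensorProduct.tmul_smul]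
    _ = _ := by
        rw [Finset.sum_comm]
        refine Finset.sum_congr rfl fun j _ => ?_
        refine Eq.trans ?_ (congrArg (fun z => z ⊗ₜ[k] b.coord j) (h2 j).symm)
        simp only [TensorProduct.sum_tmul, TensorProduct.smul_tmul']

theorem cup_mul_lTensor (B : Module.End k Z) :
    (DualPair.canonical k Z).cup * Module.End.lTensorAlgHom k _ Z (Module.Dual.transpose (R := k) B) =
      (DualPair.canonical k Z).cup * Module.End.rTensorAlgHom k Z _ B := by
  ext a φ
  rfl

theorem lTensor_mul_cup (B : Module.End k Z) :
    Module.End.lTensorAlgHom k _ Z (Module.Dual.transpose (R := k) B) * (DualPair.canonical k Z).cup =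
      Module.End.rTensorAlgHom k Z _ B * (DualPair.canonical k Z).cup := by
  refine LinearMap.ext fun z => ?_
  refine (map_smul (LinearMap.lTensor Z (Module.Dual.transpose (R := k) B)) _ _).trans ?_
  refine Eq.trans ?_ (map_smul (LinearMap.rTensor _ B) _ _).symm
  exact congrArg _ (lTensor_transpose_coevaluation B)

theorem symm_cup_mul_rTensor (B : Module.End k Z) :
    (DualPair.canonical k Z).symm.cup *
        Module.End.rTensorAlgHom k _ Z (Module.Dual.transpose (R := k) B) =
      (DualPair.canonical k Z).symm.cup * Module.End.lTensorAlgHom k Z _ B := by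
  ext a φ
  rfl

theorem rTensor_mul_symm_cup (B : Module.End k Z) :
    Module.End.rTensorAlgHom k _ Z (Module.Dual.transpose (R := k) B) *
        (DualPair.canonical k Z).symm.cup =
      Module.End.lTensorAlgHom k Z _ B * (DualPair.canonical k Z).symm.cup := by
  have h : LinearMap.rTensor Z (Module.Dual.transpose (R := k) B) (DualPair.canonical k Z).symm.ξ =
      LinearMap.lTensor _ B (DualPair.canonical k Z).symm.ξ := by
    have h1 := congrArg (TensorProduct.comm k Z _) (lTensor_transpose_coevaluation B)
    have e1 : ∀ z, TensorProduct.comm k Z _ (LinearMap.lTensor Z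
        (Module.Dual.transpose (R := k) B) z) = LinearMap.rTensor Z
          (Module.Dual.transpose (R := k) B) (TensorProduct.comm k Z (Module.Dual k Z) z) :=
      fun z => (LinearMap.rTensor_comm _ z).symm
    have e2 : ∀ z, TensorProduct.comm k Z _ (LinearMap.rTensor (Module.Dual k Z) B z) =
        LinearMap.lTensor _ B (TensorProduct.comm k Z (Module.Dual k Z) z) :=
      fun z => (LinearMap.lTensor_comm _ z).symm
    rw [e1, e2] at h1
    exact h1
  refine LinearMap.ext fun z => ?_
  refine (map_smul (LinearMap.rTensor Z (Module.Dual.transpose (R := k) B)) _ _).trans ?_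
  refine Eq.trans ?_ (map_smul (LinearMap.lTensor _ B) _ _).symm
  exact congrArg _ h

/-- The evaluation carries x across to the dual factor as its transpose. In `legMul_mul_cup` the
coevaluation instead carries yᵗ back to the first factor as y. -/
theorem cup_mul_legMul (x y : Module.End k Z ⊗[k] R) :
    ((DualPair.canonical k Z).cup ⊗ₜ[k] 1) * legMul x (transposeLeft R y) =
      ((DualPair.canonical k Z).cup ⊗ₜ[k] 1) * mapL (Module.End.lTensorAlgHom k _ Z) R
        (transposeLeft R x * transposeLeft R y) := by
  induction x with
  | zero => simp [legMul]
  | add a b ha hb => simp only [map_add, add_mul, mul_add, legMul] at ha hb ⊢; rw [ha, hb]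
  | tmul A r =>
    induction y with
    | zero => simp [legMul]
    | add a b ha hb => simp only [map_add, mul_add, legMul] at ha hb ⊢; rw [ha, hb]
    | tmul B s =>
      simp only [legMul, transposeLeft, LinearMap.rTensor_tmul, Algebra.TensorProduct.map_tmul,
        Algebra.TensorProduct.tmul_mul_tmul, AlgHom.id_apply]
      rw [map_mul]
      simp only [← mul_assoc]
      rw [cup_mul_lTensor]

theorem legMul_mul_cup (x y : Module.End k Z ⊗[k] R) :
    legMul x (transposeLeft R y) * ((DualPair.canonical k Z).cup ⊗ₜ[k] 1) =
      mapL (Module.End.rTensorAlgHom k Z _) R (x * y) * ((DualPair.canonical k Z).cup ⊗ₜ[k] 1) := by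
  induction x with
  | zero => simp [legMul]
  | add a b ha hb => simp only [map_add, add_mul, legMul] at ha hb ⊢; rw [ha, hb]
  | tmul A r =>
    induction y with
    | zero => simp [legMul]
    | add a b ha hb => simp only [map_add, mul_add, add_mul, legMul] at ha hb ⊢; rw [ha, hb]
    | tmul B s =>
      simp only [legMul, transposeLeft, LinearMap.rTensor_tmul, Algebra.TensorProduct.map_tmul,
        Algebra.TensorProduct.tmul_mul_tmul, AlgHom.id_apply]
      rw [map_mul]
      simp only [mul_assoc]
      rw [lTensor_mul_cup]

theorem symm_cup_mul_legMul (x y : Module.End k Z ⊗[k] R) :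
    ((DualPair.canonical k Z).symm.cup ⊗ₜ[k] (1 : R)) * legMul (transposeLeft R y) x =
      ((DualPair.canonical k Z).symm.cup ⊗ₜ[k] (1 : R)) * mapL (Y := Module.Dual k Z ⊗[k] Z)
        (Module.End.lTensorAlgHom k Z (Module.Dual k Z)) R (y * x) := by
  induction x with
  | zero => simp [legMul]
  | add a b ha hb => simp only [map_add, mul_add, legMul] at ha hb ⊢; rw [ha, hb]
  | tmul A r =>
    induction y with
    | zero => simp [legMul]
    | add a b ha hb => simp only [map_add, mul_add, add_mul, legMul] at ha hb ⊢; rw [ha, hb]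
    | tmul B s =>
      simp only [legMul, transposeLeft, LinearMap.rTensor_tmul, Algebra.TensorProduct.map_tmul,
        Algebra.TensorProduct.tmul_mul_tmul, AlgHom.id_apply]
      rw [map_mul]
      simp only [← mul_assoc]
      rw [symm_cup_mul_rTensor]

theorem legMul_mul_symm_cup (x y : Module.End k Z ⊗[k] R) :
    legMul (transposeLeft R y) x * ((DualPair.canonical k Z).symm.cup ⊗ₜ[k] 1) =
      mapL (Module.End.rTensorAlgHom k _ Z) R (transposeLeft R y * transposeLeft R x) *
        ((DualPair.canonical k Z).symm.cup ⊗ₜ[k] 1) := by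
  induction x with
  | zero => simp [legMul]
  | add a b ha hb => simp only [map_add, add_mul, mul_add, legMul] at ha hb ⊢; rw [ha, hb]
  | tmul A r =>
    induction y with
    | zero => simp [legMul]
    | add a b ha hb => simp only [map_add, add_mul, legMul] at ha hb ⊢; rw [ha, hb]
    | tmul B s =>
      simp only [legMul, transposeLeft, LinearMap.rTensor_tmul, Algebra.TensorProduct.map_tmul,
        Algebra.TensorProduct.tmul_mul_tmul, AlgHom.id_apply]
      rw [map_mul]
      simp only [mul_assoc]
      rw [rTensor_mul_symm_cup]

variable {W : Type u} [AddCommGroup W] [Module k W]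

/-- Take x = u and y = u⁻¹. One side collapses by (⋆) and the other by u u⁻¹ = 1, so u ⊗ û fixes cup
∘ cap on both sides. -/
theorem commute_cup_hatUnit (u : (Module.End k Z ⊗[k] Module.End k W)ˣ) (hu : SatisfiesStar u) :
    Commute ((DualPair.canonical k Z).cup ⊗ₜ[k] 1)
      (legMul (u : Module.End k Z ⊗[k] Module.End k W)
        (hatUnit u hu : Module.End k (Module.Dual k Z) ⊗[k] Module.End k W)) := by
  refine (cup_mul_legMul (R := Module.End k W) (u : Module.End k Z ⊗[k] Module.End k W)
    (↑u⁻¹ : Module.End k Z ⊗[k] Module.End k W)).trans ?_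
  refine Eq.trans ?_ (legMul_mul_cup (R := Module.End k W) (u : Module.End k Z ⊗[k] Module.End k W)
    (↑u⁻¹ : Module.End k Z ⊗[k] Module.End k W)).symm
  rw [hu.1, Units.mul_inv, map_one, map_one, mul_one, one_mul]

theorem commute_symm_cup_hatUnit (u : (Module.End k Z ⊗[k] Module.End k W)ˣ)
    (hu : SatisfiesStar u) :
    Commute ((DualPair.canonical k Z).symm.cup ⊗ₜ[k] 1)
      (legMul (hatUnit u hu : Module.End k (Module.Dual k Z) ⊗[k] Module.End k W)
        (u : Module.End k Z ⊗[k] Module.End k W)) := by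
  refine (symm_cup_mul_legMul (R := Module.End k W) (u : Module.End k Z ⊗[k] Module.End k W)
    (↑u⁻¹ : Module.End k Z ⊗[k] Module.End k W)).trans ?_
  refine Eq.trans ?_ (legMul_mul_symm_cup (R := Module.End k W) (u : Module.End k Z ⊗[k] Module.End k W)
    (↑u⁻¹ : Module.End k Z ⊗[k] Module.End k W)).symm
  rw [hu.2, Units.inv_mul, map_one, map_one, mul_one, one_mul]

end Cup

/-! ### The square □_u as the bottom of the tower -/

section Base

variable {k A : Type u} [Field k] [Ring A] [Algebra k A]

theorem includeRight_bijective (R : Type u) [Ring R] [Algebra k R] : Function.Bijective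
    (Algebra.TensorProduct.includeRight : R →ₐ[k] Module.End k k ⊗[k] R) := by
  constructor
  · exact Algebra.TensorProduct.includeRight_injective (algebraMap k (Module.End k k)).injective
  · intro z
    induction z with
    | zero => exact ⟨0, by simp⟩
    | add a b ha hb =>
      obtain ⟨r, rfl⟩ := ha
      obtain ⟨s, rfl⟩ := hb
      exact ⟨r + s, map_add _ _ _⟩
    | tmul T r =>
      obtain ⟨c, rfl⟩ := exists_eq_algebraMap T
      refine ⟨c • r, ?_⟩
      rw [Algebra.algebraMap_eq_smul_one, TensorProduct.smul_tmul]
      rfl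

variable {V W : Type u} [AddCommGroup V] [Module k V] [FiniteDimensional k V] [Nontrivial V]
  [AddCommGroup W] [Module k W] [FiniteDimensional k W] [Nontrivial W]

variable (k V W) in
/-- The identification of `k ⊗ L(W) ⊂ L(V) ⊗ L(W)` with `L(k) ⊗ L(W)`. -/
def rightEquiv : (Algebra.TensorProduct.includeRight :
    Module.End k W →ₐ[k] Module.End k V ⊗[k] Module.End k W).range ≃ₐ[k]
      Module.End k k ⊗[k] Module.End k W :=
  (AlgEquiv.ofInjective _ (Algebra.TensorProduct.includeRight_injective
    (algebraMap k (Module.End k V)).injective)).symm.trans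
      (AlgEquiv.ofBijective _ (includeRight_bijective (Module.End k W)))

theorem rightEquiv_apply (r : Module.End k W) (h) :
    rightEquiv k V W ⟨1 ⊗ₜ[k] r, h⟩ = 1 ⊗ₜ[k] r := by
  have h1 : (AlgEquiv.ofInjective (Algebra.TensorProduct.includeRight :
      Module.End k W →ₐ[k] Module.End k V ⊗[k] Module.End k W)
      (Algebra.TensorProduct.includeRight_injective
        (algebraMap k (Module.End k V)).injective)).symm ⟨1 ⊗ₜ[k] r, h⟩ = r := by
    rw [AlgEquiv.symm_apply_eq]
    rfl
  rw [rightEquiv, AlgEquiv.trans_apply, h1]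
  rfl

variable (k V W) in
/-- The identification of `L(V) ⊗ L(W)` with `L(V ⊗ k) ⊗ L(W)`. -/
def unitEquiv : Module.End k V ⊗[k] Module.End k W ≃ₐ[k]
    Module.End k (V ⊗[k] k) ⊗[k] Module.End k W :=
  Algebra.TensorProduct.congr ((TensorProduct.rid k V).symm.conjAlgEquiv k) AlgEquiv.refl

theorem unitEquiv_tmul (T : Module.End k V) (r : Module.End k W) :
    unitEquiv k V W (T ⊗ₜ[k] r) = (TensorProduct.rid k V).symm.conjAlgEquiv k T ⊗ₜ[k] r := rfl

theorem conj_rid_symm (T : Module.End k V) :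
    (TensorProduct.rid k V).symm.conjAlgEquiv k T = Module.End.rTensorAlgHom k V k T := by
  refine Obj.conj_eq _ _ _ ?_
  ext a
  change (TensorProduct.rid k V).symm (T a) =
    Module.End.rTensorAlgHom k V k T ((TensorProduct.rid k V).symm a)
  rw [TensorProduct.rid_symm_apply, TensorProduct.rid_symm_apply]
  rfl

theorem unitEquiv_coe (a : (Module.End k V ⊗[k] Module.End k W)ˣ) :
    Units.map (unitEquiv k V W : _ →* _) a =
      legMulU a (1 : (Module.End k k ⊗[k] Module.End k W)ˣ) := by
  refine Units.ext ?_
  rw [coe_legMulU, legMul, Units.val_one, map_one, mul_one]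
  change unitEquiv k V W ↑a = _
  generalize (a : Module.End k V ⊗[k] Module.End k W) = z
  induction z with
  | zero => simp
  | add a b ha hb => simp only [map_add, ha, hb]
  | tmul T r => rw [unitEquiv_tmul, conj_rid_symm]; rfl

theorem trT_unitEquiv (z : Module.End k V ⊗[k] Module.End k W) :
    trT k (V ⊗[k] k) W (unitEquiv k V W z) = trT k V W z := by
  induction z with
  | zero => simp
  | add a b ha hb => simp only [map_add, ha, hb]
  | tmul T r =>
    rw [unitEquiv_tmul, trT_tmul, trT_tmul]
    congr 1
    exact LinearMap.trace_conj' T (TensorProduct.rid k V).symm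

variable [CharZero k]

/-- The identification of the square `□_u`. -/
def boxStage (inc : Module.End k k →ₐ[k] Module.End k (V ⊗[k] k))
    (a : (Module.End k V ⊗[k] Module.End k W)ˣ) :
    Stage (box a) inc (legMulU a (1 : (Module.End k k ⊗[k] Module.End k W)ˣ)) where
  αA := rightEquiv k V W
  αB := unitEquiv k V W
  αB_ι := by
    -- A_{01} contains only elements 1 ⊗ r, so any unital inclusion `inc` will do.
    rintro ⟨_, r, rfl⟩
    refine Eq.trans ?_ (congrArg (mapL inc (Module.End k W)) (rightEquiv_apply r ⟨r, rfl⟩)).symm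
    rw [Algebra.TensorProduct.map_tmul, map_one]
    refine (unitEquiv_tmul 1 r).trans ?_
    rw [map_one]
    rfl
  c := (Module.finrank k V * Module.finrank k W : k)⁻¹
  c_mul := by
    rw [Module.finrank_tensorProduct, Module.finrank_self, mul_one]
    -- Characteristic zero keeps the dimensions of V and W invertible in k.
    refine inv_mul_cancel₀ (mul_ne_zero ?_ ?_) <;>
    exact Nat.cast_ne_zero.2 Module.finrank_pos.ne'
  τ_eq b := (congrArg (fun z => (Module.finrank k V * Module.finrank k W : k)⁻¹ * z)
    (trT_unitEquiv b)).symm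
  map_B₀ := by
    change ((Algebra.TensorProduct.includeLeft : Module.End k V →ₐ[k]
      Module.End k V ⊗[k] Module.End k W).range.map (ad a)).map
      (unitEquiv k V W : _ →ₐ[k] Module.End k (V ⊗[k] k) ⊗[k] Module.End k W) = _
    rw [← unitEquiv_coe]
    have h : ∀ T : Module.End k V, unitEquiv k V W (ad (k := k) a (T ⊗ₜ[k] 1)) =
        ad (k := k) (Units.map (unitEquiv k V W : _ →* _) a)
          ((TensorProduct.rid k V).symm.conjAlgEquiv k T ⊗ₜ[k] 1) := by
      intro T
      rw [ad_apply, map_mul, map_mul, unitEquiv_tmul]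
      rfl
    ext z
    constructor
    · rintro ⟨_, ⟨_, ⟨T, rfl⟩, rfl⟩, rfl⟩
      exact ⟨_, (h T).symm⟩
    · rintro ⟨T, rfl⟩
      obtain ⟨T, rfl⟩ := ((TensorProduct.rid k V).symm.conjAlgEquiv k).surjective T
      exact ⟨_, ⟨_, ⟨T, rfl⟩, rfl⟩, h T⟩

end Base

/-! ### The tower of alternating products -/

section Tower

variable {k A W : Type u} [Field k] [CharZero k] [Ring A] [Algebra k A] [AddCommGroup W]
  [Module k W] [FiniteDimensional k W] [Nontrivial W] (x y : Obj k A)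
  [FiniteDimensional k x.X] [FiniteDimensional k y.X] [Nontrivial x.X] [Nontrivial y.X]
  (D : DualPair k x.X y.X) (hxy : Module.finrank k y.X = Module.finrank k x.X)

/-- The basic construction of `L(X_i) ⊂ L(X_{i+1})`, where `X_i` is the alternating tensor product
with `i` terms. -/
def wordBasic (i : ℕ) : BasicData k (Obj.word x y 0 i).X (Obj.word x y 0 (i + 1)).X
    (Obj.word x y 0 (i + 2)).X where
  inc := Obj.addRight x y 0 i
  inc' := Obj.addRight x y 0 (i + 1)
  cup := coev x y D 0 i
  cap := ev x y D 0 i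
  d := Module.finrank k x.X
  d_ne := Nat.cast_ne_zero.2 Module.finrank_pos.ne'
  inc_cup := addRight_addRight_coev x y D 0 i
  trace_inc := trace_addRight x y rfl hxy 0 i
  trace_inc' := trace_addRight x y rfl hxy 0 (i + 1)
  trace_cap_cup := trace_ev_addRight_coev x y D 0 i
  finrank_eq := by
    rw [finrank_word rfl hxy, finrank_word rfl hxy, finrank_word rfl hxy]
    ring

theorem commute_addRight_onLast {R : Type u} [Ring R] [Algebra k R] (j m : ℕ)
    (T : Module.End k (Obj.word x y j m).X)
    (z : Module.End k (Obj.alt x y (Obj.nextIndex j m)).X ⊗[k] R) :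
    Commute (Obj.addRight x y j m T ⊗ₜ[k] (1 : R)) (mapL (onLast x y j m) R z) := by
  have h := (Obj.commute_legs_left (Obj.word x y j m).X (Obj.alt x y (Obj.nextIndex j m)).X T
    z).map (Obj.cj (Obj.wordSnoc x y j m))
  rw [Obj.map_map_apply, Algebra.TensorProduct.map_tmul, map_one] at h
  exact h

variable (a : (Module.End k x.X ⊗[k] Module.End k W)ˣ)
  (b : (Module.End k y.X ⊗[k] Module.End k W)ˣ)
  (h : Commute (D.cup ⊗ₜ[k] (1 : Module.End k W))
    (legMul (a : Module.End k x.X ⊗[k] Module.End k W) ↑b))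
  (h' : Commute (D.symm.cup ⊗ₜ[k] (1 : Module.End k W))
    (legMul (b : Module.End k y.X ⊗[k] Module.End k W) ↑a))

/-- The identification of the tower of basic constructions of `□_u`. -/
def stage : (i : ℕ) →
    Stage ((box a).tower i) (Obj.addRight x y 0 i) (wordU x y a b 0 (i + 1))
  | 0 => boxStage _ a
  | i + 1 =>
    Stage.next (B := wordBasic x y D hxy i) (stage i) (wordU x y a b 0 (i + 2))
      (mapL (onLast x y 0 (i + 1)) (Module.End k W) (altU x y a b (Obj.nextIndex 0 (i + 1))))
      (coe_wordU_snoc x y a b 0 (i + 1)) (fun T => commute_addRight_onLast x y 0 (i + 1) T _)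
      (commute_coev_ev x y D a b h h' 0 i)

end Tower

/-! ### Endomorphisms of words in v and its contragredient -/

section Models

variable {k V W H : Type u} [Field k] [AddCommGroup V] [Module k V] [AddCommGroup W] [Module k W]
  [Ring H] [HopfAlgebra k H]

theorem transposeLeft_transposeRight {X : Type u} [AddCommGroup X] [Module k X]
    (z : Module.End k X ⊗[k] Module.End k W) :
    transposeLeft (Module.End k (Module.Dual k W)) (tR z) = tR (tL z) := by
  induction z with
  | zero => simp
  | add a b ha hb => simp only [map_add, ha, hb]
  | tmul S r => rfl

/-- The inverse `((id ⊗ t)u)₁₃ (u⁻¹)₁₂` of `u'`. -/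
def uPrimeInv (u : (Module.End k V ⊗[k] Module.End k W)ˣ) :
    Module.End k V ⊗[k] Module.End k (W ⊗[k] Module.Dual k W) :=
  mapR (A := Module.End k (Module.Dual k W)) V
      (Module.End.lTensorAlgHom k (Module.Dual k W) W)
      (tR (u : Module.End k V ⊗[k] Module.End k W)) *
    mapR V (Module.End.rTensorAlgHom k W (Module.Dual k W))
      (↑u⁻¹ : Module.End k V ⊗[k] Module.End k W)

theorem uPrime_mul_uPrimeInv (u : (Module.End k V ⊗[k] Module.End k W)ˣ) (hu : TransposeInv u) :
    uPrime u * uPrimeInv u = 1 := by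
  have h1 := congrArg (mapR (A := Module.End k (Module.Dual k W)) V
    (Module.End.lTensorAlgHom k (Module.Dual k W) W)) hu.2
  have h2 := congrArg (mapR V (Module.End.rTensorAlgHom k W (Module.Dual k W))) u.mul_inv
  rw [map_mul, map_one] at h1 h2
  rw [uPrime, uPrimeInv, mul_assoc]
  refine (congrArg (fun z => mapR V (Module.End.rTensorAlgHom k W (Module.Dual k W))
    (u : Module.End k V ⊗[k] Module.End k W) * z) ?_).trans h2
  refine (mul_assoc _ _ _).symm.trans ?_
  exact (congrArg (fun z => z * _) h1).trans (one_mul _)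

theorem commute_lTensorAlgHom_rTensorAlgHom (b : Module.End k (Module.Dual k W))
    (c : Module.End k W) :
    Commute (Module.End.lTensorAlgHom k (Module.Dual k W) W b)
      (Module.End.rTensorAlgHom k W (Module.Dual k W) c) :=
  TensorProduct.ext' fun _ _ => rfl

theorem transposeLeft_mapR_mul_mapR (a : Module.End k V ⊗[k] Module.End k (Module.Dual k W))
    (b : Module.End k V ⊗[k] Module.End k W) :
    transposeLeft (Module.End k (W ⊗[k] Module.Dual k W))
        (mapR (A := Module.End k (Module.Dual k W)) V
            (Module.End.lTensorAlgHom k (Module.Dual k W) W) a *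
          mapR V (Module.End.rTensorAlgHom k W (Module.Dual k W)) b) =
      mapR (Module.Dual k V) (Module.End.rTensorAlgHom k W (Module.Dual k W))
          (transposeLeft (Module.End k W) b) *
        mapR (A := Module.End k (Module.Dual k W)) (Module.Dual k V)
          (Module.End.lTensorAlgHom k (Module.Dual k W) W)
          (transposeLeft (Module.End k (Module.Dual k W)) a) :=
  transposeLeft_mul (X := V) (B := Module.End k (Module.Dual k W)) (C := Module.End k W)
    (Module.End k (W ⊗[k] Module.Dual k W)) _ _ commute_lTensorAlgHom_rTensorAlgHom a b

theorem uPrime_hatUnit (u : (Module.End k V ⊗[k] Module.End k W)ˣ) (hu : SatisfiesStar u) :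
    uPrime (hatUnit u hu) =
      mapR (Module.Dual k V) (Module.End.rTensorAlgHom k W (Module.Dual k W))
          (transposeLeft (Module.End k W) (↑u⁻¹ : Module.End k V ⊗[k] Module.End k W)) *
        mapR (A := Module.End k (Module.Dual k W)) (Module.Dual k V)
          (Module.End.lTensorAlgHom k (Module.Dual k W) W)
          (tR (tL (u : Module.End k V ⊗[k] Module.End k W))) := rfl

/-- Since v̂ is the transpose of v⁻¹, this says that π sends v̂ to the element û' attached to û. -/
theorem transposeLeft_uPrimeInv (u : (Module.End k V ⊗[k] Module.End k W)ˣ)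
    (hu : SatisfiesStar u) :
    transposeLeft (Module.End k (W ⊗[k] Module.Dual k W)) (uPrimeInv u) =
      uPrime (hatUnit u hu) := by
  rw [uPrime_hatUnit, uPrimeInv, transposeLeft_mapR_mul_mapR, transposeLeft_transposeRight]

theorem uPrime_one : uPrime (1 : (Module.End k V ⊗[k] Module.End k W)ˣ) = 1 := by
  rw [uPrime, inv_one, Units.val_one, transposeRight_one, map_one, map_one, mul_one]

theorem transposeInv_one : TransposeInv (1 : (Module.End k V ⊗[k] Module.End k W)ˣ) := by
  rw [TransposeInv, inv_one, Units.val_one, transposeRight_one, mul_one]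
  exact ⟨rfl, rfl⟩

theorem mapR_alt (π : H →ₐ[k] Module.End k (W ⊗[k] Module.Dual k W)) {x y : Obj k H}
    {a : (Module.End k x.X ⊗[k] Module.End k W)ˣ} {b : (Module.End k y.X ⊗[k] Module.End k W)ˣ}
    (hx : mapR x.X π x.el = uPrime a) (hy : mapR y.X π y.el = uPrime b) (j : ℕ) :
    mapR (Obj.alt x y j).X π (Obj.alt x y j).el = uPrime (altU x y a b j) := by
  induction j generalizing x y with
  | zero => exact hx
  | succ j ih => exact ih hy hx

theorem mapR_word (π : H →ₐ[k] Module.End k (W ⊗[k] Module.Dual k W)) {x y : Obj k H}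
    {a : (Module.End k x.X ⊗[k] Module.End k W)ˣ} {b : (Module.End k y.X ⊗[k] Module.End k W)ˣ}
    (hx : mapR x.X π x.el = uPrime a) (hy : mapR y.X π y.el = uPrime b) (j m : ℕ) :
    mapR (Obj.word x y j m).X π (Obj.word x y j m).el = uPrime (wordU x y a b j m) := by
  induction m generalizing j with
  | zero => exact (map_one (mapR k π)).trans uPrime_one.symm
  | succ m ih =>
    refine Eq.trans ?_ (uPrime_legMulU (altU x y a b j) (wordU x y a b (j + 1) m)).symm
    rw [← ih, ← mapR_alt π hx hy]
    refine (map_mul (mapR ((Obj.alt x y j).X ⊗[k] (Obj.word x y (j + 1) m).X) π) _ _).trans ?_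
    rw [mapR_mapL, mapR_mapL]

theorem transposeInv_alt {x y : Obj k H} {a : (Module.End k x.X ⊗[k] Module.End k W)ˣ}
    {b : (Module.End k y.X ⊗[k] Module.End k W)ˣ} (ha : TransposeInv a) (hb : TransposeInv b)
    (j : ℕ) : TransposeInv (altU x y a b j) := by
  induction j generalizing x y with
  | zero => exact ha
  | succ j ih => exact ih hb ha

theorem transposeInv_word {x y : Obj k H} {a : (Module.End k x.X ⊗[k] Module.End k W)ˣ}
    {b : (Module.End k y.X ⊗[k] Module.End k W)ˣ} (ha : TransposeInv a) (hb : TransposeInv b)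
    (j m : ℕ) : TransposeInv (wordU x y a b j m) := by
  induction m generalizing j with
  | zero => exact transposeInv_one
  | succ m ih => exact (transposeInv_alt ha hb j).legMul (ih (j + 1))

/-- Minimality replaces the word r by (id ⊗ π)r, which is U' for the matching product U of the u and
û; `commute_uPrime_iff` then applies. -/
theorem mem_latticeEnd_iff [Nontrivial W] {u : (Module.End k V ⊗[k] Module.End k W)ˣ}
    (hu : SatisfiesStar u) {v : Module.End k V ⊗[k] H}
    {π : H →ₐ[k] Module.End k (W ⊗[k] Module.Dual k W)} (hmin : IsMinimalModel (uPrime u) v π)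
    (j m : ℕ) (T : Module.End k (Obj.word (vObj v) (vHatObj v) j m).X) :
    T ∈ latticeEnd v j m ↔ Conjugable (wordU (vObj v) (vHatObj v) u (hatUnit u hu) j m) T := by
  have hv : IsCorep v := hmin.1.1.1
  have hπ : mapR V π v = uPrime u := hmin.1.1.2
  have hπ' : mapR (Module.Dual k V) π (contragredient v) = uPrime (hatUnit u hu) := by
    rw [contragredient_eq, mapR_transposeLeft]
    rw [← transposeLeft_uPrimeInv]
    -- (id ⊗ πS)v is a left inverse of u' because (id ⊗ S)v is one of v; it therefore equals the
    -- explicit right inverse.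
    refine congrArg _ (left_inv_eq_right_inv ?_ (uPrime_mul_uPrimeInv u hu.transposeInv))
    rw [← hπ, ← map_mul, hv.antipodeR_mul, map_one]
  have h1 := mapR_word (x := vObj v) (y := vHatObj v) π hπ hπ' j m
  have h2 : IsCorep (Obj.word (vObj v) (vHatObj v) j m).el :=
    IsCorep.word (x := vObj v) (y := vHatObj v) hv hv.contragredient j m
  rw [Obj.mem_endAlg, ← commute_uPrime_iff (transposeInv_word (x := vObj v) (y := vHatObj v)
    hu.transposeInv hu.transposeInv_hat j m), ← h1]
  constructor
  · intro h
    have h3 := (show Commute _ _ from h).map (mapR _ π)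
    rwa [Algebra.TensorProduct.map_tmul, map_one] at h3
  · exact fun h => hmin.commute_of_commute_mapR h2 h

end Models

/-! ### Commutants after adding a tensor factor -/

section Centralizers

variable {k R : Type u} [Field k] [Ring R] [Algebra k R]

section Shuffle

variable {X Z : Type u} [AddCommGroup X] [Module k X] [AddCommGroup Z] [Module k Z]
  [FiniteDimensional k X] [FiniteDimensional k Z]

variable (R X Z) in
/-- `(L(X) ⊗ R) ⊗ L(Z) → L(X ⊗ Z) ⊗ R`. -/
def shuffle : (Module.End k X ⊗[k] R) ⊗[k] Module.End k Z →ₐ[k] Module.End k (X ⊗[k] Z) ⊗[k] R :=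
  Algebra.TensorProduct.lift (mapL (Module.End.rTensorAlgHom k X Z) R)
    ((Algebra.TensorProduct.includeLeft : Module.End k (X ⊗[k] Z) →ₐ[k] _).comp
      (Module.End.lTensorAlgHom k Z X)) fun x T => (Obj.commute_legs_right X Z T x).symm

theorem shuffle_tmul (x : Module.End k X ⊗[k] R) (T : Module.End k Z) :
    shuffle R X Z (x ⊗ₜ[k] T) = mapL (Module.End.rTensorAlgHom k X Z) R x *
      (Module.End.lTensorAlgHom k Z X T ⊗ₜ[k] 1) := rfl

theorem shuffle_bijective : Function.Bijective (shuffle (k := k) R X Z) := by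
  convert ((TensorProduct.rightComm k (Module.End k X) R (Module.End k Z)).trans
    (TensorProduct.congr (endTensorEnd k X Z).toLinearEquiv (LinearEquiv.refl k R))).bijective
    using 1
  change ⇑(shuffle (k := k) R X Z).toLinearMap = ⇑(LinearEquiv.toLinearMap _)
  congr 1
  refine TensorProduct.ext_threefold fun S r T => ?_
  refine (shuffle_tmul (S ⊗ₜ[k] r) T).trans ?_
  rw [Algebra.TensorProduct.map_tmul, Algebra.TensorProduct.tmul_mul_tmul, mul_one,
    AlgHom.id_apply]
  refine congrArg (fun z => z ⊗ₜ[k] r) ?_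
  exact TensorProduct.ext' fun a b => rfl

/-- The centralizer in `L(X ⊗ Z) ⊗ R` of a subset of `L(X) ⊗ R`. -/
theorem centralizer_induction {C : Set (Module.End k X ⊗[k] R)}
    {P : Module.End k (X ⊗[k] Z) ⊗[k] R → Prop} (zero : P 0) (add : ∀ a b, P a → P b → P (a + b))
    (mul : ∀ (x : Module.End k X ⊗[k] R) (T : Module.End k Z), (∀ c ∈ C, Commute c x) →
      P (mapL (Module.End.rTensorAlgHom k X Z) R x * (Module.End.lTensorAlgHom k Z X T ⊗ₜ[k] 1)))
    (z : Module.End k (X ⊗[k] Z) ⊗[k] R)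
    (hz : ∀ c ∈ C, Commute (mapL (Module.End.rTensorAlgHom k X Z) R c) z) : P z := by
  obtain ⟨w, rfl⟩ := shuffle_bijective.2 z
  have hw : w ∈ Subalgebra.centralizer k (Algebra.TensorProduct.includeLeft (R := k) (S := k)
      (A := Module.End k X ⊗[k] R) (B := Module.End k Z) '' C) := by
    rw [Subalgebra.mem_centralizer_iff]
    rintro _ ⟨c, hc, rfl⟩
    refine shuffle_bijective.1 ?_
    have h1 : shuffle R X Z (Algebra.TensorProduct.includeLeft (S := k) c) =
        mapL (Module.End.rTensorAlgHom k X Z) R c := by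
      refine (shuffle_tmul c 1).trans ?_
      rw [map_one]
      exact mul_one _
    rw [map_mul, map_mul, h1]
    exact hz c hc
  -- The commutant of C ⊗ 1 in (L(X) ⊗ R) ⊗ L(Z) is C' ⊗ L(Z), C' being the commutant of C.
  rw [Subalgebra.centralizer_coe_image_includeLeft_eq_center_tensorProduct] at hw
  obtain ⟨y, rfl⟩ := hw
  clear hz
  induction y with
  | zero => rw [map_zero, map_zero]; exact zero
  | add a b ha hb => rw [map_add, map_add]; exact add _ _ ha hb
  | tmul x T =>
    obtain ⟨x, hx⟩ := x
    exact mul x T fun c hc => (Subalgebra.mem_centralizer_iff k).1 hx c hc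

end Shuffle

variable {A : Type u} [Ring A] [Algebra k A] (x y : Obj k A)

/-- The last letter of the short word is that of the long one, but its two indices agree only
propositionally; an existential statement avoids transporting operators between the two spaces. -/
theorem exists_onLast_eq (j m i : ℕ) (h : j + (m + 1) = i + 1)
    (T : Module.End k (Obj.alt x y (Obj.nextIndex j m)).X) :
    ∃ S, onLast x y 0 i S = emb x y j (m + 1) (i + 1) h (onLast x y j m T) := by
  induction j generalizing m with
  | zero =>
    obtain rfl : m = i := by omega
    exact ⟨T, rfl⟩
  | succ j ih =>
    obtain ⟨S, hS⟩ := ih (m + 1) (by omega) T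
    exact ⟨S, hS.trans (congrArg (emb x y j (m + 2) (i + 1) _) (onLast_succ x y j m T))⟩

theorem exists_emb_onLast_eq (j m i : ℕ) (h : j + (m + 1) = i + 1)
    (S : Module.End k (Obj.alt x y (Obj.nextIndex 0 i)).X) :
    ∃ T, emb x y j (m + 1) (i + 1) h (onLast x y j m T) = onLast x y 0 i S := by
  induction j generalizing m with
  | zero =>
    obtain rfl : m = i := by omega
    exact ⟨S, rfl⟩
  | succ j ih =>
    obtain ⟨T, hT⟩ := ih (m + 1) (by omega)
    exact ⟨T, (congrArg (emb x y j (m + 2) (i + 1) _) (onLast_succ x y j m T).symm).trans hT⟩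

theorem addRight_mul_onLast (j m : ℕ) (S : Module.End k (Obj.word x y j m).X)
    (T : Module.End k (Obj.alt x y (Obj.nextIndex j m)).X) :
    Obj.addRight x y j m S * onLast x y j m T =
      (Obj.wordSnoc x y j m).conjAlgEquiv k (TensorProduct.map S T) := by
  refine (map_mul ((Obj.wordSnoc x y j m).conjAlgEquiv k) _ _).symm.trans ?_
  refine congrArg ((Obj.wordSnoc x y j m).conjAlgEquiv k) ?_
  exact TensorProduct.ext' fun a b => rfl

variable [FiniteDimensional k x.X] [FiniteDimensional k y.X]

theorem snoc_induction (j m : ℕ) {P : Module.End k (Obj.word x y j (m + 1)).X → Prop}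
    (add : ∀ S T, P S → P T → P (S + T))
    (mul : ∀ S T, P (Obj.addRight x y j m S * onLast x y j m T))
    (T : Module.End k (Obj.word x y j (m + 1)).X) : P T := by
  obtain ⟨T, rfl⟩ := ((Obj.wordSnoc x y j m).conjAlgEquiv k).surjective T
  induction T using end_tensor_induction with
  | add S T hS hT => rw [map_add]; exact add _ _ hS hT
  | map S T => rw [← addRight_mul_onLast]; exact mul S T

theorem centralizer_snoc_induction (j m : ℕ) {C : Set (Module.End k (Obj.word x y j m).X ⊗[k] R)}
    {P : Module.End k (Obj.word x y j (m + 1)).X ⊗[k] R → Prop} (zero : P 0)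
    (add : ∀ a b, P a → P b → P (a + b))
    (mul : ∀ (z : Module.End k (Obj.word x y j m).X ⊗[k] R) T, (∀ c ∈ C, Commute c z) →
      P (mapL (Obj.addRight x y j m) R z * (onLast x y j m T ⊗ₜ[k] 1)))
    (z : Module.End k (Obj.word x y j (m + 1)).X ⊗[k] R)
    (hz : ∀ c ∈ C, Commute (mapL (Obj.addRight x y j m) R c) z) : P z := by
  let e : Module.End k ((Obj.word x y j m).X ⊗[k] (Obj.alt x y (Obj.nextIndex j m)).X) ⊗[k] R ≃ₐ[k]
      Module.End k (Obj.word x y j (m + 1)).X ⊗[k] R :=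
    Algebra.TensorProduct.congr ((Obj.wordSnoc x y j m).conjAlgEquiv k) AlgEquiv.refl
  have he : ∀ c, e (mapL (Module.End.rTensorAlgHom k _ _) R c) =
      mapL (Obj.addRight x y j m) R c := fun c => Obj.map_map_apply _ _ c
  obtain ⟨z, rfl⟩ := e.surjective z
  refine centralizer_induction (C := C) (P := fun z => P (e z)) (by rwa [map_zero])
    (fun a b ha hb => by rw [map_add]; exact add _ _ ha hb) (fun z T h => ?_) z fun c hc => ?_
  · rw [map_mul, he]
    exact mul z T h
  · refine e.injective ?_
    rw [map_mul, map_mul, he]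
    exact hz c hc

end Centralizers

/-! ### Higher relative commutants -/

section Lattice

variable {k A W : Type u} [Field k] [Ring A] [Algebra k A] [AddCommGroup W] [Module k W]
  (x y : Obj k A)
  [FiniteDimensional k x.X] [FiniteDimensional k y.X] {s : Square k}
  (α : ∀ i, s.upper i ≃ₐ[k] Module.End k (Obj.word x y 0 i).X ⊗[k] Module.End k W)

theorem commute_mapL_addRight_onLast {R : Type u} [Ring R] [Algebra k R] (j m : ℕ)
    (z : Module.End k (Obj.word x y j m).X ⊗[k] R)
    (T : Module.End k (Obj.alt x y (Obj.nextIndex j m)).X) :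
    Commute (mapL (Obj.addRight x y j m) R z) (onLast x y j m T ⊗ₜ[k] (1 : R)) := by
  have h := (Obj.commute_legs_right (Obj.word x y j m).X (Obj.alt x y (Obj.nextIndex j m)).X T
    z).map (Obj.cj (Obj.wordSnoc x y j m))
  rw [Obj.map_map_apply, Algebra.TensorProduct.map_tmul, map_one] at h
  exact h.symm

theorem upperIn_self (i : ℕ) : s.upperIn i i = ⊤ := by
  cases i with
  | zero => rfl
  | succ i => exact if_neg (by omega)

theorem exists_emb_eq_of_commute_top (i : ℕ) (h : i + 0 = i)
    (z : Module.End k (Obj.word x y 0 i).X ⊗[k] Module.End k W) (hz : ∀ c, Commute c z) :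
    ∃ T, z = emb x y i 0 i h T ⊗ₜ[k] 1 := by
  -- If W is zero the tensor algebra is zero; otherwise a central element is S ⊗ 1 with S central in
  -- L(X_i), thus a scalar.
  rcases subsingleton_or_nontrivial (Module.End k W) with hW | hW
  · refine ⟨0, ?_⟩
    have h1 : (1 : Module.End k W) = 0 := Subsingleton.elim _ _
    have h2 : (1 : Module.End k (Obj.word x y 0 i).X ⊗[k] Module.End k W) = 0 := by
      rw [Algebra.TensorProduct.one_def, h1, TensorProduct.tmul_zero]
    rw [← one_mul z, h2, zero_mul, h1, TensorProduct.tmul_zero]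
  obtain ⟨S, rfl⟩ := exists_eq_tmul_one_of_commute z fun c => hz _
  have hS : S ∈ Subalgebra.center k (Module.End k (Obj.word x y 0 i).X) := by
    rw [Subalgebra.mem_center_iff]
    intro T
    have h1 := hz (T ⊗ₜ[k] 1)
    rw [Commute, SemiconjBy, Algebra.TensorProduct.tmul_mul_tmul,
      Algebra.TensorProduct.tmul_mul_tmul, mul_one] at h1
    exact Algebra.TensorProduct.includeLeft_injective (S := k)
      (algebraMap k (Module.End k W)).injective h1
  rw [Algebra.IsCentral.center_eq_bot] at hS
  obtain ⟨c, rfl⟩ := hS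
  exact ⟨algebraMap k _ c, by rw [AlgHom.commutes]; rfl⟩

/-- The commutant of A_{j1} starts as the centre k of A_{j1}, and each further stage of the tower
tensors it with the operators on the new last factor. -/
theorem mem_centralizer_upperIn_iff
    (hα : ∀ i z, α (i + 1) (s.incl i z) = mapL (Obj.addRight x y 0 i) (Module.End k W) (α i z))
    (j m i : ℕ) (h : j + m = i) (z : s.upper i) :
    z ∈ Subalgebra.centralizer k (s.upperIn j i : Set (s.upper i)) ↔
      ∃ T, α i z = emb x y j m i h T ⊗ₜ[k] 1 := by
  rw [Subalgebra.mem_centralizer_iff]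
  induction m generalizing i with
  | zero =>
    obtain rfl : j = i := by omega
    rw [upperIn_self]
    constructor
    · intro hz
      refine exists_emb_eq_of_commute_top x y j h _ fun c => ?_
      obtain ⟨c, rfl⟩ := (α j).surjective c
      exact (show Commute c z from hz c trivial).map (α j)
    · rintro ⟨T, hT⟩ g -
      obtain ⟨c, hc⟩ := exists_eq_algebraMap (T : Module.End k k)
      have hc' : T = algebraMap k (Module.End k (Obj.word x y j 0).X) c := hc
      have h1 : α j z = algebraMap k _ c := by
        rw [hT, hc', AlgHom.commutes]
        rfl
      have h2 : z = algebraMap k _ c := by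
        refine (α j).injective ?_
        rw [h1, AlgEquiv.commutes]
      rw [h2, Algebra.commutes]
  | succ m ih =>
    cases i with
    | zero => omega
    | succ i =>
      have h0 : j + m = i := by omega
      have h1 : s.upperIn j (i + 1) = (s.upperIn j i).map (s.incl i) := if_pos (by omega)
      rw [h1]
      constructor
      · intro hz
        have hz' : ∀ c ∈ α i '' (s.upperIn j i : Set (s.upper i)),
            Commute (mapL (Obj.addRight x y 0 i) (Module.End k W) c) (α (i + 1) z) := by
          rintro _ ⟨c, hc, rfl⟩
          rw [← hα]
          exact (show Commute (s.incl i c) z from hz _ ⟨c, hc, rfl⟩).map (α (i + 1))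
        refine centralizer_snoc_induction x y 0 i (C := α i '' (s.upperIn j i : Set (s.upper i)))
          (P := fun w => ∃ T, w = emb x y j (m + 1) (i + 1) h T ⊗ₜ[k] 1)
          ⟨0, by rw [map_zero, TensorProduct.zero_tmul]⟩ ?_ ?_ _ hz'
        · rintro _ _ ⟨S, rfl⟩ ⟨T, rfl⟩
          exact ⟨S + T, by rw [map_add, TensorProduct.add_tmul]⟩
        · intro w S hw
          obtain ⟨w, rfl⟩ := (α i).surjective w
          obtain ⟨T, hT⟩ := (ih i h0 w).1 fun g hg => by
            refine (α i).injective ?_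
            rw [map_mul, map_mul]
            exact hw _ ⟨g, hg, rfl⟩
          obtain ⟨S', hS'⟩ := exists_emb_onLast_eq x y j m i h S
          refine ⟨Obj.addRight x y j m T * onLast x y j m S', ?_⟩
          rw [map_mul, emb_addRight x y j m i h0, hS', hT, Algebra.TensorProduct.map_tmul, map_one,
            Algebra.TensorProduct.tmul_mul_tmul, mul_one]
      · rintro ⟨T, hT⟩ _ ⟨g, hg, rfl⟩
        refine (α (i + 1)).injective ?_
        rw [map_mul, map_mul]
        change α (i + 1) (s.incl i g) * α (i + 1) z = α (i + 1) z * α (i + 1) (s.incl i g)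
        rw [hT, hα]
        clear hT
        change Commute _ _
        -- T may be taken to be a product of an operator on the earlier factors, handled by
        -- induction, and one on the last factor, which commutes with all of A_{i1}.
        induction T using snoc_induction with
        | add S T hS hT =>
          rw [map_add, TensorProduct.add_tmul]
          exact hS.add_right hT
        | mul S T =>
          obtain ⟨T', hT'⟩ := exists_onLast_eq x y j m i h T
          have e : emb x y j (m + 1) (i + 1) h (Obj.addRight x y j m S * onLast x y j m T) ⊗ₜ[k]
              (1 : Module.End k W) = mapL (Obj.addRight x y 0 i) (Module.End k W)
                (emb x y j m i h0 S ⊗ₜ[k] 1) * (onLast x y 0 i T' ⊗ₜ[k] 1) := by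
            rw [map_mul, emb_addRight x y j m i h0, hT', Algebra.TensorProduct.map_tmul, map_one,
              Algebra.TensorProduct.tmul_mul_tmul, mul_one]
          rw [e]
          refine Commute.mul_right ?_ ?_
          · have h2 := (ih i h0 ((α i).symm (emb x y j m i h0 S ⊗ₜ[k] 1))).2
              ⟨S, AlgEquiv.apply_symm_apply _ _⟩ g hg
            have h3 := (show Commute _ _ from h2).map (α i)
            rw [AlgEquiv.apply_symm_apply] at h3
            exact h3.map (mapL (Obj.addRight x y 0 i) (Module.End k W))
          · exact commute_mapL_addRight_onLast x y 0 i (α i g) T'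

variable [Nontrivial x.X] [Nontrivial y.X] [Nontrivial W]
  {a : (Module.End k x.X ⊗[k] Module.End k W)ˣ} {b : (Module.End k y.X ⊗[k] Module.End k W)ˣ}

theorem emb_tmul_one_injective (j m i : ℕ) (h : j + m = i) :
    Function.Injective fun T => emb x y j m i h T ⊗ₜ[k] (1 : Module.End k W) :=
  (Algebra.TensorProduct.includeLeft_injective (S := k)
    (algebraMap k (Module.End k W)).injective).comp (emb_injective x y j m i h)

theorem mem_relComm_iff
    (hα : ∀ i z, α (i + 1) (s.incl i z) = mapL (Obj.addRight x y 0 i) (Module.End k W) (α i z))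
    (hlow : ∀ i z T, α i z = T ⊗ₜ[k] 1 → (z ∈ s.lower i ↔ Conjugable (wordU x y a b 0 i) T))
    (hend : ∀ j m T, T ∈ (Obj.word x y j m).endAlg ↔ Conjugable (wordU x y a b j m) T)
    (j m i : ℕ) (h : j + m = i) (z : s.upper i) :
    z ∈ s.relComm i j ↔ ∃ T ∈ (Obj.word x y j m).endAlg, α i z = emb x y j m i h T ⊗ₜ[k] 1 := by
  change z ∈ Subalgebra.centralizer k (s.upperIn j i : Set (s.upper i)) ∧ z ∈ s.lower i ↔ _
  rw [mem_centralizer_upperIn_iff x y α hα j m i h]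
  constructor
  · rintro ⟨⟨T, hT⟩, hz⟩
    rw [hlow i z _ hT, conjugable_emb_iff, ← hend] at hz
    exact ⟨T, hz, hT⟩
  · rintro ⟨T, hT, hz⟩
    refine ⟨⟨T, hz⟩, ?_⟩
    rwa [hlow i z _ hz, conjugable_emb_iff, ← hend]

/-- The lattice of higher relative commutants is the lattice of endomorphisms of words. -/
theorem exists_lattice_equiv
    (hα : ∀ i z, α (i + 1) (s.incl i z) = mapL (Obj.addRight x y 0 i) (Module.End k W) (α i z))
    (hlow : ∀ i z T, α i z = T ⊗ₜ[k] 1 → (z ∈ s.lower i ↔ Conjugable (wordU x y a b 0 i) T))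
    (hend : ∀ j m T, T ∈ (Obj.word x y j m).endAlg ↔ Conjugable (wordU x y a b j m) T) :
    ∃ Φ : ∀ i j m : ℕ, j + m = i → (s.relComm i j ≃ₐ[k] (Obj.word x y j m).endAlg),
      (∀ (i j m : ℕ) (h : j + m = i) (h' : j + (m + 1) = i + 1) (hij : j ≤ i) (z : s.relComm i j),
        Φ (i + 1) j (m + 1) h' (s.horiz hij z) = Obj.endHoriz x y j m (Φ i j m h z)) ∧
      (∀ (i j m : ℕ) (h : (j + 1) + m = i) (h' : j + (m + 1) = i) (hij : j + 1 ≤ i)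
          (z : s.relComm i (j + 1)),
        Φ i j (m + 1) h' (s.vert hij z) = Obj.endVert x y j m (Φ i (j + 1) m h z)) := by
  have key : ∀ i j m (h : j + m = i), ∃ Φ : s.relComm i j ≃ₐ[k] (Obj.word x y j m).endAlg,
      ∀ z : s.relComm i j, α i z = emb x y j m i h (Φ z) ⊗ₜ[k] 1 := by
    intro i j m h
    have hmem := mem_relComm_iff x y α hα hlow hend j m i h
    -- The inverse isomorphism is explicit. The relation kept for Φ determines it, as `emb` followed
    -- by T ↦ T ⊗ 1 is injective, and compatibility with the inclusions is checked after that
    -- embedding.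
    let ψ : (Obj.word x y j m).endAlg →ₐ[k] s.relComm i j :=
      (((α i).symm : _ →ₐ[k] s.upper i).comp
        ((Algebra.TensorProduct.includeLeft : _ →ₐ[k] _ ⊗[k] Module.End k W).comp
          ((emb x y j m i h).comp (Obj.word x y j m).endAlg.val))).codRestrict _ fun T =>
        (hmem _).2 ⟨T, T.2, AlgEquiv.apply_symm_apply _ _⟩
    have hψ : ∀ T, α i (ψ T) = emb x y j m i h T ⊗ₜ[k] 1 := fun T =>
      AlgEquiv.apply_symm_apply _ _
    have hbij : Function.Bijective ψ := by
      constructor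
      · intro S T hST
        refine Subtype.ext (emb_tmul_one_injective (W := W) x y j m i h ?_)
        change emb x y j m i h S ⊗ₜ[k] (1 : Module.End k W) = emb x y j m i h T ⊗ₜ[k] 1
        rw [← hψ, ← hψ, hST]
      · rintro ⟨z, hz⟩
        obtain ⟨T, hT, hTz⟩ := (hmem z).1 hz
        exact ⟨⟨T, hT⟩, Subtype.ext ((α i).injective ((hψ ⟨T, hT⟩).trans hTz.symm))⟩
    refine ⟨(AlgEquiv.ofBijective ψ hbij).symm, fun z => ?_⟩
    rw [← hψ]
    exact congrArg (fun w : s.relComm i j => α i w)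
      ((AlgEquiv.ofBijective ψ hbij).apply_symm_apply z).symm
  choose Φ hΦ using key
  refine ⟨Φ, fun i j m h h' hij z => ?_, fun i j m h h' hij z => ?_⟩
  · refine Subtype.ext (emb_tmul_one_injective (W := W) x y j (m + 1) (i + 1) h' ?_)
    refine (hΦ (i + 1) j (m + 1) h' _).symm.trans ?_
    refine (hα i z).trans ?_
    rw [hΦ i j m h, Algebra.TensorProduct.map_tmul, map_one]
    exact congrArg (fun w => w ⊗ₜ[k] (1 : Module.End k W)) (emb_addRight x y j m i h h' _).symm
  · refine Subtype.ext (emb_tmul_one_injective (W := W) x y j (m + 1) i h' ?_)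
    refine (hΦ i j (m + 1) h' _).symm.trans ?_
    exact hΦ i (j + 1) m h z

end Lattice

/-! ### The lower algebras of the tower -/

section Lower

theorem Stage.mem_B₀_iff {k X Y W : Type u} [Field k] [AddCommGroup X] [Module k X]
    [AddCommGroup Y] [Module k Y] [AddCommGroup W] [Module k W] {s : Square k}
    {inc : Module.End k X →ₐ[k] Module.End k Y} {U : (Module.End k Y ⊗[k] Module.End k W)ˣ}
    (S : Stage s inc U) (z : s.B) (T : Module.End k Y) (hT : S.αB z = T ⊗ₜ[k] 1) :
    z ∈ s.B₀ ↔ Conjugable U T := by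
  have h1 : z ∈ s.B₀ ↔ S.αB z ∈ s.B₀.map
      (S.αB : s.B →ₐ[k] Module.End k Y ⊗[k] Module.End k W) := by
    constructor
    · exact fun h => ⟨z, h, rfl⟩
    · rintro ⟨w, hw, h⟩
      rwa [← S.αB.injective h]
  rw [h1, S.map_B₀, hT]
  refine exists_congr fun R => ?_
  change ad (k := k) U (R ⊗ₜ[k] 1) = _ ↔ _
  rw [ad_apply, Units.mul_inv_eq_iff_eq_mul, eq_comm]

variable {k A W : Type u} [Field k] [CharZero k] [Ring A] [Algebra k A] [AddCommGroup W]
  [Module k W] [FiniteDimensional k W] [Nontrivial W] (x y : Obj k A)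
  [FiniteDimensional k x.X] [FiniteDimensional k y.X] [Nontrivial x.X] [Nontrivial y.X]
  (D : DualPair k x.X y.X) (hxy : Module.finrank k y.X = Module.finrank k x.X)
  (a : (Module.End k x.X ⊗[k] Module.End k W)ˣ)
  (b : (Module.End k y.X ⊗[k] Module.End k W)ˣ)
  (h : Commute (D.cup ⊗ₜ[k] (1 : Module.End k W))
    (legMul (a : Module.End k x.X ⊗[k] Module.End k W) ↑b))
  (h' : Commute (D.symm.cup ⊗ₜ[k] (1 : Module.End k W))
    (legMul (b : Module.End k y.X ⊗[k] Module.End k W) ↑a))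

theorem mem_lower_iff (i : ℕ) (z : (box a).upper i) (T : Module.End k (Obj.word x y 0 i).X)
    (hT : (stage x y D hxy a b h h' i).αA z = T ⊗ₜ[k] 1) :
    z ∈ (box a).lower i ↔ Conjugable (wordU x y a b 0 i) T := by
  cases i with
  | zero =>
    -- At the bottom A_{00} = k while X_0 = k and U_0 = 1, so both conditions always hold. For i +
    -- 1, A_{i+1,0} is the lower right algebra of the i-th square.
    refine iff_of_true ?_ ⟨T, ?_⟩
    · obtain ⟨c, hc⟩ := exists_eq_algebraMap (T : Module.End k k)
      have hc' : T = algebraMap k (Module.End k (Obj.word x y 0 0).X) c := hc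
      have h1 : z = algebraMap k _ c := by
        refine (stage x y D hxy a b h h' 0).αA.injective ?_
        rw [hT, hc', AlgEquiv.commutes]
        rfl
      rw [h1]
      exact (⊥ : Subalgebra k (box a).A).algebraMap_mem c
    · exact (mul_one _).trans (one_mul _).symm
  | succ i => exact (stage x y D hxy a b h h' i).mem_B₀_iff z T hT

end Lower

end VertexModel

end

theorem theorem4p1 {k V W H : Type u} [Field k] [CharZero k]
    [AddCommGroup V] [Module k V] [FiniteDimensional k V] [Nontrivial V]
    [AddCommGroup W] [Module k W] [FiniteDimensional k W] [Nontrivial W]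
    (u : (Module.End k V ⊗[k] Module.End k W)ˣ) (hu : VertexModel.SatisfiesStar u)
    [Ring H] [HopfAlgebra k H] (v : Module.End k V ⊗[k] H)
    (π : H →ₐ[k] Module.End k (W ⊗[k] Module.Dual k W))
    (hmin : VertexModel.IsMinimalModel (VertexModel.uPrime u) v π) :
    ∃ Φ : ∀ i j m : ℕ, j + m = i →
        ((VertexModel.box u).relComm i j ≃ₐ[k] VertexModel.latticeEnd v j m),
      (∀ (i j m : ℕ) (h : j + m = i) (h' : j + (m + 1) = i + 1) (hij : j ≤ i)
          (x : (VertexModel.box u).relComm i j),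
        Φ (i + 1) j (m + 1) h' ((VertexModel.box u).horiz hij x) =
          VertexModel.Obj.endHoriz (VertexModel.vObj v) (VertexModel.vHatObj v) j m
            (Φ i j m h x)) ∧
      (∀ (i j m : ℕ) (h : (j + 1) + m = i) (h' : j + (m + 1) = i) (hij : j + 1 ≤ i)
          (x : (VertexModel.box u).relComm i (j + 1)),
        Φ i j (m + 1) h' ((VertexModel.box u).vert hij x) =
          VertexModel.Obj.endVert (VertexModel.vObj v) (VertexModel.vHatObj v) j m
            (Φ i (j + 1) m h x)) := by
  have : FiniteDimensional k (VertexModel.vObj v).X := inferInstanceAs (FiniteDimensional k V)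
  have : FiniteDimensional k (VertexModel.vHatObj v).X :=
    inferInstanceAs (FiniteDimensional k (Module.Dual k V))
  have : Nontrivial (VertexModel.vObj v).X := inferInstanceAs (Nontrivial V)
  have : Nontrivial (VertexModel.vHatObj v).X := inferInstanceAs (Nontrivial (Module.Dual k V))
  have hd : Module.finrank k (VertexModel.vHatObj v).X = Module.finrank k (VertexModel.vObj v).X :=
    Subspace.dual_finrank_eq (K := k) (V := V)
  let S := VertexModel.stage (VertexModel.vObj v) (VertexModel.vHatObj v)
    (VertexModel.DualPair.canonical k V) hd u (VertexModel.hatUnit u hu)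
    (VertexModel.commute_cup_hatUnit u hu) (VertexModel.commute_symm_cup_hatUnit u hu)
  exact VertexModel.exists_lattice_equiv (VertexModel.vObj v) (VertexModel.vHatObj v)
    (s := VertexModel.box u) (fun i => (S i).αA) (fun i z => (S i).αB_ι z)
    (VertexModel.mem_lower_iff _ _ _ hd u _ _ _) (VertexModel.mem_latticeEnd_iff hu hmin)
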